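/- **Setting.** Let $\Lambda$ be a finite set of labels. A *graph* is a finite directed multigraph with edges labelled in $\Lambda$ (loops and parallel edges allowed). A partial morphism $\varphi\colon G\rightharpoonup H$ is a pair of partial maps on nodes and edges that preserves labels, sources and targets of the edges on which it is defined, and is defined on the end nodes of every such edge. A *rule* is a partial morphism $r\colon L\rightharpoonup R$. A *match* of $r$ is a total morphism $m\colon L\to G$ that is conflict-free: if $m(x)=m(y)$, then $r$ is defined on both or on neither of $x,y$. A step $G\Rightarrow H$ is a pushout of $r$ and a match $m\colon L\to G$ with object $H$ in the category of graphs and partial morphisms. A *graph transformation system* (GTS) is a finite set of rules; it generates the relation $\Rightarrow$ on the set $S$ of all graphs. Write $G\sqsubseteq H$ if $G$ is isomorphic to a graph obtained from $H$ by deleting a set of nodes and all edges incident to them (induced subgraph order). For $n,k\in\mathbb N$ let $\mathcal G_{n,k}$ be the set of graphs in which every undirected path (without repeated nodes or edges) has at most $n$ edges and in which, for all nodes $u,v$ (possibly equal) and all labels $\lambda$, there are at most $k$ edges from $u$ to $v$ labelled $\lambda$. For sets $I$ of graphs, ${\uparrow} I$ is the upward closure and $\mathrm{Pred}(I)$ the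 set of direct predecessors. Algorithms operate on finite codes of graphs. **Theorem.** Let $n,k\in\mathbb N$, let $\mathcal R$ be a GTS, and write $Q=\mathcal G_{n,k}$. 1. $(S,\Rightarrow,\sqsubseteq)$ is a $Q$-restricted well-structured transition system: $Q$ is decidable and downward closed, $\sqsubseteq$ is a decidable quasi-order on $S$ and a well-quasi-order on $Q$, and if $s_1\sqsubseteq t_1$ and $s_1\Rightarrow s_2$ then $t_1\Rightarrow^* t_2$ for some $t_2\sqsupseteq s_2$. 2. It has an effective $Q$-pred-basis: there is an algorithm that, for every $q\in Q$, returns a finite set $pb_Q(q)\subseteq Q$ with ${\uparrow}pb_Q(q)={\uparrow}\bigl(\mathrm{Pred}({\uparrow}\{q\})\cap Q\bigr)$. 3. Consequently the results on coverability problems apply. Say that $s$ *covers* $t$ in a relation $\to$ if $s\to^* u$ for some $u\sqsupseteq t$, and let $\Rightarrow_Q$ be the restriction of $\Rightarrow$ to $Q\times Q$. The general coverability problem asks, for $s,t\in S$, whether $s$ covers $t$ in $\Rightarrow$; the restricted one asks, for $s,t\in Q$, whether $s$ covers $t$ in $\Rightarrow_Q$. (i) If there is an effective pred-basis (an algorithm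 returning for every $s\in S$ a finite set $pb(s)$ with ${\uparrow}pb(s)={\uparrow}\mathrm{Pred}({\uparrow}\{s\})$) and $Q=S$, then both problems coincide and are decidable. (ii) If $Q$ is closed under reachability, restricted coverability is decidable. (iii) Let $I={\uparrow}I_B$ with $I_B\subseteq Q$ finite, let $pb_Q$ be any $Q$-pred-basis, $I_0=I_B$ and $I_{j+1}=I_j\cup pb_Q(I_j)$. Then ${\uparrow}I_m={\uparrow}I_{m+1}$ for some $m$, and for each such $m$ and every $s$: if $s\in{\uparrow}I_m$, then $s$ covers an element of $I$ in $\Rightarrow$; if $s\notin{\uparrow}I_m$, then $s$ covers no element of $I$ in $\Rightarrow_Q$. (iv) If $pb$ is a pred-basis, $I={\uparrow}I_B$ with $I_B\subseteq S$ finite, $I_0=I_B$, $I_{j+1}=I_j\cup pb(I_j)$ and ${\uparrow}I_m={\uparrow}I_{m+1}$, then $s$ covers an element of $I$ in $\Rightarrow$ if and only if $s\in{\uparrow}I_m$. 4. Let $r\colon L\rightharpoonup R$ be a partial morphism and $m'\colon R\to G$ a total morphism. A *pushout complement* is a triple $(X,m,r')$ with $m\colon L\to X$ total and conflict-free with respect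 to $r$, $r'\colon X\rightharpoonup G$, such that $(G,m',r')$ is the pushout of $r$ and $m$. Start with all pushout complements with $X\in\mathcal G_{n,k}$ that are subgraph-minimal, i.e. no pushout complement $(X_0,m_0,r_0')$ with $X_0$ a proper subgraph of $X$, $m_0=m$ and $r_0'=r'|_{X_0}$ exists. Repeatedly add all triples obtained by adding to some $X$ one edge attached to at least one node on which $r'$ is undefined ($r'$ being undefined on the new edge), provided that no edge multiplicity exceeds $k$. After finitely many rounds this set is stationary; it then consists of pushout complements, contains only finitely many graphs up to isomorphism, and its $\sqsubseteq$-minimal graphs among those in $\mathcal G_{n,k}$ are exactly the $\sqsubseteq$-minimal elements of the set of pushout complement objects in $\mathcal G_{n,k}$. -/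

import Mathlib

namespace GraphWSTS

/-! ## Restricted well-structured transition systems -/

/-- A transition system together with a binary relation (the candidate order) on its states. -/
structure TransSys (S : Type*) where
  step : S → S → Prop
  le : S → S → Prop

section Abstract

variable {S : Type*} {C : Type*}

/-- Upward closure. -/
def TransSys.up (T : TransSys S) (I : Set S) : Set S := {x | ∃ y ∈ I, T.le y x}

/-- Direct predecessors. -/
def TransSys.pred (T : TransSys S) (I : Set S) : Set S := {s | ∃ s' ∈ I, T.step s s'}

/-- The restricted transition relation: both ends of the step lie in `Q`. -/
def TransSys.stepIn (T : TransSys S) (Q : Set S) (s t : S) : Prop := T.step s t ∧ s ∈ Q ∧ t ∈ Q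

/-- `Q` is downward closed, the order is a quasi-order on all states and a well-quasi-order on `Q`,
and the order is a weak simulation on all states. -/
structure IsRestrictedWSTS (T : TransSys S) (Q : Set S) : Prop where
  downClosed : ∀ s t, T.le s t → t ∈ Q → s ∈ Q
  refl : ∀ s, T.le s s
  trans : ∀ s t u, T.le s t → T.le t u → T.le s u
  wqo : ∀ f : ℕ → S, (∀ i, f i ∈ Q) → ∃ i j, i < j ∧ T.le (f i) (f j)
  compat : ∀ s₁ t₁ s₂, T.le s₁ t₁ → T.step s₁ s₂ →
    ∃ t₂, Relation.ReflTransGen T.step t₁ t₂ ∧ T.le s₂ t₂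

/-- General coverability: `s ⇒* u` for some `u ≥ t`. -/
def Covers (T : TransSys S) (s t : S) : Prop :=
  ∃ u, Relation.ReflTransGen T.step s u ∧ T.le t u

/-- Coverability by a run all of whose steps stay inside `Q`. -/
def RestrictedCovers (T : TransSys S) (Q : Set S) (s t : S) : Prop :=
  ∃ u, Relation.ReflTransGen (T.stepIn Q) s u ∧ T.le t u

/-- `B` is a basis of `I`. -/
def IsBasis (T : TransSys S) (B I : Set S) : Prop := I = T.up B

/-- The set of states denoted by a list of codes. -/
def codedSet (dec : C → S) (l : List C) : Set S := {s | ∃ c ∈ l, dec c = s}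

/-- `pb` sends (the code of) any state `s` to a finite basis of `↑Pred(↑{s})`. -/
def IsPredBasis (T : TransSys S) (dec : C → S) (pb : C → List C) : Prop :=
  ∀ c, IsBasis T (codedSet dec (pb c)) (T.up (T.pred (T.up {dec c})))

/-- `pb` sends (the code of) any state `q ∈ Q` to a finite basis, consisting of elements of `Q`,
of `↑(Pred(↑{q}) ∩ Q)`. -/
def IsQPredBasis (T : TransSys S) (dec : C → S) (Q : Set S) (pb : C → List C) : Prop :=
  ∀ c, dec c ∈ Q →
    (∀ b ∈ pb c, dec b ∈ Q) ∧
    IsBasis T (codedSet dec (pb c)) (T.up (T.pred (T.up {dec c}) ∩ Q))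

/-- Existence of an effective pred-basis. -/
def EffectivePredBasis [Primcodable C] (T : TransSys S) (dec : C → S) : Prop :=
  ∃ pb : C → List C, Computable pb ∧ IsPredBasis T dec pb

/-- Existence of an effective `Q`-pred-basis. -/
def EffectiveQPredBasis [Primcodable C] (T : TransSys S) (dec : C → S) (Q : Set S) : Prop :=
  ∃ pb : C → List C, Computable pb ∧ IsQPredBasis T dec Q pb

/-- The backward sequence `I₀ = I_B`, `I_{n+1} = I_n ∪ pb(I_n)`. -/
def backSeq (pb : C → List C) (IB : List C) : ℕ → List C
  | 0 => IB
  | n + 1 => backSeq pb IB n ++ (backSeq pb IB n).flatMap pb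

/-- The upward closure of the `m`-th member of the backward sequence. -/
def upSeq (T : TransSys S) (dec : C → S) (pb : C → List C) (IB : List C) (m : ℕ) : Set S :=
  T.up (codedSet dec (backSeq pb IB m))

/-- The general coverability problem is decidable. -/
def CoverabilityDecidable [Primcodable C] (T : TransSys S) (dec : C → S) : Prop :=
  ComputablePred fun p : C × C => Covers T (dec p.1) (dec p.2)

/-- The restricted coverability problem (whose inputs are pairs of states of `Q`) is decidable. -/
def RestrictedCoverabilityDecidable [Primcodable C] (T : TransSys S) (dec : C → S) (Q : Set S) :
    Prop :=
  ∃ f : C × C → Bool, Computable f ∧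
    ∀ s t, dec s ∈ Q → dec t ∈ Q → (f (s, t) = true ↔ RestrictedCovers T Q (dec s) (dec t))

/-- The four results on the coverability problems of a `Q`-restricted WSTS. -/
structure CoverabilityResults [Primcodable C] (T : TransSys S) (dec : C → S) (Q : Set S) :
    Prop where
  /-- With an effective pred-basis and all states in `Q`, the two problems coincide and are
  decidable. -/
  case_all : EffectivePredBasis T dec → (∀ s, s ∈ Q) →
    (∀ s t, RestrictedCovers T Q s t ↔ Covers T s t) ∧
    CoverabilityDecidable T dec ∧ RestrictedCoverabilityDecidable T dec Q
  /-- With an effective `Q`-pred-basis, restricted coverability is decidable if `Q` is closed under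
  reachability. -/
  case_special : EffectiveQPredBasis T dec Q → (∀ s t, s ∈ Q → T.step s t → t ∈ Q) →
    RestrictedCoverabilityDecidable T dec Q
  /-- Without closure of `Q`: the backward sequence becomes stationary, membership in the upward
  closure of its limit implies general coverability of a state of `I = ↑I_B`, and non-membership
  excludes restricted coverability. -/
  case_general : ∀ pb : C → List C, IsQPredBasis T dec Q pb →
    ∀ IB : List C, (∀ c ∈ IB, dec c ∈ Q) →
      (∃ m, upSeq T dec pb IB m = upSeq T dec pb IB (m + 1)) ∧
      ∀ m, upSeq T dec pb IB m = upSeq T dec pb IB (m + 1) → ∀ s,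
        (s ∈ upSeq T dec pb IB m → ∃ i ∈ T.up (codedSet dec IB), Covers T s i) ∧
        (s ∉ upSeq T dec pb IB m → ¬ ∃ i ∈ T.up (codedSet dec IB), RestrictedCovers T Q s i)
  /-- With a pred-basis, if the backward sequence is stationary at `m`, then membership in the
  upward closure of its `m`-th member is equivalent to general coverability of a state of `I`. -/
  case_hope : ∀ pb : C → List C, IsPredBasis T dec pb → ∀ IB : List C, ∀ m,
    upSeq T dec pb IB m = upSeq T dec pb IB (m + 1) → ∀ s,
      (∃ i ∈ T.up (codedSet dec IB), Covers T s i) ↔ s ∈ upSeq T dec pb IB m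

end Abstract

/-! ## Directed edge-labelled graphs -/

/-- Finite directed multigraphs with edge labels in `Λ`. -/
structure DGraph (Λ : Type) where
  V : Type
  E : Type
  finV : Finite V
  finE : Finite E
  src : E → V
  tgt : E → V
  lab : E → Λ

variable {Λ : Type}

/-- Isomorphisms of graphs. -/
structure GIso (G H : DGraph Λ) where
  onV : G.V ≃ H.V
  onE : G.E ≃ H.E
  src_eq : ∀ e, H.src (onE e) = onV (G.src e)
  tgt_eq : ∀ e, H.tgt (onE e) = onV (G.tgt e)
  lab_eq : ∀ e, H.lab (onE e) = G.lab e

/-- The graph obtained by keeping the nodes in `W`, i.e. deleting all other nodes together with all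
edges incident to a deleted node. -/
def DGraph.induce (G : DGraph Λ) (W : Set G.V) : DGraph Λ where
  V := W
  E := {e : G.E // G.src e ∈ W ∧ G.tgt e ∈ W}
  finV := have := G.finV; inferInstance
  finE := have := G.finE; inferInstance
  src e := ⟨G.src e.1, e.2.1⟩
  tgt e := ⟨G.tgt e.1, e.2.2⟩
  lab e := G.lab e.1

/-- `G` is (up to isomorphism) an induced subgraph of `H`. -/
def IndSub (G H : DGraph Λ) : Prop := ∃ W : Set H.V, Nonempty (GIso G (H.induce W))

/-- The node `v` occurs among the ends of `e`. -/
def DGraph.Incident (G : DGraph Λ) (e : G.E) (v : G.V) : Prop := G.src e = v ∨ G.tgt e = v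

/-- Elementary undirected paths `v₀, e₁, v₁, …, e_l, v_l` of length `l`. -/
def DGraph.IsPath (G : DGraph Λ) (l : ℕ) (v : Fin (l + 1) → G.V) (e : Fin l → G.E) : Prop :=
  Function.Injective v ∧ Function.Injective e ∧
    ∀ i : Fin l, G.Incident (e i) (v i.castSucc) ∧ G.Incident (e i) (v i.succ)

/-- At most `k` parallel edges with the same label from `u` to `v`, for all (possibly equal) nodes
`u` and `v`. -/
def DGraph.MultBounded (G : DGraph Λ) (k : ℕ) : Prop :=
  ∀ (u v : G.V) (a : Λ), Nat.card {e : G.E // G.src e = u ∧ G.tgt e = v ∧ G.lab e = a} ≤ k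

/-- Graphs with undirected paths of length at most `n` and edge multiplicity at most `k`. -/
def boundedGraphs (Λ : Type) (n k : ℕ) : Set (DGraph Λ) :=
  {G | (∀ l v e, G.IsPath l v e → l ≤ n) ∧ G.MultBounded k}

/-- Partial graph morphisms; `none` means undefined. -/
structure PHom (G H : DGraph Λ) where
  onV : G.V → Option H.V
  onE : G.E → Option H.E
  lab_eq : ∀ e e', onE e = some e' → H.lab e' = G.lab e
  src_eq : ∀ e e', onE e = some e' → onV (G.src e) = some (H.src e')
  tgt_eq : ∀ e e', onE e = some e' → onV (G.tgt e) = some (H.tgt e')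

/-- Composition of partial morphisms, `ψ ∘ φ`. -/
def PHom.comp {G H K : DGraph Λ} (ψ : PHom H K) (φ : PHom G H) : PHom G K where
  onV x := (φ.onV x).bind ψ.onV
  onE e := (φ.onE e).bind ψ.onE
  lab_eq e e' h := by
    obtain ⟨d, hd, hd'⟩ := Option.bind_eq_some_iff.1 h
    rw [ψ.lab_eq d e' hd', φ.lab_eq e d hd]
  src_eq e e' h := by
    obtain ⟨d, hd, hd'⟩ := Option.bind_eq_some_iff.1 h
    rw [φ.src_eq e d hd]; exact ψ.src_eq d e' hd'
  tgt_eq e e' h := by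
    obtain ⟨d, hd, hd'⟩ := Option.bind_eq_some_iff.1 h
    rw [φ.tgt_eq e d hd]; exact ψ.tgt_eq d e' hd'

/-- Total morphisms. -/
def PHom.Total {G H : DGraph Λ} (φ : PHom G H) : Prop :=
  (∀ x, φ.onV x ≠ none) ∧ (∀ e, φ.onE e ≠ none)

/-- The square `ψ' ∘ φ = φ' ∘ ψ` is a pushout in the category of partial graph morphisms. -/
def IsPushout {G₀ G₁ G₂ G₃ : DGraph Λ} (φ : PHom G₀ G₁) (ψ : PHom G₀ G₂)
    (ψ' : PHom G₁ G₃) (φ' : PHom G₂ G₃) : Prop :=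
  ψ'.comp φ = φ'.comp ψ ∧
    ∀ (K : DGraph Λ) (ψ'' : PHom G₁ K) (φ'' : PHom G₂ K), ψ''.comp φ = φ''.comp ψ →
      ∃! η : PHom G₃ K, η.comp ψ' = ψ'' ∧ η.comp φ' = φ''

/-- `m` is conflict-free with respect to `r`: elements identified by `m` are either all preserved or
all deleted by `r`. (Used for total `m`.) -/
def ConflictFree {L R G : DGraph Λ} (r : PHom L R) (m : PHom L G) : Prop :=
  (∀ x y, m.onV x = m.onV y → (r.onV x = none ↔ r.onV y = none)) ∧
  (∀ x y, m.onE x = m.onE y → (r.onE x = none ↔ r.onE y = none))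

/-- Rewriting rules. -/
structure Rule (Λ : Type) where
  L : DGraph Λ
  R : DGraph Λ
  r : PHom L R

/-- `G` can be rewritten to `H` by `ρ` (single-pushout approach, conflict-free total matches). -/
def Rewrites (ρ : Rule Λ) (G H : DGraph Λ) : Prop :=
  ∃ (m : PHom ρ.L G) (m' : PHom ρ.R H) (r' : PHom G H),
    m.Total ∧ ConflictFree ρ.r m ∧ IsPushout ρ.r m m' r'

/-- The transition system on all graphs generated by a set of rules, with the induced subgraph
order. -/
def gts (rules : Set (Rule Λ)) : TransSys (DGraph Λ) where
  step G H := ∃ ρ ∈ rules, Rewrites ρ G H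
  le := IndSub

/-! ## Codes for graphs -/

/-- A finite description of a graph: the number of nodes, and the list of edges given by label,
source and target. -/
abbrev GraphCode (Λ : Type) : Type :=
  {p : ℕ × List (Λ × ℕ × ℕ) // ∀ e ∈ p.2, e.2.1 < p.1 ∧ e.2.2 < p.1}

theorem primrecPred_graphCode (Λ : Type) [Primcodable Λ] :
    PrimrecPred fun p : ℕ × List (Λ × ℕ × ℕ) => ∀ e ∈ p.2, e.2.1 < p.1 ∧ e.2.2 < p.1 := by
  have h1 : PrimrecRel fun (e : Λ × ℕ × ℕ) (n : ℕ) => e.2.1 < n ∧ e.2.2 < n := by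
    refine PrimrecPred.and ?_ ?_
    · exact Primrec.nat_lt.comp
        (Primrec.fst.comp (Primrec.snd.comp Primrec.fst)) Primrec.snd
    · exact Primrec.nat_lt.comp
        (Primrec.snd.comp (Primrec.snd.comp Primrec.fst)) Primrec.snd
  exact h1.forall_mem_list.comp Primrec.snd Primrec.fst

instance instPrimcodableGraphCode (Λ : Type) [Primcodable Λ] : Primcodable (GraphCode Λ) :=
  Primcodable.subtype (primrecPred_graphCode Λ)

/-- The graph described by a code. -/
def GraphCode.toGraph (c : GraphCode Λ) : DGraph Λ where
  V := Fin c.1.1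
  E := Fin c.1.2.length
  finV := inferInstance
  finE := inferInstance
  src i := ⟨(c.1.2.get i).2.1, (c.2 _ (List.get_mem _ _)).1⟩
  tgt i := ⟨(c.1.2.get i).2.2, (c.2 _ (List.get_mem _ _)).2⟩
  lab i := (c.1.2.get i).1

/-- Every graph has a code, up to isomorphism. -/
theorem GraphCode.exists_iso (G : DGraph Λ) : ∃ c : GraphCode Λ, Nonempty (GIso c.toGraph G) := by
  have hV := G.finV
  have hE := G.finE
  obtain ⟨n, ⟨f⟩⟩ := Finite.exists_equiv_fin G.V
  obtain ⟨k, ⟨g⟩⟩ := Finite.exists_equiv_fin G.E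
  let l : List (Λ × ℕ × ℕ) := List.ofFn fun i : Fin k =>
    (G.lab (g.symm i), ((f (G.src (g.symm i)) : Fin n) : ℕ), ((f (G.tgt (g.symm i)) : Fin n) : ℕ))
  have hl : l.length = k := List.length_ofFn
  have hget : ∀ i : Fin l.length, l.get i = (G.lab (g.symm (Fin.cast hl i)),
      ((f (G.src (g.symm (Fin.cast hl i))) : Fin n) : ℕ),
      ((f (G.tgt (g.symm (Fin.cast hl i))) : Fin n) : ℕ)) := fun i => by
    simp [l]
    exact ⟨rfl, rfl, rfl⟩
  have hc : ∀ e ∈ l, e.2.1 < n ∧ e.2.2 < n := by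
    intro e he
    obtain ⟨i, rfl⟩ := List.mem_ofFn.1 he
    exact ⟨Fin.is_lt _, Fin.is_lt _⟩
  let eqE : Fin l.length ≃ G.E := (finCongr hl).trans g.symm
  refine ⟨⟨(n, l), hc⟩, ⟨GIso.mk (G := GraphCode.toGraph ⟨(n, l), hc⟩) f.symm eqE ?_ ?_ ?_⟩⟩
  · intro (i : Fin l.length)
    refine (Equiv.eq_symm_apply f).2 (Fin.ext ?_)
    exact (congrArg (fun t => t.2.1) (hget i)).symm
  · intro (i : Fin l.length)
    refine (Equiv.eq_symm_apply f).2 (Fin.ext ?_)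
    exact (congrArg (fun t => t.2.2) (hget i)).symm
  · intro (i : Fin l.length)
    exact (congrArg (fun t => t.1) (hget i)).symm

/-! ## Pushout complements and the saturation procedure -/

/-- The data of a square completing `r : L ⇀ R` and `m' : R → G`: a graph `X` with morphisms
`m : L ⇀ X` and `r' : X ⇀ G`. -/
structure Completion {L R G : DGraph Λ} (r : PHom L R) (m' : PHom R G) where
  X : DGraph Λ
  m : PHom L X
  r' : PHom X G

section Complements

variable {L R G : DGraph Λ} {r : PHom L R} {m' : PHom R G}

/-- Pushout complements with total, conflict-free `m`. -/
def Completion.IsComplement (P : Completion r m') : Prop :=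
  P.m.Total ∧ ConflictFree r P.m ∧ IsPushout r P.m m' P.r'

/-- `ι` is an embedding of `P.X` as a subgraph of `P'.X` that is compatible with the
other morphisms. -/
def Completion.IsEmbedding (P P' : Completion r m') (ι : PHom P.X P'.X) : Prop :=
  ι.Total ∧ Function.Injective ι.onV ∧ Function.Injective ι.onE ∧
    ι.comp P.m = P'.m ∧ P'.r'.comp ι = P.r'

/-- Pushout complements that are minimal with respect to the subgraph ordering: no pushout
complement embeds into `P` as a proper subgraph. -/
def Completion.IsSubgraphMinimal (P : Completion r m') : Prop :=
  P.IsComplement ∧ ∀ P₀ : Completion r m', P₀.IsComplement →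
    ∀ ι : PHom P₀.X P.X, P₀.IsEmbedding P ι →
      (∀ y, ∃ x, ι.onV x = some y) ∧ (∀ d, ∃ e, ι.onE e = some d)

/-- `P'` arises from `P` by adding one edge that is attached to at least one node on which the
morphism `r'` is undefined. -/
def Completion.AddEdge (P P' : Completion r m') : Prop :=
  ∃ ι : PHom P.X P'.X, P.IsEmbedding P' ι ∧ (∀ y, ∃ x, ι.onV x = some y) ∧
    ∃ d : P'.X.E, (∀ d', (∃ e, ι.onE e = some d') ↔ d' ≠ d) ∧
      (P'.r'.onV (P'.X.src d) = none ∨ P'.r'.onV (P'.X.tgt d) = none)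

/-- The working set after `i` rounds: start with the subgraph-minimal pushout complements in
`boundedGraphs Λ n k`, then repeatedly add edges attached to deleted nodes, never exceeding edge
multiplicity `k`. -/
def saturation (r : PHom L R) (m' : PHom R G) (n k : ℕ) : ℕ → Set (Completion r m')
  | 0 => {P | P.IsSubgraphMinimal ∧ P.X ∈ boundedGraphs Λ n k}
  | i + 1 => saturation r m' n k i ∪
      {P' | P'.X.MultBounded k ∧ ∃ P ∈ saturation r m' n k i, P.AddEdge P'}

/-- The graphs underlying a set of completions. -/
def objects (A : Set (Completion r m')) : Set (DGraph Λ) := {X | ∃ P ∈ A, P.X = X}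

end Complements

/-- The elements of `A` that are minimal with respect to the induced subgraph order. -/
def indMinimal (A : Set (DGraph Λ)) : Set (DGraph Λ) :=
  {X | X ∈ A ∧ ∀ Y ∈ A, IndSub Y X → IndSub X Y}

end GraphWSTS

open GraphWSTS

namespace GraphWSTS

/-! ## Computability of folds over lists -/

section ListComputable

variable {α β σ : Type*} [Primcodable α] [Primcodable β] [Primcodable σ]

/-! The universal property of a pushout quantifies over all graphs, so pushouts are first made
explicit. For a total conflict-free match, a square is a pushout exactly when its node and edge
parts satisfy the elementary conditions `SetSquare`, and an item disappears only if it is matched by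
a deleted item or is an edge with a deleted end (`isPushout_iff_isSquare`). All later arguments use
this form.

Compatibility: when a match is prolonged along an induced embedding, the comparison morphism between
the two pushouts is again an induced embedding (`IsSquare.exists_indEmb`), so one step is simulated
by one step.

Pred-basis: given a step into a graph above `K`, keep only the nodes of the match and one preimage
for each node of `K` that has one. The step survives on this induced subgraph, which has at most
`|L| + |K|` nodes (`Rewrites.exists_induce`). Inside `Q` the multiplicity bound also bounds the
edges, so a basis is obtained by filtering a finite list of codes by decidable conditions
(`effectiveQPredBasis_gts`). Pushout complements play no role there.

Well-quasi-order: bounded paths give bounded tree-depth. By induction on tree-depth, each component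
loses a root, the edges to and from that root are stored in finite labels on the remaining vertices,
and the lists of components are compared by Higman's lemma (`wellQuasiOrdered_treeDepthLE`). Bounded
multiplicity keeps the adjacency data finite.

Coverability: a backward sequence that never became stationary would produce a bad sequence in `Q`
(`exists_upSeq_eq_succ`). Compatibility gives soundness, and stationarity gives completeness for the
runs whose steps the basis sees.

Saturation: a complement has at most `|L| + |G|` nodes, and each added edge raises the edge count,
so the process stops. A complement that is minimal for `⊑` has the same nodes as every complement
inside it, so it differs from a subgraph-minimal one only by edges at deleted nodes; these are put
back one at a time (`exists_mem_saturation`). -/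

theorem computable_foldl {f : α → List β} {g : α → σ} {h : α → σ → β → σ} (hf : Computable f)
    (hg : Computable g) (hh : Computable fun x : α × σ × β => h x.1 x.2.1 x.2.2) :
    Computable fun a => (f a).foldl (h a) (g a) := by
  have key : Computable fun a => Nat.rec (motive := fun _ => σ) (g a)
      (fun i s => Option.casesOn (motive := fun _ => σ) ((f a)[i]?) s fun b => h a s b)
      (f a).length := by
    refine Computable.nat_rec (h := fun a (x : ℕ × σ) =>
      Option.casesOn (motive := fun _ => σ) ((f a)[x.1]?) x.2 fun b => h a x.2 b)
      (Computable.list_length.comp hf) hg ?_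
    refine Computable.option_casesOn (o := fun x : α × ℕ × σ => (f x.1)[x.2.1]?)
      (f := fun x : α × ℕ × σ => x.2.2) (g := fun (x : α × ℕ × σ) b => h x.1 x.2.2 b) ?_ ?_ ?_
    · exact Computable.list_getElem?.comp (hf.comp Computable.fst)
        (Computable.fst.comp Computable.snd)
    · exact Computable.snd.comp Computable.snd
    · exact hh.comp ((Computable.fst.comp Computable.fst).pair
        ((Computable.snd.comp (Computable.snd.comp Computable.fst)).pair Computable.snd))
  refine key.of_eq fun a => ?_
  -- Invariant of the recursion: after `n` rounds the state is the fold over the first `n` entries.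
  -- The `none` branch leaves the state unchanged, which matches `take` beyond the end.
  have : ∀ n, Nat.rec (motive := fun _ => σ) (g a)
      (fun i s => Option.casesOn (motive := fun _ => σ) ((f a)[i]?) s fun b => h a s b) n =
      ((f a).take n).foldl (h a) (g a) := by
    intro n
    induction n with
    | zero => rfl
    | succ n ih =>
      rw [List.take_add_one, List.foldl_append, ← ih]
      simp only
      cases (f a)[n]? <;> rfl
  rw [this, List.take_length]

theorem computable_flatMap {f : α → List β} {h : α → β → List σ} (hf : Computable f)
    (hh : Computable fun x : α × β => h x.1 x.2) : Computable fun a => (f a).flatMap (h a) := by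
  have key := computable_foldl (h := fun a s b => s ++ h a b) hf (Computable.const ([] : List σ))
    (Computable.list_append.comp (Computable.fst.comp Computable.snd)
      (hh.comp (Computable.fst.pair (Computable.snd.comp Computable.snd))))
  refine key.of_eq fun a => ?_
  have : ∀ (l : List β) (s : List σ), l.foldl (fun s b => s ++ h a b) s = s ++ l.flatMap (h a) := by
    intro l
    induction l with
    | nil => simp
    | cons b l ih => intro s; simp [ih]
  simpa using this (f a) []

theorem computablePred_comp {p : β → Prop} {f : α → β} (hp : ComputablePred p)
    (hf : Computable f) : ComputablePred fun a => p (f a) := by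
  obtain ⟨_, hp⟩ := hp
  exact ⟨inferInstance, hp.comp hf⟩

theorem computablePred_forall_mem {f : α → List β} {P : α → β → Prop} (hf : Computable f)
    (hP : ComputablePred fun x : α × β => P x.1 x.2) :
    ComputablePred fun a => ∀ b ∈ f a, P a b := by
  classical
  have key := computable_foldl (h := fun a s b => s && decide (P a b)) hf (Computable.const true)
    (Primrec.and.to_comp.comp (Computable.fst.comp Computable.snd)
      (hP.decide.comp (Computable.fst.pair (Computable.snd.comp Computable.snd))))
  have : ∀ a (l : List β) (s : Bool),
      l.foldl (fun s b => s && decide (P a b)) s = (s && decide (∀ b ∈ l, P a b)) := by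
    intro a l
    induction l with
    | nil => simp
    | cons b l ih => intro s; simp [ih, Bool.and_assoc]
  exact Computable.computablePred (key.of_eq fun a => by rw [this]; simp)

theorem computablePred_exists_mem {f : α → List β} {P : α → β → Prop} (hf : Computable f)
    (hP : ComputablePred fun x : α × β => P x.1 x.2) :
    ComputablePred fun a => ∃ b ∈ f a, P a b :=
  (computablePred_forall_mem (P := fun a b => ¬ P a b) hf hP.not).not.of_eq fun a => by simp

end ListComputable

/-! ## Backward search in restricted well-structured transition systems -/

section Backward

variable {S C : Type*} {T : TransSys S} {Q : Set S} {dec : C → S} {pb : C → List C} {IB : List C}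

theorem mem_up_codedSet {l : List C} {s : S} :
    s ∈ T.up (codedSet dec l) ↔ ∃ c ∈ l, T.le (dec c) s := by
  constructor
  · rintro ⟨_, ⟨c, hc, rfl⟩, h⟩
    exact ⟨c, hc, h⟩
  · rintro ⟨c, hc, h⟩
    exact ⟨_, ⟨c, hc, rfl⟩, h⟩

theorem mem_up_singleton {s t : S} : s ∈ T.up {t} ↔ T.le t s := by
  simp [TransSys.up]

theorem backSeq_subset {i j : ℕ} (h : i ≤ j) : ∀ c ∈ backSeq pb IB i, c ∈ backSeq pb IB j := by
  induction h with
  | refl => exact fun _ h => h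
  | step _ ih => exact fun c hc => List.mem_append_left _ (ih c hc)

/-- The predicate `A` lets the same lemmas serve both kinds of basis: it becomes `dec c ∈ Q` for a
`Q`-pred-basis and `True` for a pred-basis. -/
theorem backSeq_invariant {A : C → Prop} (hIB : ∀ c ∈ IB, A c)
    (hA : ∀ c, A c → ∀ b ∈ pb c, A b) (m : ℕ) : ∀ c ∈ backSeq pb IB m, A c := by
  induction m with
  | zero => exact hIB
  | succ m ih =>
    intro c hc
    rcases List.mem_append.1 hc with hc | hc
    · exact ih c hc
    · obtain ⟨d, hd, hc⟩ := List.mem_flatMap.1 hc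
      exact hA d (ih d hd) c hc

/-- Every state above the backward sequence can reach a state above its start. -/
theorem covers_of_mem_upSeq (hT : IsRestrictedWSTS T Q) {A : C → Prop} (hIB : ∀ c ∈ IB, A c)
    (hA : ∀ c, A c → ∀ b ∈ pb c, A b ∧ dec b ∈ T.up (T.pred (T.up {dec c}))) (m : ℕ) {s : S}
    (hs : s ∈ upSeq T dec pb IB m) : ∃ i ∈ T.up (codedSet dec IB), Covers T s i := by
  induction m generalizing s with
  | zero => exact ⟨s, hs, s, .refl, hT.refl s⟩
  | succ m ih =>
    obtain ⟨c, hc, hle⟩ := mem_up_codedSet.1 hs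
    rcases List.mem_append.1 hc with hc | hc
    · exact ih (mem_up_codedSet.2 ⟨c, hc, hle⟩)
    · obtain ⟨d, hd, hc⟩ := List.mem_flatMap.1 hc
      have hAd := backSeq_invariant hIB (fun c hc b hb => (hA c hc b hb).1) m d hd
      obtain ⟨x, ⟨y, hy, hxy⟩, hx⟩ := (hA d hAd c hc).2
      -- Since `x ≤ dec c ≤ s`, compatibility lifts the step of `x` to a run of `s` that ends above
      -- `dec d`, where the induction hypothesis applies.
      obtain ⟨t, hst, hyt⟩ := hT.compat x s y (hT.trans _ _ _ hx hle) hxy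
      obtain ⟨i, hi, u, htu, hiu⟩ := ih (s := t)
        (mem_up_codedSet.2 ⟨d, hd, hT.trans _ _ _ (mem_up_singleton.1 hy) hyt⟩)
      exact ⟨i, hi, u, hst.trans htu, hiu⟩

/-- A stationary backward sequence contains every state with a restricted run into its start. -/
theorem mem_upSeq_of_restrictedCovers (hT : IsRestrictedWSTS T Q) {Q' : Set S} {A : C → Prop}
    (hIB : ∀ c ∈ IB, A c) (hA : ∀ c, A c → ∀ b ∈ pb c, A b)
    (hpb : ∀ c, A c → ∀ s ∈ T.pred (T.up {dec c}), s ∈ Q' → s ∈ T.up (codedSet dec (pb c)))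
    {m : ℕ} (hm : upSeq T dec pb IB m = upSeq T dec pb IB (m + 1)) {s i : S}
    (hi : i ∈ T.up (codedSet dec IB)) (hs : RestrictedCovers T Q' s i) :
    s ∈ upSeq T dec pb IB m := by
  obtain ⟨u, hsu, hiu⟩ := hs
  induction hsu using Relation.ReflTransGen.head_induction_on with
  | refl =>
    obtain ⟨c, hc, hci⟩ := mem_up_codedSet.1 hi
    exact mem_up_codedSet.2 ⟨c, backSeq_subset (Nat.zero_le m) c hc, hT.trans _ _ _ hci hiu⟩
  | head hst _ ih =>
    obtain ⟨c, hc, hct⟩ := mem_up_codedSet.1 ih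
    have hAc := backSeq_invariant hIB hA m c hc
    obtain ⟨b, hb, hle⟩ := mem_up_codedSet.1
      (hpb c hAc _ ⟨_, mem_up_singleton.2 hct, hst.1⟩ hst.2.1)
    -- A predecessor is a priori only found one stage later; stationarity brings it back to stage
    -- `m`.
    rw [hm]
    exact mem_up_codedSet.2
      ⟨b, List.mem_append_right _ (List.mem_flatMap.2 ⟨c, hc, hb⟩), hle⟩

/-- Replaces an equality of infinite sets by a comparison of two finite lists, which makes
stationarity decidable. -/
theorem upSeq_eq_succ_iff (hT : IsRestrictedWSTS T Q) {m : ℕ} :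
    upSeq T dec pb IB m = upSeq T dec pb IB (m + 1) ↔
      ∀ c ∈ backSeq pb IB (m + 1), ∃ d ∈ backSeq pb IB m, T.le (dec d) (dec c) := by
  constructor
  · intro h c hc
    have : dec c ∈ upSeq T dec pb IB (m + 1) := mem_up_codedSet.2 ⟨c, hc, hT.refl _⟩
    rw [← h] at this
    exact mem_up_codedSet.1 this
  · intro h
    ext s
    constructor
    · intro hs
      obtain ⟨c, hc, hle⟩ := mem_up_codedSet.1 hs
      exact mem_up_codedSet.2 ⟨c, backSeq_subset (Nat.le_succ m) c hc, hle⟩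
    · intro hs
      obtain ⟨c, hc, hle⟩ := mem_up_codedSet.1 hs
      obtain ⟨d, hd, hdc⟩ := h c hc
      exact mem_up_codedSet.2 ⟨d, hd, hT.trans _ _ _ hdc hle⟩

/-- Otherwise every stage contributes an element of `Q` above nothing found earlier, and these
elements form a bad sequence. -/
theorem exists_upSeq_eq_succ (hT : IsRestrictedWSTS T Q) (hIB : ∀ c ∈ IB, dec c ∈ Q)
    (hA : ∀ c, dec c ∈ Q → ∀ b ∈ pb c, dec b ∈ Q) :
    ∃ m, upSeq T dec pb IB m = upSeq T dec pb IB (m + 1) := by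
  by_contra! h
  have h' : ∀ m, ∃ c ∈ backSeq pb IB (m + 1), ∀ d ∈ backSeq pb IB m, ¬ T.le (dec d) (dec c) := by
    intro m
    have := h m
    rw [Ne, upSeq_eq_succ_iff hT] at this
    push Not at this
    exact this
  choose c hc hd using h'
  obtain ⟨i, j, hij, hle⟩ := hT.wqo (fun m => dec (c m))
    fun m => backSeq_invariant hIB hA (m + 1) _ (hc m)
  exact hd j (c i) (backSeq_subset hij _ (hc i)) hle

/-- Allows `mem_upSeq_of_restrictedCovers`, stated for restricted runs, to handle general
coverability as well. -/
theorem covers_iff_restrictedCovers_univ {s t : S} :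
    Covers T s t ↔ RestrictedCovers T Set.univ s t := by
  have : T.stepIn Set.univ = T.step := by
    ext s t
    simp [TransSys.stepIn]
  rw [Covers, RestrictedCovers, this]

theorem restrictedCovers_iff_covers (hQ : ∀ s t, s ∈ Q → T.step s t → t ∈ Q) {s t : S}
    (hs : s ∈ Q) : RestrictedCovers T Q s t ↔ Covers T s t := by
  constructor
  · rintro ⟨u, hu, h⟩
    exact ⟨u, Relation.ReflTransGen.mono (fun _ _ h => h.1) _ _ hu, h⟩
  · rintro ⟨u, hu, h⟩
    have : Relation.ReflTransGen (T.stepIn Q) s u ∧ u ∈ Q := by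
      clear h
      induction hu with
      | refl => exact ⟨.refl, hs⟩
      | tail _ hst ih =>
        obtain ⟨h1, h2⟩ := ih
        exact ⟨h1.tail ⟨hst, h2, hQ _ _ h2 hst⟩, hQ _ _ h2 hst⟩
    exact ⟨u, this.1, h⟩

theorem covers_of_covers_up (hT : IsRestrictedWSTS T Q) {s t i : S} (hi : T.le t i)
    (h : Covers T s i) : Covers T s t := by
  obtain ⟨u, hu, h⟩ := h
  exact ⟨u, hu, hT.trans _ _ _ hi h⟩

end Backward

/-! ### Backward search as a decision procedure. -/

section BackwardComputable

variable {S C : Type*} [Primcodable C] {T : TransSys S} {Q : Set S} {dec : C → S} {pb : C → List C}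

theorem computable_backSeq (hpb : Computable pb) :
    Computable fun x : List C × ℕ => backSeq pb x.1 x.2 := by
  have key : Computable fun x : List C × ℕ => Nat.rec (motive := fun _ => List C) x.1
      (fun _ l => l ++ l.flatMap pb) x.2 := by
    refine Computable.nat_rec (h := fun _ (y : ℕ × List C) => y.2 ++ y.2.flatMap pb)
      Computable.snd Computable.fst ?_
    have h2 : Computable fun x : (List C × ℕ) × ℕ × List C => x.2.2 :=
      Computable.snd.comp Computable.snd
    exact Computable.list_append.comp h2
      (computable_flatMap (h := fun _ => pb) h2 (hpb.comp Computable.snd))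
  refine key.of_eq fun x => ?_
  induction x.2 with
  | zero => rfl
  | succ n ih => simp only [backSeq, ← ih]

/-- The backward search decides whether a state lies above a stationary member of the backward
sequence of a given bounded state. -/
theorem exists_computable_mem_upSeq (hT : IsRestrictedWSTS T Q)
    (hQ : ComputablePred fun c => dec c ∈ Q)
    (hle : ComputablePred fun p : C × C => T.le (dec p.1) (dec p.2)) (hpb : Computable pb)
    (hA : ∀ c, dec c ∈ Q → ∀ b ∈ pb c, dec b ∈ Q) :
    ∃ f : C × C → Bool, Computable f ∧ ∀ s t, dec t ∈ Q →
      ∃ m, upSeq T dec pb [t] m = upSeq T dec pb [t] (m + 1) ∧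
        (f (s, t) = true ↔ dec s ∈ upSeq T dec pb [t] m) := by
  classical
  -- A computable total function is wanted, but the search is only known to stop for targets in `Q`.
  -- Any other target is replaced by the empty start list, for which it stops as well.
  obtain ⟨start, hstart, h_in, h_notin⟩ : ∃ start : C → List C, Computable start ∧
      (∀ t, dec t ∈ Q → start t = [t]) ∧ (∀ t, ∀ c ∈ start t, dec c ∈ Q) := by
    refine ⟨fun t => bif decide (dec t ∈ Q) then [t] else [], Computable.cond hQ.decide
      (Computable.list_cons.comp Computable.id (Computable.const []))
      (Computable.const []), fun t ht => by simp [ht], fun t c hc => ?_⟩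
    by_cases h : dec t ∈ Q
    · simp only [h, decide_true, cond_true, List.mem_singleton] at hc
      exact hc ▸ h
    · simp [h] at hc
  have hseq : Computable fun x : C × ℕ => backSeq pb (start x.1) x.2 :=
    (computable_backSeq hpb).comp ((hstart.comp Computable.fst).pair Computable.snd)
  obtain ⟨P, hPdef⟩ : ∃ P : C → ℕ → Prop, ∀ t m, P t m ↔
      ∀ c ∈ backSeq pb (start t) (m + 1), ∃ d ∈ backSeq pb (start t) m, T.le (dec d) (dec c) :=
    ⟨_, fun _ _ => Iff.rfl⟩
  have hP : ComputablePred fun x : C × ℕ => P x.1 x.2 := by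
    refine ComputablePred.of_eq (p := fun x : C × ℕ => ∀ c ∈ backSeq pb (start x.1) (x.2 + 1),
      ∃ d ∈ backSeq pb (start x.1) x.2, T.le (dec d) (dec c)) ?_ fun x => (hPdef _ _).symm
    refine computablePred_forall_mem (f := fun x : C × ℕ => backSeq pb (start x.1) (x.2 + 1))
      (P := fun x c => ∃ d ∈ backSeq pb (start x.1) x.2, T.le (dec d) (dec c))
      (hseq.comp (Computable.fst.pair (Computable.succ.comp Computable.snd))) ?_
    refine computablePred_exists_mem
      (f := fun y : (C × ℕ) × C => backSeq pb (start y.1.1) y.1.2)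
      (P := fun y d => T.le (dec d) (dec y.2)) (hseq.comp Computable.fst) ?_
    exact computablePred_comp (f := fun z : ((C × ℕ) × C) × C => (z.2, z.1.2)) hle
      (Computable.snd.pair (Computable.snd.comp Computable.fst))
  have hex : ∀ t, ∃ m, P t m := by
    intro t
    obtain ⟨m, hm⟩ := exists_upSeq_eq_succ (IB := start t) hT (h_notin t) hA
    exact ⟨m, (hPdef _ _).2 ((upSeq_eq_succ_iff hT).1 hm)⟩
  -- Unbounded search for the first stationary stage; no bound on it is computed, only its existence
  -- is used.
  have hfind : Computable fun t => Nat.find (hex t) := Computable.find (P := P) hP hex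
  have hmem : ComputablePred fun p : C × C =>
      ∃ d ∈ backSeq pb (start p.2) (Nat.find (hex p.2)), T.le (dec d) (dec p.1) := by
    refine computablePred_exists_mem
      (f := fun p : C × C => backSeq pb (start p.2) (Nat.find (hex p.2)))
      (P := fun p d => T.le (dec d) (dec p.1)) ?_ ?_
    · exact hseq.comp (Computable.snd.pair (hfind.comp Computable.snd))
    · exact computablePred_comp (f := fun z : (C × C) × C => (z.2, z.1.1)) hle
        (Computable.snd.pair (Computable.fst.comp Computable.fst))
  refine ⟨_, hmem.decide, fun s t ht => ⟨Nat.find (hex t), ?_, ?_⟩⟩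
  · have h := (hPdef _ _).1 (Nat.find_spec (hex t))
    rw [h_in t ht] at h
    exact (upSeq_eq_succ_iff hT).2 h
  · simp only [decide_eq_true_eq, upSeq, mem_up_codedSet, h_in t ht]

theorem coverabilityResults (hT : IsRestrictedWSTS T Q) (hQ : ComputablePred fun c => dec c ∈ Q)
    (hle : ComputablePred fun p : C × C => T.le (dec p.1) (dec p.2)) :
    CoverabilityResults T dec Q where
  case_all := by
    rintro ⟨pb, hpb, hbasis⟩ hall
    have hA : ∀ c, True → ∀ b ∈ pb c, True ∧ dec b ∈ T.up (T.pred (T.up {dec c})) := by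
      intro c _ b hb
      refine ⟨trivial, ?_⟩
      rw [hbasis c]
      exact mem_up_codedSet.2 ⟨b, hb, hT.refl _⟩
    have hiff : ∀ s t, RestrictedCovers T Q s t ↔ Covers T s t := fun s t =>
      restrictedCovers_iff_covers (fun _ _ _ _ => hall _) (hall s)
    obtain ⟨f, hf, hspec⟩ := exists_computable_mem_upSeq hT hQ hle hpb
      fun _ _ _ _ => hall _
    have hdec : ∀ s t, f (s, t) = true ↔ Covers T (dec s) (dec t) := by
      intro s t
      obtain ⟨m, hm, h⟩ := hspec s t (hall _)
      rw [h]
      constructor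
      · intro hs
        obtain ⟨i, hi, hcov⟩ := covers_of_mem_upSeq hT (A := fun _ => True) (by simp) hA m hs
        obtain ⟨c, hc, hci⟩ := mem_up_codedSet.1 hi
        rw [List.mem_singleton.1 hc] at hci
        exact covers_of_covers_up hT hci hcov
      · intro hcov
        refine mem_upSeq_of_restrictedCovers hT (A := fun _ => True) (Q' := Set.univ) (by simp)
          (by simp) ?_ hm (mem_up_codedSet.2 ⟨t, by simp, hT.refl _⟩)
          (covers_iff_restrictedCovers_univ.1 hcov)
        intro c _ s hs _
        have : s ∈ T.up (T.pred (T.up {dec c})) := ⟨s, hs, hT.refl s⟩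
        rwa [hbasis c] at this
    refine ⟨hiff, ?_, f, hf, fun s t _ _ => by rw [hdec, hiff]⟩
    refine ComputablePred.computable_iff.2 ⟨f, hf, funext fun p => propext ?_⟩
    exact (hdec p.1 p.2).symm
  case_special := by
    rintro ⟨pb, hpb, hbasis⟩ hclosed
    have hA : ∀ c, dec c ∈ Q → ∀ b ∈ pb c,
        dec b ∈ Q ∧ dec b ∈ T.up (T.pred (T.up {dec c})) := by
      intro c hc b hb
      refine ⟨(hbasis c hc).1 b hb, ?_⟩
      have : dec b ∈ T.up (codedSet dec (pb c)) := mem_up_codedSet.2 ⟨b, hb, hT.refl _⟩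
      rw [← (hbasis c hc).2] at this
      obtain ⟨x, hx, hxb⟩ := this
      exact ⟨x, hx.1, hxb⟩
    obtain ⟨f, hf, hspec⟩ := exists_computable_mem_upSeq hT hQ hle hpb
      fun c hc b hb => (hA c hc b hb).1
    refine ⟨f, hf, fun s t hs ht => ?_⟩
    obtain ⟨m, hm, h⟩ := hspec s t ht
    rw [h]
    constructor
    · intro hs'
      obtain ⟨i, hi, hcov⟩ := covers_of_mem_upSeq hT (A := fun c => dec c ∈ Q) (by simpa) hA m hs'
      obtain ⟨c, hc, hci⟩ := mem_up_codedSet.1 hi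
      rw [List.mem_singleton.1 hc] at hci
      exact (restrictedCovers_iff_covers hclosed hs).2 (covers_of_covers_up hT hci hcov)
    · intro hcov
      refine mem_upSeq_of_restrictedCovers hT (A := fun c => dec c ∈ Q) (by simpa)
        (fun c hc b hb => (hA c hc b hb).1) ?_ hm (mem_up_codedSet.2 ⟨t, by simp, hT.refl _⟩) hcov
      intro c hc s hs hsQ
      rw [← (hbasis c hc).2]
      exact ⟨s, ⟨hs, hsQ⟩, hT.refl s⟩
  case_general := by
    intro pb hbasis IB hIB
    have hA : ∀ c, dec c ∈ Q → ∀ b ∈ pb c,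
        dec b ∈ Q ∧ dec b ∈ T.up (T.pred (T.up {dec c})) := by
      intro c hc b hb
      refine ⟨(hbasis c hc).1 b hb, ?_⟩
      have : dec b ∈ T.up (codedSet dec (pb c)) := mem_up_codedSet.2 ⟨b, hb, hT.refl _⟩
      rw [← (hbasis c hc).2] at this
      obtain ⟨x, hx, hxb⟩ := this
      exact ⟨x, hx.1, hxb⟩
    refine ⟨exists_upSeq_eq_succ hT hIB fun c hc b hb => (hA c hc b hb).1, fun m hm s => ⟨?_, ?_⟩⟩
    · exact covers_of_mem_upSeq hT hIB hA m
    · rintro hs ⟨i, hi, hcov⟩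
      refine hs (mem_upSeq_of_restrictedCovers hT hIB (fun c hc b hb => (hA c hc b hb).1) ?_ hm
        hi hcov)
      intro c hc s hs hsQ
      rw [← (hbasis c hc).2]
      exact ⟨s, ⟨hs, hsQ⟩, hT.refl s⟩
  case_hope := by
    intro pb hbasis IB m hm s
    constructor
    · rintro ⟨i, hi, hcov⟩
      refine mem_upSeq_of_restrictedCovers hT (A := fun _ => True) (Q' := Set.univ) (by simp)
        (by simp) ?_ hm hi (covers_iff_restrictedCovers_univ.1 hcov)
      intro c _ s hs _
      have : s ∈ T.up (T.pred (T.up {dec c})) := ⟨s, hs, hT.refl s⟩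
      rwa [hbasis c] at this
    · refine covers_of_mem_upSeq hT (A := fun _ => True) (by simp) ?_ m
      intro c _ b hb
      refine ⟨trivial, ?_⟩
      rw [hbasis c]
      exact mem_up_codedSet.2 ⟨b, hb, hT.refl _⟩

end BackwardComputable

/-! ## Partial maps of sets: squares with the shape of a pushout -/

section SetSquare

variable {A B C D K : Type*}

/-- The elements of `B` that a pushout of `f` and `g` has to identify. -/
def Glue (f : A → Option B) (g : A → Option C) (b b' : B) : Prop :=
  ∃ a a', f a = some b ∧ f a' = some b' ∧ g a = g a'

/-- The square of partial maps `g' ∘ f = f' ∘ g` identifies and covers exactly what a pushout along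
a total map does. -/
structure SetSquare (f : A → Option B) (g : A → Option C) (g' : B → Option D)
    (f' : C → Option D) : Prop where
  comm : ∀ a, (f a).bind g' = (g a).bind f'
  total : ∀ b, g' b ≠ none
  surj : ∀ d, (∃ b, g' b = some d) ∨ ∃ c, f' c = some d
  ker : ∀ b b', g' b = g' b' → Relation.EqvGen (Glue f g) b b'
  mix : ∀ b c d, g' b = some d → f' c = some d → ∃ a b', g a = some c ∧ f a = some b'
  inj : ∀ c c' d, f' c = some d → f' c' = some d → c = c' ∨ ∃ a b, g a = some c ∧ f a = some b

namespace SetSquare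

variable {f : A → Option B} {g : A → Option C} {g' : B → Option D} {f' : C → Option D}

theorem comm_of_eq (h : SetSquare f g g' f') {a : A} {b : B} {c : C} (hf : f a = some b)
    (hg : g a = some c) : g' b = f' c := by
  simpa [hf, hg] using h.comm a

theorem eq_none (h : SetSquare f g g' f') {a : A} {c : C} (hf : f a = none)
    (hg : g a = some c) : f' c = none := by
  simpa [hf, hg] using (h.comm a).symm

theorem map_eq_of_eqvGen (h : SetSquare f g g' f') {b b' : B}
    (hb : Relation.EqvGen (Glue f g) b b') : g' b = g' b' := by
  induction hb with
  | rel x y hxy =>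
    obtain ⟨a, a', ha, ha', hg⟩ := hxy
    have h1 := h.comm a
    have h2 := h.comm a'
    rw [ha, Option.bind_some] at h1
    rw [ha', Option.bind_some] at h2
    rw [h1, h2, hg]
  | refl => rfl
  | symm _ _ _ ih => exact ih.symm
  | trans _ _ _ _ _ ih1 ih2 => exact ih1.trans ih2

/-- The universal property for partial maps of sets. The value at `d` is forced by any preimage;
`ker`, `mix` and `inj` say that two preimages of `d` are linked through gluing, so they force the
same value. -/
theorem exists_desc (h : SetSquare f g g' f') {p : B → Option K}
    {q : C → Option K} (hpq : ∀ a, (f a).bind p = (g a).bind q)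
    (hq : ∀ c, f' c = none → q c = none) :
    ∃ η : D → Option K, (∀ b, (g' b).bind η = p b) ∧ ∀ c, (f' c).bind η = q c := by
  have hBB : ∀ b b', g' b = g' b' → p b = p b' := by
    intro b b' hb
    have := h.ker b b' hb
    clear hb
    induction this with
    | rel x y hxy =>
      obtain ⟨a, a', ha, ha', hg⟩ := hxy
      have h1 := hpq a
      have h2 := hpq a'
      rw [ha, Option.bind_some] at h1
      rw [ha', Option.bind_some] at h2
      rw [h1, h2, hg]
    | refl => rfl
    | symm _ _ _ ih => exact ih.symm
    | trans _ _ _ _ _ ih1 ih2 => exact ih1.trans ih2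
  have hBC : ∀ b c d, g' b = some d → f' c = some d → p b = q c := by
    intro b c d hb hc
    obtain ⟨a, b', hga, hfa⟩ := h.mix b c d hb hc
    have h1 := hpq a
    rw [hfa, hga, Option.bind_some, Option.bind_some] at h1
    rw [← h1]
    exact hBB _ _ (by rw [hb, h.comm_of_eq hfa hga, hc])
  have hCC : ∀ c c' d, f' c = some d → f' c' = some d → q c = q c' := by
    intro c c' d hc hc'
    rcases h.inj c c' d hc hc' with rfl | ⟨a, b, hga, hfa⟩
    · rfl
    · have hb : g' b = some d := by rw [h.comm_of_eq hfa hga, hc]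
      rw [← hBC b c d hb hc, hBC b c' d hb hc']
  have hη : ∀ d, ∃ o : Option K, (∀ b, g' b = some d → p b = o) ∧ ∀ c, f' c = some d → q c = o := by
    intro d
    rcases h.surj d with ⟨b, hb⟩ | ⟨c, hc⟩
    · exact ⟨p b, fun b' hb' => hBB _ _ (hb'.trans hb.symm), fun c hc => (hBC b c d hb hc).symm⟩
    · exact ⟨q c, fun b hb => hBC b c d hb hc, fun c' hc' => hCC _ _ d hc' hc⟩
  choose η h1 h2 using hη
  refine ⟨η, fun b => ?_, fun c => ?_⟩
  · obtain ⟨d, hd⟩ := Option.ne_none_iff_exists'.1 (h.total b)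
    rw [hd, Option.bind_some, h1 d b hd]
  · cases hc : f' c with
    | none => rw [hq c hc]; rfl
    | some d => rw [Option.bind_some, h2 d c hc]

theorem desc_unique (h : SetSquare f g g' f') {η θ : D → Option K}
    (h1 : ∀ b, (g' b).bind η = (g' b).bind θ) (h2 : ∀ c, (f' c).bind η = (f' c).bind θ) :
    η = θ := by
  funext d
  rcases h.surj d with ⟨b, hb⟩ | ⟨c, hc⟩
  · simpa [hb] using h1 b
  · simpa [hc] using h2 c

/-- The bijection is presented as a partial map because it will be a component of an invertible
partial morphism. -/
theorem map_bijective (h : SetSquare f g g' f') {θ : D → Option K} (htot : ∀ d, θ d ≠ none)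
    (hinj : Function.Injective θ) (hsurj : ∀ k, ∃ d, θ d = some k) :
    SetSquare f g (fun b => (g' b).bind θ) fun c => (f' c).bind θ := by
  have key : ∀ (o o' : Option D), o.bind θ = o'.bind θ → o = o' := by
    intro o o' ho
    cases o with
    | none =>
      cases o' with
      | none => rfl
      | some d' => exact absurd ho.symm (htot d')
    | some d =>
      cases o' with
      | none => exact absurd ho (htot d)
      | some d' => rw [hinj ho]
  refine ⟨fun a => ?_, fun b => ?_, fun k => ?_, fun b b' hb => h.ker _ _ (key _ _ hb), ?_, ?_⟩
  · rw [← Option.bind_assoc, ← Option.bind_assoc, h.comm]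
  · obtain ⟨d, hd⟩ := Option.ne_none_iff_exists'.1 (h.total b)
    simpa [hd] using htot d
  · obtain ⟨d, hd⟩ := hsurj k
    rcases h.surj d with ⟨b, hb⟩ | ⟨c, hc⟩
    · exact Or.inl ⟨b, by simp [hb, hd]⟩
    · exact Or.inr ⟨c, by simp [hc, hd]⟩
  · intro b c k hb hc
    obtain ⟨d, hd, -⟩ := Option.bind_eq_some_iff.1 hb
    exact h.mix b c d hd ((key _ _ (hc.trans hb.symm)).trans hd)
  · intro c c' k hc hc'
    obtain ⟨d, hd, -⟩ := Option.bind_eq_some_iff.1 hc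
    exact h.inj c c' d hd ((key _ _ (hc'.trans hc.symm)).trans hd)

/-- If a second square is attached along an injection `ι`, the comparison map is injective. -/
theorem comparison_injective {C₂ D₂ : Type*} {g₂ : A → Option C₂} {g₂' : B → Option D₂}
    {f₂' : C₂ → Option D₂} (h : SetSquare f g g' f') (h₂ : SetSquare f g₂ g₂' f₂')
    {ι : C → Option C₂} (hι : Function.Injective ι) (hg : ∀ a, g a ≠ none)
    (hιg : ∀ a, (g a).bind ι = g₂ a) {η : D → Option D₂} (htot : ∀ d, η d ≠ none)
    (h1 : ∀ b, (g' b).bind η = g₂' b) (h2 : ∀ c, (f' c).bind η = (ι c).bind f₂') :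
    Function.Injective η := by
  -- As `ι` is injective, enlarging `C` creates no new identifications in `B`.
  have hglue : ∀ b b', Glue f g₂ b b' → Glue f g b b' := by
    rintro b b' ⟨a, a', ha, ha', hgg⟩
    refine ⟨a, a', ha, ha', ?_⟩
    obtain ⟨c, hc⟩ := Option.ne_none_iff_exists'.1 (hg a)
    obtain ⟨c', hc'⟩ := Option.ne_none_iff_exists'.1 (hg a')
    rw [← hιg, ← hιg, hc, hc'] at hgg
    rw [hc, hc', hι hgg]
  have hBB : ∀ b b' d d', g' b = some d → g' b' = some d' → η d = η d' → d = d' := by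
    intro b b' d d' hb hb' hd
    have h3 := h1 b
    have h4 := h1 b'
    rw [hb, Option.bind_some] at h3
    rw [hb', Option.bind_some] at h4
    have h5 := h.map_eq_of_eqvGen
      (Relation.EqvGen.mono hglue _ _ (h₂.ker b b' (by rw [← h3, ← h4, hd])))
    rw [hb, hb'] at h5
    exact Option.some.inj h5
  -- An element of `C` that is matched after `ι` was already matched before, again by injectivity.
  have hpre : ∀ c a c₂ b, ι c = some c₂ → g₂ a = some c₂ → f a = some b → g' b = f' c := by
    intro c a c₂ b hc ha hb
    obtain ⟨c', hc'⟩ := Option.ne_none_iff_exists'.1 (hg a)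
    have := hιg a
    rw [hc', Option.bind_some, ha, ← hc] at this
    rw [hι this] at hc'
    exact h.comm_of_eq hb hc'
  have hfac : ∀ c d, f' c = some d → ∃ c₂, ι c = some c₂ ∧ f₂' c₂ = η d := by
    intro c d hc
    have h3 := h2 c
    rw [hc, Option.bind_some] at h3
    obtain ⟨d₂, hd₂⟩ := Option.ne_none_iff_exists'.1 (htot d)
    rw [hd₂] at h3
    obtain ⟨c₂, hc₂, h4⟩ := Option.bind_eq_some_iff.1 h3.symm
    exact ⟨c₂, hc₂, h4.trans hd₂.symm⟩
  have hBC : ∀ b c d d', g' b = some d → f' c = some d' → η d = η d' → d = d' := by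
    intro b c d d' hb hc hd
    obtain ⟨c₂, hc₂, h4⟩ := hfac c d' hc
    obtain ⟨d₂, hd₂⟩ := Option.ne_none_iff_exists'.1 (htot d)
    have h3 := h1 b
    rw [hb, Option.bind_some] at h3
    obtain ⟨a, b', ha, hb'⟩ := h₂.mix b c₂ d₂ (h3.symm.trans hd₂) (by rw [h4, ← hd, hd₂])
    exact hBB b b' d d' hb ((hpre c a c₂ b' hc₂ ha hb').trans hc) hd
  intro d d' hd
  rcases h.surj d with ⟨b, hb⟩ | ⟨c, hc⟩
  · rcases h.surj d' with ⟨b', hb'⟩ | ⟨c', hc'⟩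
    · exact hBB b b' d d' hb hb' hd
    · exact hBC b c' d d' hb hc' hd
  · rcases h.surj d' with ⟨b', hb'⟩ | ⟨c', hc'⟩
    · exact (hBC b' c d' d hb' hc hd.symm).symm
    · obtain ⟨c₂, hc₂, h4⟩ := hfac c d hc
      obtain ⟨c₂', hc₂', h4'⟩ := hfac c' d' hc'
      obtain ⟨d₂, hd₂⟩ := Option.ne_none_iff_exists'.1 (htot d)
      rcases h₂.inj c₂ c₂' d₂ (h4.trans hd₂) (by rw [h4', ← hd, hd₂]) with rfl | ⟨a, b, ha, hb⟩
      · rw [hι (hc₂.trans hc₂'.symm), hc'] at hc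
        exact (Option.some.inj hc).symm
      · exact hBC b c' d d' ((hpre c a c₂ b hc₂ ha hb).trans hc) hc' hd

end SetSquare

/-! ### The canonical pushout object of two partial maps. -/

section Canonical

variable (f : A → Option B) (g : A → Option C) (Z : C → Prop)

/-- The pushout object of `f` and `g`, where the elements of `C` in `Z` are deleted. -/
abbrev Glued : Type _ := Quot (Glue f g) ⊕ {c : C // (∀ a, g a ≠ some c) ∧ ¬ Z c}

open Classical in
/-- The map from `C` to the pushout object. -/
noncomputable def glueMap (c : C) : Option (Glued f g Z) :=
  if h : ∃ b a, g a = some c ∧ f a = some b then some (Sum.inl (Quot.mk _ h.choose))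
  else if h : (∀ a, g a ≠ some c) ∧ ¬ Z c then some (Sum.inr ⟨c, h⟩) else none

variable {f g Z}

theorem glueMap_of_eq {a : A} {b : B} {c : C} (hf : f a = some b) (hg : g a = some c) :
    glueMap f g Z c = some (Sum.inl (Quot.mk _ b)) := by
  have h : ∃ b a, g a = some c ∧ f a = some b := ⟨b, a, hg, hf⟩
  obtain ⟨a', ha', hb'⟩ := h.choose_spec
  rw [glueMap, dif_pos h]
  exact congrArg (fun x => some (Sum.inl x)) (Quot.sound ⟨a', a, hb', hf, ha'.trans hg.symm⟩)

theorem glueMap_eq_inl {c : C} {x : Quot (Glue f g)} (h : glueMap f g Z c = some (Sum.inl x)) :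
    ∃ a b, g a = some c ∧ f a = some b ∧ x = Quot.mk _ b := by
  by_cases hc : ∃ b a, g a = some c ∧ f a = some b
  · obtain ⟨b, a, hg, hf⟩ := hc
    rw [glueMap_of_eq hf hg] at h
    exact ⟨a, b, hg, hf, (Sum.inl.inj (Option.some.inj h)).symm⟩
  · rw [glueMap, dif_neg hc] at h
    split_ifs at h with h'
    exact absurd (Option.some.inj h) Sum.inr_ne_inl

theorem glueMap_eq_inr {c : C} {x} (h : glueMap f g Z c = some (Sum.inr x)) : x.1 = c := by
  rw [glueMap] at h
  split_ifs at h with h1 h2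
  · exact absurd (Option.some.inj h) Sum.inl_ne_inr
  · rw [← Sum.inr.inj (Option.some.inj h)]

theorem glueMap_of_notMem {c : C} (h : (∀ a, g a ≠ some c) ∧ ¬ Z c) :
    glueMap f g Z c = some (Sum.inr ⟨c, h⟩) := by
  rw [glueMap, dif_neg, dif_pos h]
  rintro ⟨b, a, hg, -⟩
  exact h.1 a hg

theorem glueMap_eq_none {c : C} (h : glueMap f g Z c = none) :
    (∃ a, g a = some c ∧ f a = none) ∨ Z c := by
  by_cases hZ : Z c
  · exact Or.inr hZ
  · by_cases hc : ∀ a, g a ≠ some c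
    · rw [glueMap_of_notMem ⟨hc, hZ⟩] at h
      cases h
    · push Not at hc
      obtain ⟨a, ha⟩ := hc
      refine Or.inl ⟨a, ha, ?_⟩
      cases hf : f a with
      | none => rfl
      | some b => rw [glueMap_of_eq hf ha] at h; cases h

/-- Conflict-freeness is needed only for `comm`: the image of a deleted item has no preserved
preimage, so `glueMap` is undefined there. The set `Z` is arbitrary because deleting unmatched
elements of `C` violates none of the conditions; for edges it will consist of those with a deleted
end. -/
theorem setSquare_glued (hg : ∀ a, g a ≠ none)
    (hcf : ∀ a a', g a = g a' → (f a = none ↔ f a' = none)) :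
    SetSquare f g (fun b => some (Sum.inl (Quot.mk _ b))) (glueMap f g Z) where
  comm a := by
    obtain ⟨c, hc⟩ := Option.ne_none_iff_exists'.1 (hg a)
    rw [hc, Option.bind_some]
    cases hf : f a with
    | some b => rw [glueMap_of_eq hf hc]; rfl
    | none =>
      rw [glueMap, dif_neg, dif_neg]
      · rfl
      · exact fun h => h.1 a hc
      · rintro ⟨b, a', ha', hb⟩
        rw [(hcf a a' (hc.trans ha'.symm)).1 hf] at hb
        cases hb
  total b := by simp
  surj d := by
    rcases d with x | ⟨c, hc⟩
    · obtain ⟨b, rfl⟩ := Quot.exists_rep x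
      exact Or.inl ⟨b, rfl⟩
    · exact Or.inr ⟨c, glueMap_of_notMem hc⟩
  ker b b' h := Quot.eqvGen_exact (Sum.inl.inj (Option.some.inj h))
  mix b c d hb hc := by
    rw [← hb] at hc
    obtain ⟨a, b', ha, hb', -⟩ := glueMap_eq_inl hc
    exact ⟨a, b', ha, hb'⟩
  inj c c' d hc hc' := by
    rcases d with x | x
    · obtain ⟨a, b, ha, hb, -⟩ := glueMap_eq_inl hc
      exact Or.inr ⟨a, b, ha, hb⟩
    · exact Or.inl ((glueMap_eq_inr hc).symm.trans (glueMap_eq_inr hc'))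

end Canonical

end SetSquare

/-! ## The category of graphs and partial morphisms -/

section Morphisms

variable {Λ : Type} {G H K L R X : DGraph Λ}

@[ext]
theorem PHom.ext {φ ψ : PHom G H} (hV : ∀ x, φ.onV x = ψ.onV x) (hE : ∀ e, φ.onE e = ψ.onE e) :
    φ = ψ := by
  cases φ
  cases ψ
  obtain rfl := funext hV
  obtain rfl := funext hE
  rfl

/-- The identity morphism. -/
def PHom.id (G : DGraph Λ) : PHom G G where
  onV := some
  onE := some
  lab_eq _ _ h := by cases h; rfl
  src_eq _ _ h := by cases h; rfl
  tgt_eq _ _ h := by cases h; rfl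

@[simp] theorem PHom.comp_onV (ψ : PHom H K) (φ : PHom G H) (x : G.V) :
    (ψ.comp φ).onV x = (φ.onV x).bind ψ.onV := rfl

@[simp] theorem PHom.comp_onE (ψ : PHom H K) (φ : PHom G H) (e : G.E) :
    (ψ.comp φ).onE e = (φ.onE e).bind ψ.onE := rfl

theorem PHom.comp_assoc {M : DGraph Λ} (χ : PHom K M) (ψ : PHom H K) (φ : PHom G H) :
    (χ.comp ψ).comp φ = χ.comp (ψ.comp φ) := by
  ext x : 1
  · exact (Option.bind_assoc _ _ _).symm
  · exact (Option.bind_assoc _ _ _).symm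

theorem PHom.id_comp (φ : PHom G H) : (PHom.id H).comp φ = φ := by
  ext x : 1
  · exact Option.bind_fun_some _
  · exact Option.bind_fun_some _

/-- The explicit form of a pushout of `r` along a total morphism `m`. -/
structure IsSquare (r : PHom L R) (m : PHom L X) (m' : PHom R H) (r' : PHom X H) : Prop where
  nodes : SetSquare r.onV m.onV m'.onV r'.onV
  edges : SetSquare r.onE m.onE m'.onE r'.onE
  delV : ∀ x, r'.onV x = none → ∃ a, m.onV a = some x ∧ r.onV a = none
  delE : ∀ e, r'.onE e = none → (∃ a, m.onE a = some e ∧ r.onE a = none) ∨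
    r'.onV (X.src e) = none ∨ r'.onV (X.tgt e) = none

variable {r : PHom L R} {m : PHom L X} {m' : PHom R H} {r' : PHom X H}

/-- Nodes and edges are mapped separately by `exists_desc`. What remains is that the competing
morphism `q` is undefined wherever `r'` is, and that the two induced maps respect incidence and
labels. -/
theorem IsSquare.isPushout (h : IsSquare r m m' r') : IsPushout r m m' r' := by
  refine ⟨PHom.ext h.nodes.comm h.edges.comm, fun K p q hpq => ?_⟩
  have hpqV : ∀ a, (r.onV a).bind p.onV = (m.onV a).bind q.onV := fun a =>
    congrArg (fun φ : PHom L K => φ.onV a) hpq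
  have hpqE : ∀ a, (r.onE a).bind p.onE = (m.onE a).bind q.onE := fun a =>
    congrArg (fun φ : PHom L K => φ.onE a) hpq
  have hqV : ∀ x, r'.onV x = none → q.onV x = none := by
    intro x hx
    obtain ⟨a, ha, hra⟩ := h.delV x hx
    simpa [ha, hra] using (hpqV a).symm
  -- For an edge with a deleted end, `q` is undefined at that end by `hqV`, and a partial morphism
  -- defined on an edge is defined on its ends.
  have hqE : ∀ e, r'.onE e = none → q.onE e = none := by
    intro e he
    rcases h.delE e he with ⟨a, ha, hra⟩ | hs | ht
    · simpa [ha, hra] using (hpqE a).symm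
    · by_contra hne
      obtain ⟨k, hk⟩ := Option.ne_none_iff_exists'.1 hne
      have := q.src_eq e k hk
      rw [hqV _ hs] at this
      cases this
    · by_contra hne
      obtain ⟨k, hk⟩ := Option.ne_none_iff_exists'.1 hne
      have := q.tgt_eq e k hk
      rw [hqV _ ht] at this
      cases this
  obtain ⟨ηV, hV1, hV2⟩ := h.nodes.exists_desc hpqV hqV
  obtain ⟨ηE, hE1, hE2⟩ := h.edges.exists_desc hpqE hqE
  -- Every edge of `H` comes from `R` or `X`, and there the incidences are known from `p` or `q`.
  have hcases : ∀ d k, ηE d = some k → K.lab k = H.lab d ∧ ηV (H.src d) = some (K.src k) ∧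
      ηV (H.tgt d) = some (K.tgt k) := by
    intro d k hk
    rcases h.edges.surj d with ⟨b, hb⟩ | ⟨c, hc⟩
    · have h1 := hE1 b
      rw [hb, Option.bind_some, hk] at h1
      have h2 := hV1 (R.src b)
      have h3 := hV1 (R.tgt b)
      rw [m'.src_eq b d hb, Option.bind_some, p.src_eq b k h1.symm] at h2
      rw [m'.tgt_eq b d hb, Option.bind_some, p.tgt_eq b k h1.symm] at h3
      exact ⟨by rw [p.lab_eq b k h1.symm, m'.lab_eq b d hb], h2, h3⟩
    · have h1 := hE2 c
      rw [hc, Option.bind_some, hk] at h1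
      have h2 := hV2 (X.src c)
      have h3 := hV2 (X.tgt c)
      rw [r'.src_eq c d hc, Option.bind_some, q.src_eq c k h1.symm] at h2
      rw [r'.tgt_eq c d hc, Option.bind_some, q.tgt_eq c k h1.symm] at h3
      exact ⟨by rw [q.lab_eq c k h1.symm, r'.lab_eq c d hc], h2, h3⟩
  refine ⟨⟨ηV, ηE, fun d k hk => (hcases d k hk).1, fun d k hk => (hcases d k hk).2.1,
    fun d k hk => (hcases d k hk).2.2⟩, ⟨PHom.ext hV1 hE1, PHom.ext hV2 hE2⟩, ?_⟩
  rintro θ ⟨rfl, rfl⟩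
  exact PHom.ext (congrFun (h.nodes.desc_unique (fun b => (hV1 b).symm) fun c => (hV2 c).symm))
    (congrFun (h.edges.desc_unique (fun b => (hE1 b).symm) fun c => (hE2 c).symm))

/-- Every conflict-free total match has a pushout of the explicit form. -/
theorem exists_isSquare (r : PHom L R) (m : PHom L X) (hm : m.Total) (hcf : ConflictFree r m) :
    ∃ (H : DGraph Λ) (m' : PHom R H) (r' : PHom X H), IsSquare r m m' r' := by
  have hV := setSquare_glued (Z := fun _ => False) hm.1 hcf.1
  let fV : X.V → Option (Glued r.onV m.onV fun _ => False) := glueMap r.onV m.onV fun _ => False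
  -- Nodes are deleted only through the match, hence `False` above; unmatched edges are also deleted
  -- when they would dangle.
  let Z : X.E → Prop := fun e => fV (X.src e) = none ∨ fV (X.tgt e) = none
  have hE := setSquare_glued (Z := Z) hm.2 hcf.2
  let fE : X.E → Option (Glued r.onE m.onE Z) := glueMap r.onE m.onE Z
  -- Glued edges have glued ends, so source and target descend to the quotient.
  have hglue : ∀ {e e'}, Glue r.onE m.onE e e' →
      Glue r.onV m.onV (R.src e) (R.src e') ∧ Glue r.onV m.onV (R.tgt e) (R.tgt e') := by
    rintro e e' ⟨a, a', ha, ha', hg⟩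
    obtain ⟨c, hc⟩ := Option.ne_none_iff_exists'.1 (hm.2 a)
    have hc' := hg.symm.trans hc
    exact ⟨⟨_, _, r.src_eq a e ha, r.src_eq a' e' ha', by rw [m.src_eq a c hc, m.src_eq a' c hc']⟩,
      ⟨_, _, r.tgt_eq a e ha, r.tgt_eq a' e' ha', by rw [m.tgt_eq a c hc, m.tgt_eq a' c hc']⟩⟩
  have hfin := X.finV
  have hfin' := R.finV
  have hfin'' := X.finE
  have hfin''' := R.finE
  let H : DGraph Λ :=
    { V := Glued r.onV m.onV fun _ => False
      E := Glued r.onE m.onE Z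
      finV := inferInstance
      finE := inferInstance
      src := Sum.elim (Quot.lift (fun e => Sum.inl (Quot.mk _ (R.src e)))
          fun _ _ h => congrArg Sum.inl (Quot.sound (hglue h).1))
        fun e => (fV (X.src e.1)).get (Option.ne_none_iff_isSome.1 fun h => e.2.2 (Or.inl h))
      tgt := Sum.elim (Quot.lift (fun e => Sum.inl (Quot.mk _ (R.tgt e)))
          fun _ _ h => congrArg Sum.inl (Quot.sound (hglue h).2))
        fun e => (fV (X.tgt e.1)).get (Option.ne_none_iff_isSome.1 fun h => e.2.2 (Or.inr h))
      lab := Sum.elim (Quot.lift R.lab (by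
          rintro e e' ⟨a, a', ha, ha', hg⟩
          obtain ⟨c, hc⟩ := Option.ne_none_iff_exists'.1 (hm.2 a)
          rw [r.lab_eq a e ha, r.lab_eq a' e' ha', ← m.lab_eq a c hc,
            ← m.lab_eq a' c (hg.symm.trans hc)]))
        fun e => X.lab e.1 }
  let m' : PHom R H :=
    { onV := fun b => some (Sum.inl (Quot.mk _ b))
      onE := fun b => some (Sum.inl (Quot.mk _ b))
      lab_eq := by rintro e _ ⟨⟩; rfl
      src_eq := by rintro e _ ⟨⟩; rfl
      tgt_eq := by rintro e _ ⟨⟩; rfl }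
  have key : ∀ e (d : H.E), fE e = some d → H.lab d = X.lab e ∧
      fV (X.src e) = some (H.src d) ∧ fV (X.tgt e) = some (H.tgt d) := by
    intro e d hd
    rcases d with x | x
    · obtain ⟨a, b, ha, hb, rfl⟩ := glueMap_eq_inl hd
      refine ⟨?_, ?_, ?_⟩
      · exact (r.lab_eq a b hb).trans (m.lab_eq a e ha).symm
      · exact glueMap_of_eq (r.src_eq a b hb) (m.src_eq a e ha)
      · exact glueMap_of_eq (r.tgt_eq a b hb) (m.tgt_eq a e ha)
    · obtain rfl := glueMap_eq_inr hd
      exact ⟨rfl, (Option.some_get _).symm, (Option.some_get _).symm⟩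
  let r' : PHom X H :=
    { onV := fV
      onE := fE
      lab_eq := fun e d h => (key e d h).1
      src_eq := fun e d h => (key e d h).2.1
      tgt_eq := fun e d h => (key e d h).2.2 }
  refine ⟨H, m', r', hV, hE, fun x hx => ?_, fun e he => glueMap_eq_none he⟩
  rcases glueMap_eq_none (Z := fun _ : X.V => False) hx with h | h
  · exact h
  · exact h.elim

/-- An explicit square exists and is a pushout, so any other pushout is isomorphic to it, and the
explicit conditions are carried along the isomorphism. -/
theorem isPushout_iff_isSquare (hm : m.Total) (hcf : ConflictFree r m) :
    IsPushout r m m' r' ↔ IsSquare r m m' r' := by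
  refine ⟨fun h => ?_, fun h => h.isPushout⟩
  obtain ⟨H₀, m₀, r₀, h₀⟩ := exists_isSquare r m hm hcf
  have hp₀ := h₀.isPushout
  obtain ⟨θ, ⟨hθ1, hθ2⟩, -⟩ := hp₀.2 H m' r' h.1
  obtain ⟨η, ⟨hη1, hη2⟩, -⟩ := h.2 H₀ m₀ r₀ hp₀.1
  have hηθ : η.comp θ = PHom.id H₀ := (hp₀.2 H₀ m₀ r₀ hp₀.1).unique
    ⟨by rw [PHom.comp_assoc, hθ1, hη1], by rw [PHom.comp_assoc, hθ2, hη2]⟩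
    ⟨PHom.id_comp _, PHom.id_comp _⟩
  have hθη : θ.comp η = PHom.id H := (h.2 H m' r' h.1).unique
    ⟨by rw [PHom.comp_assoc, hη1, hθ1], by rw [PHom.comp_assoc, hη2, hθ2]⟩
    ⟨PHom.id_comp _, PHom.id_comp _⟩
  have hV : ∀ x, (θ.onV x).bind η.onV = some x := fun x =>
    congrArg (fun φ : PHom H₀ H₀ => φ.onV x) hηθ
  have hE : ∀ x, (θ.onE x).bind η.onE = some x := fun x =>
    congrArg (fun φ : PHom H₀ H₀ => φ.onE x) hηθ
  have hV' : ∀ x, (η.onV x).bind θ.onV = some x := fun x =>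
    congrArg (fun φ : PHom H H => φ.onV x) hθη
  have hE' : ∀ x, (η.onE x).bind θ.onE = some x := fun x =>
    congrArg (fun φ : PHom H H => φ.onE x) hθη
  have htotV : ∀ x, θ.onV x ≠ none := fun x hx => by simpa [hx] using hV x
  subst hθ1 hθ2
  refine ⟨h₀.nodes.map_bijective htotV ?_ ?_, h₀.edges.map_bijective ?_ ?_ ?_, fun x hx => ?_,
    fun e he => ?_⟩
  · intro x y hxy
    have := hV x
    rw [hxy, hV y] at this
    exact (Option.some.inj this).symm
  · intro y
    obtain ⟨x, -, hx⟩ := Option.bind_eq_some_iff.1 (hV' y)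
    exact ⟨x, hx⟩
  · intro x hx
    simpa [hx] using hE x
  · intro x y hxy
    have := hE x
    rw [hxy, hE y] at this
    exact (Option.some.inj this).symm
  · intro y
    obtain ⟨x, -, hx⟩ := Option.bind_eq_some_iff.1 (hE' y)
    exact ⟨x, hx⟩
  · apply h₀.delV
    by_contra hne
    obtain ⟨y, hy⟩ := Option.ne_none_iff_exists'.1 hne
    exact htotV y (by simpa [hy] using hx)
  · have he' : r₀.onE e = none := by
      by_contra hne
      obtain ⟨y, hy⟩ := Option.ne_none_iff_exists'.1 hne
      have h1 : θ.onE y = none := by simpa [hy] using he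
      simpa [h1] using hE y
    rcases h₀.delE e he' with h | h | h
    · exact Or.inl h
    · exact Or.inr (Or.inl (by simp [h]))
    · exact Or.inr (Or.inr (by simp [h]))

end Morphisms

/-! ## Embeddings and the induced subgraph order -/

section Embeddings

variable {Λ : Type} {G H K L R X : DGraph Λ}

/-- Total injective morphisms. -/
structure PHom.Emb (ι : PHom G H) : Prop where
  total : ι.Total
  injV : Function.Injective ι.onV
  injE : Function.Injective ι.onE

/-- Embeddings whose image contains every edge between nodes of the image. -/
structure PHom.IndEmb (ι : PHom G H) : Prop extends ι.Emb where
  full : ∀ e x y, ι.onV x = some (H.src e) → ι.onV y = some (H.tgt e) → ∃ d, ι.onE d = some e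

theorem PHom.Total.exists_eq {φ : PHom G H} (h : φ.Total) :
    ∃ (f : G.V → H.V) (g : G.E → H.E), (∀ x, φ.onV x = some (f x)) ∧ ∀ e, φ.onE e = some (g e) := by
  choose f hf using fun x => Option.ne_none_iff_exists'.1 (h.1 x)
  choose g hg using fun e => Option.ne_none_iff_exists'.1 (h.2 e)
  exact ⟨f, g, hf, hg⟩

theorem PHom.Total.comp {ψ : PHom H K} {φ : PHom G H} (hψ : ψ.Total) (hφ : φ.Total) :
    (ψ.comp φ).Total := by
  obtain ⟨f, g, hf, hg⟩ := hφ.exists_eq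
  exact ⟨fun x => by simpa [hf] using hψ.1 _, fun e => by simpa [hg] using hψ.2 _⟩

theorem PHom.Emb.comp {ψ : PHom H K} {φ : PHom G H} (hψ : ψ.Emb) (hφ : φ.Emb) :
    (ψ.comp φ).Emb := by
  obtain ⟨f, g, hf, hg⟩ := hφ.total.exists_eq
  refine ⟨hψ.total.comp hφ.total, fun x y h => ?_, fun x y h => ?_⟩
  · simp only [PHom.comp_onV, hf, Option.bind_some] at h
    exact hφ.injV (by rw [hf, hf, hψ.injV h])
  · simp only [PHom.comp_onE, hg, Option.bind_some] at h
    exact hφ.injE (by rw [hg, hg, hψ.injE h])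

theorem PHom.IndEmb.comp {ψ : PHom H K} {φ : PHom G H} (hψ : ψ.IndEmb) (hφ : φ.IndEmb) :
    (ψ.comp φ).IndEmb := by
  obtain ⟨f, g, hf, hg⟩ := hφ.total.exists_eq
  refine ⟨hψ.toEmb.comp hφ.toEmb, fun e x y hx hy => ?_⟩
  simp only [PHom.comp_onV, hf, Option.bind_some] at hx hy
  obtain ⟨d, hd⟩ := hψ.full e _ _ hx hy
  have h1 := hψ.injV (hx.trans (ψ.src_eq d e hd).symm)
  have h2 := hψ.injV (hy.trans (ψ.tgt_eq d e hd).symm)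
  obtain ⟨c, hc⟩ := hφ.full d x y (by rw [hf, h1]) (by rw [hf, h2])
  exact ⟨c, by simp [hc, hd]⟩

theorem PHom.indEmb_id (G : DGraph Λ) : (PHom.id G).IndEmb :=
  ⟨⟨⟨fun _ => Option.some_ne_none _, fun _ => Option.some_ne_none _⟩, Option.some_injective _,
    Option.some_injective _⟩,
    fun e _ _ _ _ => ⟨e, rfl⟩⟩

/-- The morphism underlying an isomorphism. -/
def GIso.toPHom (φ : GIso G H) : PHom G H where
  onV x := some (φ.onV x)
  onE e := some (φ.onE e)
  lab_eq _ _ h := by cases h; exact φ.lab_eq _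
  src_eq _ _ h := by cases h; rw [φ.src_eq]
  tgt_eq _ _ h := by cases h; rw [φ.tgt_eq]

/-- The inverse of an isomorphism. -/
def GIso.symm (φ : GIso G H) : GIso H G where
  onV := φ.onV.symm
  onE := φ.onE.symm
  src_eq e := by rw [Equiv.eq_symm_apply, ← φ.src_eq, Equiv.apply_symm_apply]
  tgt_eq e := by rw [Equiv.eq_symm_apply, ← φ.tgt_eq, Equiv.apply_symm_apply]
  lab_eq e := by rw [← φ.lab_eq, Equiv.apply_symm_apply]

theorem GIso.indEmb (φ : GIso G H) : φ.toPHom.IndEmb :=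
  ⟨⟨⟨fun _ => by simp [GIso.toPHom], fun _ => by simp [GIso.toPHom]⟩,
    fun _ _ h => φ.onV.injective (Option.some.inj h),
    fun _ _ h => φ.onE.injective (Option.some.inj h)⟩,
    fun e _ _ _ _ => ⟨φ.onE.symm e, by simp [GIso.toPHom]⟩⟩

/-- The inclusion of an induced subgraph. -/
def inclusion (G : DGraph Λ) (W : Set G.V) : PHom (G.induce W) G where
  onV x := some x.1
  onE e := some e.1
  lab_eq _ _ h := by cases h; rfl
  src_eq _ _ h := by cases h; rfl
  tgt_eq _ _ h := by cases h; rfl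

theorem indEmb_inclusion (G : DGraph Λ) (W : Set G.V) : (inclusion G W).IndEmb :=
  ⟨⟨⟨fun _ => by simp [inclusion], fun _ => by simp [inclusion]⟩,
    fun _ _ h => Subtype.ext (Option.some.inj h), fun _ _ h => Subtype.ext (Option.some.inj h)⟩,
    fun e x y hx hy => ⟨⟨e, Option.some.inj hx ▸ x.2, Option.some.inj hy ▸ y.2⟩, rfl⟩⟩

theorem indSub_iff : IndSub G H ↔ ∃ ι : PHom G H, ι.IndEmb := by
  constructor
  · rintro ⟨W, ⟨φ⟩⟩
    exact ⟨_, (indEmb_inclusion H W).comp φ.indEmb⟩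
  · rintro ⟨ι, hι⟩
    obtain ⟨f, g, hf, hg⟩ := hι.total.exists_eq
    have hs : ∀ e, H.src (g e) = f (G.src e) := fun e =>
      Option.some.inj ((ι.src_eq e _ (hg e)).symm.trans (hf _))
    have ht : ∀ e, H.tgt (g e) = f (G.tgt e) := fun e =>
      Option.some.inj ((ι.tgt_eq e _ (hg e)).symm.trans (hf _))
    let fV : G.V → Set.range f := fun x => ⟨f x, x, rfl⟩
    let fE : G.E → (H.induce (Set.range f)).E := fun e => ⟨g e, ⟨_, (hs e).symm⟩, ⟨_, (ht e).symm⟩⟩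
    have hV : Function.Bijective fV :=
      ⟨fun x y h => hι.injV ((hf x).trans ((congrArg some (Subtype.ext_iff.1 h)).trans (hf y).symm)),
        fun ⟨_, x, h⟩ => ⟨x, Subtype.ext h⟩⟩
    have hE : Function.Bijective fE := by
      refine ⟨fun x y h =>
        hι.injE ((hg x).trans ((congrArg some (Subtype.ext_iff.1 h)).trans (hg y).symm)), ?_⟩
      rintro ⟨e, ⟨x, hx⟩, ⟨y, hy⟩⟩
      obtain ⟨d, hd⟩ := hι.full e x y (by rw [hf, hx]) (by rw [hf, hy])
      exact ⟨d, Subtype.ext (Option.some.inj ((hg d).symm.trans hd))⟩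
    refine ⟨Set.range f, ⟨⟨Equiv.ofBijective fV hV, Equiv.ofBijective fE hE, fun e => ?_,
      fun e => ?_, fun e => ι.lab_eq e _ (hg e)⟩⟩⟩
    · exact Subtype.ext (hs e)
    · exact Subtype.ext (ht e)

theorem IndSub.refl (G : DGraph Λ) : IndSub G G := indSub_iff.2 ⟨_, PHom.indEmb_id G⟩

theorem IndSub.trans (h : IndSub G H) (h' : IndSub H K) : IndSub G K := by
  obtain ⟨ι, hι⟩ := indSub_iff.1 h
  obtain ⟨κ, hκ⟩ := indSub_iff.1 h'
  exact indSub_iff.2 ⟨_, hκ.comp hι⟩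

theorem GIso.indSub (φ : GIso G H) : IndSub G H := indSub_iff.2 ⟨_, φ.indEmb⟩

theorem indSub_induce (G : DGraph Λ) (W : Set G.V) : IndSub (G.induce W) G :=
  indSub_iff.2 ⟨_, indEmb_inclusion G W⟩

/-- If the image of `φ` lies in that of `ψ`, then `φ` factors through the embedding `ψ`. -/
theorem PHom.IndEmb.indSub_of_range {ψ : PHom H K} {φ : PHom G K} (hψ : ψ.IndEmb) (hφ : φ.IndEmb)
    (hr : ∀ x, ∃ y, ψ.onV y = φ.onV x) : IndSub G H := by
  obtain ⟨f, g, hf, hg⟩ := hφ.total.exists_eq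
  choose p hp using hr
  have hq : ∀ e, ∃ d, ψ.onE d = φ.onE e := by
    intro e
    obtain ⟨d, hd⟩ := hψ.full (g e) (p (G.src e)) (p (G.tgt e))
      (by rw [hp, φ.src_eq e _ (hg e)]) (by rw [hp, φ.tgt_eq e _ (hg e)])
    exact ⟨d, hd.trans (hg e).symm⟩
  choose q hq using hq
  refine indSub_iff.2 ⟨⟨fun x => some (p x), fun e => some (q e), ?_, ?_, ?_⟩, ⟨⟨⟨fun _ => by simp,
    fun _ => by simp⟩, fun x y h => ?_, fun x y h => ?_⟩, fun e x y hx hy => ?_⟩⟩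
  · rintro e _ ⟨⟩
    rw [← ψ.lab_eq (q e) (g e) (by rw [hq, hg]), φ.lab_eq e _ (hg e)]
  · rintro e _ ⟨⟩
    refine congrArg some (hψ.injV ?_)
    rw [hp, φ.src_eq e _ (hg e), ψ.src_eq (q e) (g e) (by rw [hq, hg])]
  · rintro e _ ⟨⟩
    refine congrArg some (hψ.injV ?_)
    rw [hp, φ.tgt_eq e _ (hg e), ψ.tgt_eq (q e) (g e) (by rw [hq, hg])]
  · exact hφ.injV (by rw [← hp, ← hp, Option.some.inj h])
  · exact hφ.injE (by rw [← hq, ← hq, Option.some.inj h])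
  · obtain ⟨d, hd⟩ := Option.ne_none_iff_exists'.1 (hψ.total.2 e)
    obtain ⟨c, hc⟩ := hφ.full d x y
      (by rw [← hp, Option.some.inj hx, ψ.src_eq e d hd])
      (by rw [← hp, Option.some.inj hy, ψ.tgt_eq e d hd])
    exact ⟨c, congrArg some (hψ.injE (by rw [hq, hc, hd]))⟩

theorem PHom.Emb.card_le {ι : PHom G H} (h : ι.Emb) :
    Nat.card G.V ≤ Nat.card H.V ∧ Nat.card G.E ≤ Nat.card H.E := by
  obtain ⟨f, g, hf, hg⟩ := h.total.exists_eq
  have := H.finV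
  have := H.finE
  exact ⟨Nat.card_le_card_of_injective f fun x y hxy => h.injV (by rw [hf, hf, hxy]),
    Nat.card_le_card_of_injective g fun x y hxy => h.injE (by rw [hg, hg, hxy])⟩

/-- Subgraphs of bounded graphs are bounded. -/
theorem PHom.Emb.mem_boundedGraphs {ι : PHom G H} (h : ι.Emb) {n k : ℕ}
    (hH : H ∈ boundedGraphs Λ n k) : G ∈ boundedGraphs Λ n k := by
  obtain ⟨f, g, hf, hg⟩ := h.total.exists_eq
  have hfi : Function.Injective f := fun x y hxy => h.injV (by rw [hf, hf, hxy])
  have hgi : Function.Injective g := fun x y hxy => h.injE (by rw [hg, hg, hxy])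
  have hs : ∀ e, H.src (g e) = f (G.src e) := fun e =>
    Option.some.inj ((ι.src_eq e _ (hg e)).symm.trans (hf _))
  have ht : ∀ e, H.tgt (g e) = f (G.tgt e) := fun e =>
    Option.some.inj ((ι.tgt_eq e _ (hg e)).symm.trans (hf _))
  refine ⟨fun l v e hp => hH.1 l (f ∘ v) (g ∘ e) ⟨hfi.comp hp.1, hgi.comp hp.2.1, fun i => ?_⟩,
    fun u v a => le_trans ?_ (hH.2 (f u) (f v) a)⟩
  · have key : ∀ d v, G.Incident d v → H.Incident (g d) (f v) := fun d v hd => by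
      simp only [DGraph.Incident, hs, ht]
      exact hd.imp (congrArg f) (congrArg f)
    exact ⟨key _ _ (hp.2.2 i).1, key _ _ (hp.2.2 i).2⟩
  · have := H.finE
    refine Nat.card_le_card_of_injective (fun e => ⟨g e.1, ?_, ?_, ?_⟩) fun x y hxy =>
      Subtype.ext (hgi (Subtype.ext_iff.1 hxy))
    · rw [hs, e.2.1]
    · rw [ht, e.2.2.1]
    · rw [ι.lab_eq _ _ (hg e.1), e.2.2.2]

/-- The induced subgraph order is compatible with forming pushouts along a larger graph. -/
theorem IsSquare.exists_indEmb {H₂ X₂ : DGraph Λ} {r : PHom L R} {m : PHom L X} {m' : PHom R H}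
    {r' : PHom X H} {m₂ : PHom L X₂} {m₂' : PHom R H₂} {r₂' : PHom X₂ H₂}
    (h : IsSquare r m m' r') (h₂ : IsSquare r m₂ m₂' r₂') (hm : m.Total) {ι : PHom X X₂}
    (hι : ι.IndEmb) (hιm : ι.comp m = m₂) :
    ∃ η : PHom H H₂, η.IndEmb ∧ η.comp m' = m₂' ∧ η.comp r' = r₂'.comp ι := by
  subst hιm
  obtain ⟨η, ⟨h1, h2⟩, -⟩ := h.isPushout.2 H₂ m₂' (r₂'.comp ι) (by
    rw [PHom.comp_assoc]
    exact PHom.ext h₂.nodes.comm h₂.edges.comm)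
  have h1V : ∀ b, (m'.onV b).bind η.onV = m₂'.onV b := fun b =>
    congrArg (fun φ : PHom R H₂ => φ.onV b) h1
  have h1E : ∀ b, (m'.onE b).bind η.onE = m₂'.onE b := fun b =>
    congrArg (fun φ : PHom R H₂ => φ.onE b) h1
  have h2V : ∀ c, (r'.onV c).bind η.onV = (ι.onV c).bind r₂'.onV := fun c =>
    congrArg (fun φ : PHom X H₂ => φ.onV c) h2
  have h2E : ∀ c, (r'.onE c).bind η.onE = (ι.onE c).bind r₂'.onE := fun c =>
    congrArg (fun φ : PHom X H₂ => φ.onE c) h2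
  obtain ⟨f, g, hf, hg⟩ := hι.total.exists_eq
  -- Suppose `η` is undefined at the image of `c`. Then `ι c` is deleted in the large square, hence
  -- matched by a deleted item; by injectivity of `ι` that item already matches `c`, so `c` has no
  -- image.
  have htotV : ∀ d, η.onV d ≠ none := by
    intro d
    rcases h.nodes.surj d with ⟨b, hb⟩ | ⟨c, hc⟩
    · have := h1V b
      rw [hb, Option.bind_some] at this
      rw [this]
      exact h₂.nodes.total b
    · have h3 := h2V c
      rw [hc, hf, Option.bind_some, Option.bind_some] at h3
      intro hn
      obtain ⟨a, ha, hra⟩ := h₂.delV _ (h3.symm.trans hn)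
      obtain ⟨c', hc', hcc⟩ := Option.bind_eq_some_iff.1 ha
      rw [hι.injV (hcc.trans (hf c).symm)] at hc'
      rw [h.nodes.eq_none hra hc'] at hc
      cases hc
  have htotE : ∀ d, η.onE d ≠ none := by
    intro d
    rcases h.edges.surj d with ⟨b, hb⟩ | ⟨c, hc⟩
    · have := h1E b
      rw [hb, Option.bind_some] at this
      rw [this]
      exact h₂.edges.total b
    · have h3 := h2E c
      rw [hc, hg, Option.bind_some, Option.bind_some] at h3
      intro hn
      rcases h₂.delE _ (h3.symm.trans hn) with ⟨a, ha, hra⟩ | hs | ht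
      · obtain ⟨c', hc', hcc⟩ := Option.bind_eq_some_iff.1 ha
        rw [hι.injE (hcc.trans (hg c).symm)] at hc'
        rw [h.edges.eq_none hra hc'] at hc
        cases hc
      · have h4 := h2V (X.src c)
        rw [ι.src_eq c _ (hg c), Option.bind_some, hs, r'.src_eq c d hc] at h4
        exact htotV _ h4
      · have h4 := h2V (X.tgt c)
        rw [ι.tgt_eq c _ (hg c), Option.bind_some, ht, r'.tgt_eq c d hc] at h4
        exact htotV _ h4
  have hinjV := h.nodes.comparison_injective h₂.nodes hι.injV hm.1 (fun _ => rfl) htotV h1V h2V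
  have hinjE := h.edges.comparison_injective h₂.edges hι.injE hm.2 (fun _ => rfl) htotE h1E h2E
  refine ⟨η, ⟨⟨⟨htotV, htotE⟩, hinjV, hinjE⟩, ?_⟩, h1, h2⟩
  -- The key to fullness: a surviving node of `X₂` whose image is hit by `η` lies in `X`. An edge of
  -- `H₂` coming from `X₂` between nodes hit by `η` thus has both ends in `X`, and fullness of `ι`
  -- applies.
  have hrange : ∀ x₂ x y, r₂'.onV x₂ = some y → η.onV x = some y → ∃ c, ι.onV c = some x₂ := by
    intro x₂ x y hx₂ hx
    have hpre : ∀ a, (ι.comp m).onV a = some x₂ → ∃ c, ι.onV c = some x₂ := fun a ha => by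
      obtain ⟨c, -, hc⟩ := Option.bind_eq_some_iff.1 ha
      exact ⟨c, hc⟩
    rcases h.nodes.surj x with ⟨b, hb⟩ | ⟨c, hc⟩
    · have h3 := h1V b
      rw [hb, Option.bind_some, hx] at h3
      obtain ⟨a, b', ha, -⟩ := h₂.nodes.mix b x₂ y h3.symm hx₂
      exact hpre a ha
    · have h3 := h2V c
      rw [hc, hf, Option.bind_some, Option.bind_some, hx] at h3
      rcases h₂.nodes.inj x₂ (f c) y hx₂ h3.symm with rfl | ⟨a, b, ha, -⟩
      · exact ⟨c, hf c⟩
      · exact hpre a ha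
  intro e x y hx hy
  rcases h₂.edges.surj e with ⟨b, hb⟩ | ⟨c₂, hc₂⟩
  · have h3 := h1E b
    rw [hb] at h3
    obtain ⟨d, -, hd⟩ := Option.bind_eq_some_iff.1 h3
    exact ⟨d, hd⟩
  · obtain ⟨cs, hcs⟩ := hrange _ x _ (r₂'.src_eq c₂ e hc₂) hx
    obtain ⟨ct, hct⟩ := hrange _ y _ (r₂'.tgt_eq c₂ e hc₂) hy
    obtain ⟨c, hc⟩ := hι.full c₂ cs ct hcs hct
    have h3 := h2E c
    rw [hc, Option.bind_some, hc₂] at h3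
    obtain ⟨d, -, hd⟩ := Option.bind_eq_some_iff.1 h3
    exact ⟨d, hd⟩

theorem ConflictFree.comp_emb {r : PHom L R} {m : PHom L G} (hcf : ConflictFree r m)
    (hm : m.Total) {ι : PHom G H} (hι : ι.Emb) : ConflictFree r (ι.comp m) := by
  obtain ⟨f, g, hf, hg⟩ := hm.exists_eq
  refine ⟨fun x y h => hcf.1 x y ?_, fun x y h => hcf.2 x y ?_⟩
  · simp only [PHom.comp_onV, hf, Option.bind_some] at h
    rw [hf, hf, hι.injV h]
  · simp only [PHom.comp_onE, hg, Option.bind_some] at h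
    rw [hg, hg, hι.injE h]

theorem ConflictFree.of_comp {r : PHom L R} {m : PHom L G} {ι : PHom G H}
    (hcf : ConflictFree r (ι.comp m)) : ConflictFree r m :=
  ⟨fun x y h => hcf.1 x y (by simp [h]), fun x y h => hcf.2 x y (by simp [h])⟩

theorem PHom.Total.of_comp {ψ : PHom H K} {φ : PHom G H} (h : (ψ.comp φ).Total) : φ.Total :=
  ⟨fun x hx => h.1 x (by simp [hx]), fun x hx => h.2 x (by simp [hx])⟩

theorem rewrites_iff {ρ : Rule Λ} : Rewrites ρ G H ↔
    ∃ (m : PHom ρ.L G) (m' : PHom ρ.R H) (r' : PHom G H),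
      m.Total ∧ ConflictFree ρ.r m ∧ IsSquare ρ.r m m' r' := by
  constructor
  · rintro ⟨m, m', r', hm, hcf, h⟩
    exact ⟨m, m', r', hm, hcf, (isPushout_iff_isSquare hm hcf).1 h⟩
  · rintro ⟨m, m', r', hm, hcf, h⟩
    exact ⟨m, m', r', hm, hcf, (isPushout_iff_isSquare hm hcf).2 h⟩

theorem Rewrites.exists_of_indSub {ρ : Rule Λ} {G' : DGraph Λ} (h : Rewrites ρ G H)
    (hG : IndSub G G') : ∃ H', Rewrites ρ G' H' ∧ IndSub H H' := by
  obtain ⟨m, m', r', hm, hcf, hsq⟩ := rewrites_iff.1 h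
  obtain ⟨ι, hι⟩ := indSub_iff.1 hG
  obtain ⟨H', m₂', r₂', hsq₂⟩ := exists_isSquare ρ.r (ι.comp m) (hι.total.comp hm)
    (hcf.comp_emb hm hι.toEmb)
  obtain ⟨η, hη, -⟩ := hsq.exists_indEmb hsq₂ hm hι rfl
  exact ⟨H', rewrites_iff.2 ⟨_, _, _, hι.total.comp hm, hcf.comp_emb hm hι.toEmb, hsq₂⟩,
    indSub_iff.2 ⟨η, hη⟩⟩

/-- A rewriting step producing a graph above `K` can be carried out in an induced subgraph whose
size is bounded in terms of the rule and `K`. -/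
theorem Rewrites.exists_induce {ρ : Rule Λ} (h : Rewrites ρ G H) (hK : IndSub K H) :
    ∃ (W : Set G.V) (H' : DGraph Λ), Rewrites ρ (G.induce W) H' ∧ IndSub K H' ∧
      Nat.card W ≤ Nat.card ρ.L.V + Nat.card K.V := by
  classical
  obtain ⟨m, m', r', hm, hcf, hsq⟩ := rewrites_iff.1 h
  obtain ⟨κ, hκ⟩ := indSub_iff.1 hK
  obtain ⟨f, g, hf, hg⟩ := hm.exists_eq
  obtain ⟨p, q, hp, hq⟩ := hκ.total.exists_eq
  have hpre : ∀ x : K.V, ∃ o : Option G.V, (∀ y, o = some y → r'.onV y = some (p x)) ∧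
      (o = none → ∃ b, m'.onV b = some (p x)) := by
    intro x
    rcases hsq.nodes.surj (p x) with hb | ⟨c, hc⟩
    · exact ⟨none, by simp, fun _ => hb⟩
    · exact ⟨some c, by rintro _ ⟨⟩; exact hc, by simp⟩
  choose o ho1 ho2 using hpre
  let W : Set G.V := Set.range f ∪ {y | ∃ x, o x = some y}
  have hL := ρ.L.finV
  have hKf := K.finV
  have hs : ∀ e, G.src (g e) = f (ρ.L.src e) := fun e =>
    Option.some.inj ((m.src_eq e _ (hg e)).symm.trans (hf _))
  have ht : ∀ e, G.tgt (g e) = f (ρ.L.tgt e) := fun e =>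
    Option.some.inj ((m.tgt_eq e _ (hg e)).symm.trans (hf _))
  let m₀ : PHom ρ.L (G.induce W) :=
    { onV := fun x => some ⟨f x, Or.inl ⟨x, rfl⟩⟩
      onE := fun e => some ⟨g e, Or.inl ⟨_, (hs e).symm⟩, Or.inl ⟨_, (ht e).symm⟩⟩
      lab_eq := by rintro e _ ⟨⟩; exact m.lab_eq e _ (hg e)
      src_eq := by rintro e _ ⟨⟩; exact congrArg some (Subtype.ext (hs e).symm)
      tgt_eq := by rintro e _ ⟨⟩; exact congrArg some (Subtype.ext (ht e).symm) }
  have hιm : (inclusion G W).comp m₀ = m := by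
    ext x : 1
    · exact (hf x).symm
    · exact (hg x).symm
  have hm₀ : m₀.Total := ⟨fun _ => by simp [m₀], fun _ => by simp [m₀]⟩
  have hcf₀ : ConflictFree ρ.r m₀ := by
    rw [← hιm] at hcf
    exact hcf.of_comp
  obtain ⟨H', m₁', r₁', hsq'⟩ := exists_isSquare ρ.r m₀ hm₀ hcf₀
  obtain ⟨η, hη, hη1, hη2⟩ := hsq'.exists_indEmb hsq hm₀ (indEmb_inclusion G W) hιm
  refine ⟨W, H', rewrites_iff.2 ⟨_, _, _, hm₀, hcf₀, hsq'⟩, hη.indSub_of_range hκ fun x => ?_, ?_⟩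
  · cases hox : o x with
    | none =>
      obtain ⟨b, hb⟩ := ho2 x hox
      have h3 : (m₁'.onV b).bind η.onV = m'.onV b := congrArg (fun φ : PHom _ _ => φ.onV b) hη1
      rw [hb] at h3
      obtain ⟨d, -, hd⟩ := Option.bind_eq_some_iff.1 h3
      exact ⟨d, hd.trans (hp x).symm⟩
    | some y =>
      have hy := ho1 x y hox
      have h3 : (r₁'.onV ⟨y, Or.inr ⟨x, hox⟩⟩).bind η.onV = r'.onV y :=
        congrArg (fun φ : PHom (G.induce W) H => φ.onV ⟨y, Or.inr ⟨x, hox⟩⟩) hη2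
      rw [hy] at h3
      obtain ⟨d, -, hd⟩ := Option.bind_eq_some_iff.1 h3
      exact ⟨d, hd.trans (hp x).symm⟩
  -- Each node of `W` is named by a node of `L` or of `K`, which gives the bound.
  · have hsub : W ⊆ Set.range (Sum.elim (fun x => some (f x)) o) ∘ some := by
      rintro y (⟨x, rfl⟩ | ⟨x, hx⟩)
      · exact ⟨Sum.inl x, rfl⟩
      · exact ⟨Sum.inr x, hx⟩
    choose t ht using fun y : W => hsub y.2
    rw [← Nat.card_sum]
    refine Nat.card_le_card_of_injective t fun y z hyz => Subtype.ext (Option.some.inj ?_)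
    exact (ht y).symm.trans ((congrArg _ hyz).trans (ht z))

end Embeddings

/-! ### Sizes of graphs. -/

section Counting

variable {Λ : Type} {G H : DGraph Λ}

theorem PHom.Emb.surjV {ι : PHom G H} (h : ι.Emb) (hc : Nat.card H.V ≤ Nat.card G.V) (y : H.V) :
    ∃ x, ι.onV x = some y := by
  obtain ⟨f, g, hf, -⟩ := h.total.exists_eq
  have := H.finV
  have := G.finV
  have hi : Function.Injective f := fun x y hxy => h.injV (by rw [hf, hf, hxy])
  obtain ⟨x, rfl⟩ := (hi.bijective_of_nat_card_le hc).2 y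
  exact ⟨x, hf x⟩

/-- An induced embedding that is onto the nodes is onto the edges too. The node count is therefore a
strictly monotone measure for the order, unlike for ordinary subgraphs. -/
theorem IndSub.symm_of_card_le (h : IndSub G H) (hc : Nat.card H.V ≤ Nat.card G.V) :
    IndSub H G := by
  obtain ⟨ι, hι⟩ := indSub_iff.1 h
  exact hι.indSub_of_range (PHom.indEmb_id H) fun x => hι.toEmb.surjV hc x

theorem IndSub.card_le (h : IndSub G H) : Nat.card G.V ≤ Nat.card H.V := by
  obtain ⟨ι, hι⟩ := indSub_iff.1 h
  exact hι.toEmb.card_le.1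

/-- Graphs of bounded multiplicity have boundedly many edges. -/
theorem DGraph.MultBounded.card_edges_le [Finite Λ] {k : ℕ} (h : G.MultBounded k) :
    Nat.card G.E ≤ k * (Nat.card Λ * (Nat.card G.V * Nat.card G.V)) := by
  have := G.finV
  have := G.finE
  have := Fintype.ofFinite (G.V × G.V × Λ)
  let t : G.E → G.V × G.V × Λ := fun e => (G.src e, G.tgt e, G.lab e)
  rw [← Nat.card_congr (Equiv.sigmaFiberEquiv t), Nat.card_sigma]
  refine (Finset.sum_le_card_nsmul _ _ k fun x _ => ?_).trans ?_
  · refine (Nat.card_congr (Equiv.subtypeEquivRight fun e => ?_)).trans_le (h x.1 x.2.1 x.2.2)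
    simp [t, Prod.ext_iff]
  · rw [Finset.card_univ, ← Nat.card_eq_fintype_card, Nat.card_prod, Nat.card_prod, smul_eq_mul]
    apply le_of_eq
    ring

/-- There are finitely many graphs of bounded size up to isomorphism. -/
theorem exists_list_iso (Λ : Type) [Finite Λ] (a b : ℕ) : ∃ l : List (DGraph Λ),
    ∀ X : DGraph Λ, Nat.card X.V ≤ a → Nat.card X.E ≤ b → ∃ Y ∈ l, Nonempty (GIso X Y) := by
  let I := Σ (N : Fin (a + 1)) (M : Fin (b + 1)),
    (Fin M → Fin N) × (Fin M → Fin N) × (Fin M → Λ)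
  let F : I → DGraph Λ := fun i =>
    { V := Fin i.1
      E := Fin i.2.1
      finV := inferInstance
      finE := inferInstance
      src := i.2.2.1
      tgt := i.2.2.2.1
      lab := i.2.2.2.2 }
  refine ⟨(Set.finite_range F).toFinset.toList, fun X hV hE => ?_⟩
  have := X.finV
  have := X.finE
  let f := Finite.equivFin X.V
  let g := Finite.equivFin X.E
  let i : I := ⟨⟨Nat.card X.V, by omega⟩, ⟨Nat.card X.E, by omega⟩, fun e => f (X.src (g.symm e)),
    fun e => f (X.tgt (g.symm e)), fun e => X.lab (g.symm e)⟩
  refine ⟨F i, by simp, ⟨⟨f, g, fun e => ?_, fun e => ?_, fun e => ?_⟩⟩⟩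
  · exact congrArg f (congrArg X.src (g.symm_apply_apply e))
  · exact congrArg f (congrArg X.tgt (g.symm_apply_apply e))
  · exact congrArg X.lab (g.symm_apply_apply e)

end Counting

theorem PHom.comp_id {Λ : Type} {G H : DGraph Λ} (φ : PHom G H) : φ.comp (PHom.id G) = φ := rfl

/-! ## Pushout complements -/

section Complements

variable {Λ : Type} {L R G : DGraph Λ} {r : PHom L R} {m' : PHom R G} {P P' P₀ : Completion r m'}

namespace Completion

theorem isComplement_iff : P.IsComplement ↔
    P.m.Total ∧ ConflictFree r P.m ∧ IsSquare r P.m m' P.r' :=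
  ⟨fun h => ⟨h.1, h.2.1, (isPushout_iff_isSquare h.1 h.2.1).1 h.2.2⟩,
    fun h => ⟨h.1, h.2.1, (isPushout_iff_isSquare h.1 h.2.1).2 h.2.2⟩⟩

theorem IsEmbedding.emb {ι : PHom P.X P'.X} (h : P.IsEmbedding P' ι) : ι.Emb :=
  ⟨h.1, h.2.1, h.2.2.1⟩

theorem IsEmbedding.comp {ι : PHom P₀.X P.X} {κ : PHom P.X P'.X} (hκ : P.IsEmbedding P' κ)
    (hι : P₀.IsEmbedding P ι) : P₀.IsEmbedding P' (κ.comp ι) :=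
  have h := hκ.emb.comp hι.emb
  ⟨h.total, h.injV, h.injE, by rw [PHom.comp_assoc, hι.2.2.2.1, hκ.2.2.2.1],
    by rw [← PHom.comp_assoc, hκ.2.2.2.2, hι.2.2.2.2]⟩

end Completion

/-- When `C` shrinks to a part still containing all matched elements, joint surjectivity is the only
condition that can fail, so it is the one assumed. The second conclusion pulls matched elements back
to the smaller part. -/
theorem SetSquare.of_injective {A B C C₀ D : Type*} {f : A → Option B} {g : A → Option C}
    {g' : B → Option D} {f' : C → Option D} (h : SetSquare f g g' f') {g₀ : A → Option C₀}
    {ι : C₀ → Option C} (hι : Function.Injective ι)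
    (hg : ∀ a, (g₀ a).bind ι = g a) (hgt : ∀ a, g a ≠ none)
    (hs : ∀ d, (∃ b, g' b = some d) ∨ ∃ c, (ι c).bind f' = some d) :
    SetSquare f g₀ g' (fun c => (ι c).bind f') ∧
      ∀ a c c₀, ι c₀ = some c → g a = some c → g₀ a = some c₀ := by
  have hpre : ∀ a c c₀, ι c₀ = some c → g a = some c → g₀ a = some c₀ := by
    intro a c c₀ hc ha
    rw [← hg] at ha
    obtain ⟨c₁, hc₁, hc'⟩ := Option.bind_eq_some_iff.1 ha
    rw [hc₁, hι (hc'.trans hc.symm)]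
  refine ⟨⟨fun a => ?_, h.total, hs, fun b b' hb => ?_, ?_, ?_⟩, hpre⟩
  · rw [h.comm, ← hg, Option.bind_assoc]
  · refine Relation.EqvGen.mono ?_ _ _ (h.ker b b' hb)
    rintro b b' ⟨a, a', ha, ha', hgg⟩
    refine ⟨a, a', ha, ha', ?_⟩
    obtain ⟨c, hc⟩ := Option.ne_none_iff_exists'.1 (hgt a)
    have h1 := hc
    rw [← hg] at h1
    obtain ⟨c₀, hc₀, hcc⟩ := Option.bind_eq_some_iff.1 h1
    rw [hc₀, hpre a' c c₀ hcc (hgg ▸ hc)]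
  · intro b c₀ d hb hc
    obtain ⟨c, hcc, hd⟩ := Option.bind_eq_some_iff.1 hc
    obtain ⟨a, b', ha, hb'⟩ := h.mix b c d hb hd
    exact ⟨a, b', hpre a c c₀ hcc ha, hb'⟩
  · intro c₀ c₀' d hc hc'
    obtain ⟨c, hcc, hd⟩ := Option.bind_eq_some_iff.1 hc
    obtain ⟨c', hcc', hd'⟩ := Option.bind_eq_some_iff.1 hc'
    rcases h.inj c c' d hd hd' with rfl | ⟨a, b, ha, hb⟩
    · exact Or.inl (hι (hcc.trans hcc'.symm))
    · exact Or.inr ⟨a, b, hpre a c c₀ hcc ha, hb⟩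

/-- Converse direction: new elements of `C` on which `f'` is undefined are invisible to every
condition of the square. -/
theorem SetSquare.extend {A B C C₀ D : Type*} {f : A → Option B} {g₀ : A → Option C₀}
    {g' : B → Option D} {f' : C → Option D} {ι : C₀ → Option C}
    (h : SetSquare f g₀ g' fun c => (ι c).bind f')
    (hnew : ∀ c, (∀ c₀, ι c₀ ≠ some c) → f' c = none) :
    SetSquare f (fun a => (g₀ a).bind ι) g' f' := by
  have hold : ∀ c d, f' c = some d → ∃ c₀, ι c₀ = some c ∧ (ι c₀).bind f' = some d := by
    intro c d hd
    by_cases hc : ∃ c₀, ι c₀ = some c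
    · obtain ⟨c₀, hc₀⟩ := hc
      exact ⟨c₀, hc₀, by rw [hc₀]; exact hd⟩
    · push Not at hc
      rw [hnew c hc] at hd
      cases hd
  refine ⟨fun a => ?_, h.total, fun d => ?_, fun b b' hb => ?_, ?_, ?_⟩
  · rw [h.comm, Option.bind_assoc]
  · refine (h.surj d).imp id ?_
    rintro ⟨c₀, hc₀⟩
    obtain ⟨c, -, hc⟩ := Option.bind_eq_some_iff.1 hc₀
    exact ⟨c, hc⟩
  · refine Relation.EqvGen.mono ?_ _ _ (h.ker b b' hb)
    rintro b b' ⟨a, a', ha, ha', hgg⟩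
    exact ⟨a, a', ha, ha', by simp only [hgg]⟩
  · intro b c d hb hc
    obtain ⟨c₀, hc₀, hd⟩ := hold c d hc
    obtain ⟨a, b', ha, hb'⟩ := h.mix b c₀ d hb hd
    exact ⟨a, b', by simp [ha, hc₀], hb'⟩
  · intro c c' d hc hc'
    obtain ⟨c₀, hc₀, hd⟩ := hold c d hc
    obtain ⟨c₀', hc₀', hd'⟩ := hold c' d hc'
    rcases h.inj c₀ c₀' d hd hd' with rfl | ⟨a, b, ha, hb⟩
    · exact Or.inl (Option.some.inj (hc₀.symm.trans hc₀'))
    · exact Or.inr ⟨a, b, by simp [ha, hc₀], hb⟩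

namespace Completion

/-- A subgraph of a pushout complement that still covers the pushout is a pushout complement. -/
theorem IsEmbedding.isComplement {ι : PHom P₀.X P.X} (hι : P₀.IsEmbedding P ι)
    (hP : P.IsComplement)
    (hsV : ∀ d, (∃ b, m'.onV b = some d) ∨ ∃ c, P₀.r'.onV c = some d)
    (hsE : ∀ d, (∃ b, m'.onE b = some d) ∨ ∃ c, P₀.r'.onE c = some d) : P₀.IsComplement := by
  obtain ⟨hm, hcf, hsq⟩ := isComplement_iff.1 hP
  obtain ⟨ht, hiV, hiE, h1, h2⟩ := hι
  have hm₀ : P₀.m.Total := by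
    rw [← h1] at hm
    exact hm.of_comp
  have hcf₀ : ConflictFree r P₀.m := by
    rw [← h1] at hcf
    exact hcf.of_comp
  have h1V : ∀ a, (P₀.m.onV a).bind ι.onV = P.m.onV a := fun a =>
    congrArg (fun φ : PHom L P.X => φ.onV a) h1
  have h1E : ∀ a, (P₀.m.onE a).bind ι.onE = P.m.onE a := fun a =>
    congrArg (fun φ : PHom L P.X => φ.onE a) h1
  have h2V : P₀.r'.onV = fun c => (ι.onV c).bind P.r'.onV := by rw [← h2]; rfl
  have h2E : P₀.r'.onE = fun c => (ι.onE c).bind P.r'.onE := by rw [← h2]; rfl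
  have h2V' : ∀ {c c'}, ι.onV c = some c' → P₀.r'.onV c = P.r'.onV c' := fun h => by
    rw [← h2, PHom.comp_onV, h, Option.bind_some]
  have h2E' : ∀ {c c'}, ι.onE c = some c' → P₀.r'.onE c = P.r'.onE c' := fun h => by
    rw [← h2, PHom.comp_onE, h, Option.bind_some]
  obtain ⟨hV, hpV⟩ := hsq.nodes.of_injective hiV h1V hm.1 (by rw [h2V] at hsV; exact hsV)
  obtain ⟨hE, hpE⟩ := hsq.edges.of_injective hiE h1E hm.2 (by rw [h2E] at hsE; exact hsE)
  refine isComplement_iff.2 ⟨hm₀, hcf₀, h2V ▸ hV, h2E ▸ hE, fun x hx => ?_, fun e he => ?_⟩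
  · obtain ⟨y, hy⟩ := Option.ne_none_iff_exists'.1 (ht.1 x)
    obtain ⟨a, ha, hra⟩ := hsq.delV y ((h2V' hy).symm.trans hx)
    exact ⟨a, hpV a y x hy ha, hra⟩
  · obtain ⟨d, hd⟩ := Option.ne_none_iff_exists'.1 (ht.2 e)
    rcases hsq.delE d ((h2E' hd).symm.trans he) with ⟨a, ha, hra⟩ | h | h
    · exact Or.inl ⟨a, hpE a d e hd ha, hra⟩
    · exact Or.inr (Or.inl ((h2V' (ι.src_eq e d hd)).trans h))
    · exact Or.inr (Or.inr ((h2V' (ι.tgt_eq e d hd)).trans h))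

theorem AddEdge.onE_eq_none (d : P'.X.E)
    (h : P'.r'.onV (P'.X.src d) = none ∨ P'.r'.onV (P'.X.tgt d) = none) : P'.r'.onE d = none := by
  by_contra hne
  obtain ⟨e, he⟩ := Option.ne_none_iff_exists'.1 hne
  rcases h with h | h
  · rw [P'.r'.src_eq d e he] at h
    cases h
  · rw [P'.r'.tgt_eq d e he] at h
    cases h

/-- Adding an edge attached to a deleted node yields a pushout complement. -/
theorem AddEdge.isComplement (hadd : P.AddEdge P') (hP : P.IsComplement) : P'.IsComplement := by
  obtain ⟨hm, hcf, hsq⟩ := isComplement_iff.1 hP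
  obtain ⟨ι, hι, hsurj, d, hd, hdel⟩ := hadd
  have hemb := hι.emb
  obtain ⟨ht, hiV, hiE, h1, h2⟩ := hι
  have h2V : P.r'.onV = fun c => (ι.onV c).bind P'.r'.onV := by rw [← h2]; rfl
  have h2E : P.r'.onE = fun c => (ι.onE c).bind P'.r'.onE := by rw [← h2]; rfl
  have h2V' : ∀ {c c'}, ι.onV c = some c' → P.r'.onV c = P'.r'.onV c' := fun h => by
    rw [← h2, PHom.comp_onV, h, Option.bind_some]
  have h2E' : ∀ {c c'}, ι.onE c = some c' → P.r'.onE c = P'.r'.onE c' := fun h => by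
    rw [← h2, PHom.comp_onE, h, Option.bind_some]
  have hsV := hsq.nodes
  rw [h2V] at hsV
  have hsE := hsq.edges
  rw [h2E] at hsE
  refine isComplement_iff.2 ⟨h1 ▸ ht.comp hm, h1 ▸ hcf.comp_emb hm hemb, ?_, ?_, fun y hy => ?_,
    fun e he => ?_⟩
  · rw [← h1]
    refine hsV.extend fun c hc => ?_
    obtain ⟨x, hx⟩ := hsurj c
    exact absurd hx (hc x)
  · rw [← h1]
    refine hsE.extend fun c hc => ?_
    by_cases hcd : c = d
    · exact hcd ▸ AddEdge.onE_eq_none d hdel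
    · obtain ⟨e, he⟩ := (hd c).2 hcd
      exact absurd he (hc e)
  · obtain ⟨x, hx⟩ := hsurj y
    obtain ⟨a, ha, hra⟩ := hsq.delV x ((h2V' hx).trans hy)
    exact ⟨a, by rw [← h1, PHom.comp_onV, ha]; exact hx, hra⟩
  · by_cases hed : e = d
    · exact Or.inr (hed ▸ hdel)
    · obtain ⟨e₀, he₀⟩ := (hd e).2 hed
      rcases hsq.delE e₀ ((h2E' he₀).trans he) with ⟨a, ha, hra⟩ | h | h
      · exact Or.inl ⟨a, by rw [← h1, PHom.comp_onE, ha]; exact he₀, hra⟩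
      · exact Or.inr (Or.inl ((h2V' (ι.src_eq e₀ e he₀)).symm.trans h))
      · exact Or.inr (Or.inr ((h2V' (ι.tgt_eq e₀ e he₀)).symm.trans h))

/-- An edge missing from a pushout complement that is contained in another one is attached to a
deleted node. -/
theorem IsEmbedding.deleted_of_notMem {ι : PHom P₀.X P.X} (hι : P₀.IsEmbedding P ι)
    (hP₀ : P₀.IsComplement) (hP : P.IsComplement) {e : P.X.E} (he : ∀ c, ι.onE c ≠ some e) :
    P.r'.onV (P.X.src e) = none ∨ P.r'.onV (P.X.tgt e) = none := by
  obtain ⟨-, -, hsq⟩ := isComplement_iff.1 hP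
  obtain ⟨-, -, hsq₀⟩ := isComplement_iff.1 hP₀
  obtain ⟨ht, hiV, hiE, h1, h2⟩ := hι
  have hm : ∀ a, P.m.onE a ≠ some e := by
    intro a ha
    rw [← h1] at ha
    obtain ⟨c, -, hc⟩ := Option.bind_eq_some_iff.1 ha
    exact he c hc
  -- A surviving `e` has its image covered in the smaller complement too, by `R` or by another edge.
  -- Either way the square for `P` forces `e` to be matched, hence in `P₀`, or equal to an edge of
  -- `P₀`.
  cases hd : P.r'.onE e with
  | some d =>
    rcases hsq₀.edges.surj d with ⟨b, hb⟩ | ⟨c, hc⟩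
    · obtain ⟨a, -, ha, -⟩ := hsq.edges.mix b e d hb hd
      exact absurd ha (hm a)
    · rw [← h2] at hc
      obtain ⟨c', hc', hc''⟩ := Option.bind_eq_some_iff.1 hc
      rcases hsq.edges.inj e c' d hd hc'' with rfl | ⟨a, -, ha, -⟩
      · exact absurd hc' (he c)
      · exact absurd ha (hm a)
  | none =>
    rcases hsq.delE e hd with ⟨a, ha, -⟩ | h
    · exact absurd ha (hm a)
    · exact h

/-- A pushout complement contained in `P` spans a pushout complement on an induced subgraph. -/
theorem IsEmbedding.exists_induce {ι : PHom P₀.X P.X} (hι : P₀.IsEmbedding P ι)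
    (hP₀ : P₀.IsComplement) (hP : P.IsComplement) :
    ∃ P₁ : Completion r m', P₁.IsComplement ∧ P₁.X = P.X.induce {y | ∃ x, ι.onV x = some y} := by
  obtain ⟨-, -, hsq₀⟩ := isComplement_iff.1 hP₀
  have hι' := hι
  obtain ⟨ht, hiV, hiE, h1, h2⟩ := hι'
  obtain ⟨f, g, hf, hg⟩ := ht.exists_eq
  let W : Set P.X.V := {y | ∃ x, ι.onV x = some y}
  let j : PHom P₀.X (P.X.induce W) :=
    { onV := fun x => some ⟨f x, x, hf x⟩
      onE := fun e => some ⟨g e, ⟨_, ι.src_eq e _ (hg e)⟩, ⟨_, ι.tgt_eq e _ (hg e)⟩⟩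
      lab_eq := by rintro e _ ⟨⟩; exact ι.lab_eq e _ (hg e)
      src_eq := by
        rintro e _ ⟨⟩
        exact congrArg some (Subtype.ext (Option.some.inj ((hf _).symm.trans (ι.src_eq e _ (hg e)))))
      tgt_eq := by
        rintro e _ ⟨⟩
        exact congrArg some
          (Subtype.ext (Option.some.inj ((hf _).symm.trans (ι.tgt_eq e _ (hg e))))) }
  have hj : (inclusion P.X W).comp j = ι := by
    ext x : 1
    · exact (hf x).symm
    · exact (hg x).symm
  let P₁ : Completion r m' := ⟨P.X.induce W, j.comp P₀.m, P.r'.comp (inclusion P.X W)⟩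
  have hemb : P₁.IsEmbedding P (inclusion P.X W) := by
    have h := (indEmb_inclusion P.X W).toEmb
    refine ⟨h.total, h.injV, h.injE, ?_, rfl⟩
    rw [← PHom.comp_assoc, hj, h1]
  -- `P₀` factors through `P₁`, so whatever `P₀` covers in `G` is covered by `P₁`.
  have hr : P₁.r'.comp j = P₀.r' := by rw [PHom.comp_assoc, hj, h2]
  refine ⟨P₁, hemb.isComplement hP (fun d => (hsq₀.nodes.surj d).imp id ?_)
    (fun d => (hsq₀.edges.surj d).imp id ?_), rfl⟩
  · rintro ⟨c, hc⟩
    rw [← hr, PHom.comp_onV] at hc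
    obtain ⟨c', -, hc'⟩ := Option.bind_eq_some_iff.1 hc
    exact ⟨c', hc'⟩
  · rintro ⟨c, hc⟩
    rw [← hr, PHom.comp_onE] at hc
    obtain ⟨c', -, hc'⟩ := Option.bind_eq_some_iff.1 hc
    exact ⟨c', hc'⟩

/-- An edge outside a smaller pushout complement can be removed, and adding it back is a step of
the saturation procedure. -/
theorem IsEmbedding.exists_addEdge {ι : PHom P₀.X P.X} (hι : P₀.IsEmbedding P ι)
    (hP₀ : P₀.IsComplement) (hP : P.IsComplement) {d : P.X.E} (hd : ∀ c, ι.onE c ≠ some d) :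
    ∃ P₁ : Completion r m', P₁.IsComplement ∧ P₁.AddEdge P := by
  obtain ⟨hm, -, -⟩ := isComplement_iff.1 hP
  obtain ⟨-, -, hsq₀⟩ := isComplement_iff.1 hP₀
  have hdel := hι.deleted_of_notMem hP₀ hP hd
  obtain ⟨ht, hiV, hiE, h1, h2⟩ := hι
  obtain ⟨p, q, hp, hq⟩ := hm.exists_eq
  have hqd : ∀ a, q a ≠ d := by
    intro a ha
    have h3 := hq a
    rw [← h1] at h3
    obtain ⟨c, -, hc⟩ := Option.bind_eq_some_iff.1 h3
    exact hd c (ha ▸ hc)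
  have := P.X.finE
  let X : DGraph Λ :=
    { V := P.X.V
      E := {e : P.X.E // e ≠ d}
      finV := P.X.finV
      finE := inferInstance
      src := fun e => P.X.src e.1
      tgt := fun e => P.X.tgt e.1
      lab := fun e => P.X.lab e.1 }
  let κ : PHom X P.X :=
    { onV := fun x => some x
      onE := fun e => some e.1
      lab_eq := by rintro e _ ⟨⟩; rfl
      src_eq := by rintro e _ ⟨⟩; rfl
      tgt_eq := by rintro e _ ⟨⟩; rfl }
  let m₁ : PHom L X :=
    { onV := P.m.onV
      onE := fun a => some ⟨q a, hqd a⟩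
      lab_eq := by rintro e _ ⟨⟩; exact P.m.lab_eq e _ (hq e)
      src_eq := by rintro e _ ⟨⟩; exact P.m.src_eq e _ (hq e)
      tgt_eq := by rintro e _ ⟨⟩; exact P.m.tgt_eq e _ (hq e) }
  let P₁ : Completion r m' := ⟨X, m₁, P.r'.comp κ⟩
  have hemb : P₁.IsEmbedding P κ := by
    refine ⟨⟨fun _ => by simp [κ], fun _ => by simp [κ]⟩, fun _ _ h => Option.some.inj h,
      fun _ _ h => Subtype.ext (Option.some.inj h), ?_, rfl⟩
    ext x : 1
    · exact Option.bind_fun_some _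
    · exact (hq x).symm
  -- Everything in `P₀` survives the removal of `d`, so `G` stays covered.
  refine ⟨P₁, hemb.isComplement hP (fun x => (hsq₀.nodes.surj x).imp id ?_)
    (fun x => (hsq₀.edges.surj x).imp id ?_), κ, hemb, fun y => ⟨y, rfl⟩, d, fun e => ?_, hdel⟩
  · rintro ⟨c, hc⟩
    rw [← h2] at hc
    obtain ⟨c', -, hc'⟩ := Option.bind_eq_some_iff.1 hc
    exact ⟨c', hc'⟩
  · rintro ⟨c, hc⟩
    rw [← h2] at hc
    obtain ⟨c', hcc, hc'⟩ := Option.bind_eq_some_iff.1 hc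
    exact ⟨⟨c', fun h => hd c (h ▸ hcc)⟩, hc'⟩
  · constructor
    · rintro ⟨e', he'⟩
      exact Option.some.inj he' ▸ e'.2
    · intro he
      exact ⟨⟨e, he⟩, rfl⟩

theorem AddEdge.card_lt (h : P.AddEdge P') : Nat.card P.X.E < Nat.card P'.X.E := by
  obtain ⟨ι, hι, -, d, hd, -⟩ := h
  obtain ⟨f, g, -, hg⟩ := hι.1.exists_eq
  have := P'.X.finE
  have := P.X.finE
  have hgi : Function.Injective g := fun x y hxy => hι.2.2.1 (by rw [hg, hg, hxy])
  refine lt_of_le_of_ne (Nat.card_le_card_of_injective g hgi) fun hc => ?_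
  obtain ⟨e, he⟩ := (hgi.bijective_of_nat_card_le hc.ge).2 d
  exact (hd d).1 ⟨e, he ▸ hg e⟩ rfl

/-- A deleted node is always matched, and an unmatched node is determined by its image in `G`. -/
theorem IsComplement.card_nodes_le (hP : P.IsComplement) :
    Nat.card P.X.V ≤ Nat.card L.V + Nat.card G.V := by
  obtain ⟨-, -, hsq⟩ := isComplement_iff.1 hP
  have key : ∀ c : P.X.V, ∃ z : L.V ⊕ G.V, Sum.elim (fun l => P.m.onV l = some c)
      (fun d => P.r'.onV c = some d ∧ ∀ l, P.m.onV l ≠ some c) z := by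
    intro c
    by_cases hc : ∃ l, P.m.onV l = some c
    · obtain ⟨l, hl⟩ := hc
      exact ⟨Sum.inl l, hl⟩
    · push Not at hc
      cases hd : P.r'.onV c with
      | some d => exact ⟨Sum.inr d, rfl, hc⟩
      | none =>
        obtain ⟨l, hl, -⟩ := hsq.delV c hd
        exact absurd hl (hc l)
  choose t ht using key
  have := L.finV
  have := G.finV
  rw [← Nat.card_sum]
  refine Nat.card_le_card_of_injective t fun c c' hcc => ?_
  have h1 := ht c
  have h2 := ht c'
  rw [← hcc] at h2
  cases hz : t c with
  | inl l =>
    rw [hz] at h1 h2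
    exact Option.some.inj (h1.symm.trans h2)
  | inr d =>
    rw [hz] at h1 h2
    rcases hsq.nodes.inj c c' d h1.1 h2.1 with h | ⟨a, b, ha, -⟩
    · exact h
    · exact absurd ha (h1.2 a)

end Completion

/-! ## The saturation procedure -/

variable {n k : ℕ}

theorem saturation_mono {i j : ℕ} (h : i ≤ j) : saturation r m' n k i ⊆ saturation r m' n k j := by
  induction h with
  | refl => exact subset_rfl
  | step _ ih => exact ih.trans Set.subset_union_left

theorem isComplement_of_mem_saturation {i : ℕ} (h : P ∈ saturation r m' n k i) :
    P.IsComplement ∧ P.X.MultBounded k := by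
  induction i generalizing P with
  | zero => exact ⟨h.1.1, h.2.2⟩
  | succ i ih =>
    rcases h with h | ⟨hb, P₀, hP₀, hadd⟩
    · exact ih h
    · exact ⟨hadd.isComplement (ih hP₀).1, hb⟩

/-- A round adds one edge, so a member with `e` edges is present by round `e`; a bound on edges thus
bounds the number of rounds. -/
theorem mem_saturation_card {i : ℕ} (h : P ∈ saturation r m' n k i) :
    P ∈ saturation r m' n k (Nat.card P.X.E) := by
  induction i generalizing P with
  | zero => exact saturation_mono (Nat.zero_le _) h
  | succ i ih =>
    rcases h with h | ⟨hb, P₀, hP₀, hadd⟩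
    · exact ih h
    · exact saturation_mono hadd.card_lt (Or.inr ⟨hb, P₀, ih hP₀, hadd⟩)

/-- If all pushout complements inside `P` have the same nodes as `P`, then saturation finds `P`. -/
theorem exists_mem_saturation (hb : P.X ∈ boundedGraphs Λ n k)
    (hspan : ∀ (P₀ : Completion r m') (ι : PHom P₀.X P.X), P₀.IsComplement → P₀.IsEmbedding P ι →
      ∀ y, ∃ x, ι.onV x = some y)
    (P' : Completion r m') (hP' : P'.IsComplement) (κ : PHom P'.X P.X)
    (hκ : P'.IsEmbedding P κ) : ∃ i, P' ∈ saturation r m' n k i := by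
  induction hc : Nat.card P'.X.E using Nat.strong_induction_on generalizing P' with
  | _ c ih =>
    have hb' := hκ.emb.mem_boundedGraphs hb
    by_cases hmin : P'.IsSubgraphMinimal
    · exact ⟨0, hmin, hb'⟩
    · have : ∃ (P₀ : Completion r m') (ι : PHom P₀.X P'.X), P₀.IsComplement ∧
          P₀.IsEmbedding P' ι ∧ ¬ ((∀ y, ∃ x, ι.onV x = some y) ∧ ∀ d, ∃ e, ι.onE e = some d) := by
        by_contra hcon
        exact hmin ⟨hP', fun P₀ hP₀ ι hι => not_not.1 fun h => hcon ⟨P₀, ι, hP₀, hι, h⟩⟩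
      obtain ⟨P₀, ι, hP₀, hι, hns⟩ := this
      -- By `hspan` the smaller complement has all nodes, so failure of minimality means a missing
      -- edge. Removing that edge lowers the induction measure, and `AddEdge` restores it.
      have hV : ∀ y, ∃ x, ι.onV x = some y := by
        intro y
        obtain ⟨z, hz⟩ := Option.ne_none_iff_exists'.1 (hκ.1.1 y)
        obtain ⟨x, hx⟩ := hspan P₀ _ hP₀ (hκ.comp hι) z
        obtain ⟨y', hy', hz'⟩ := Option.bind_eq_some_iff.1 hx
        exact ⟨x, by rw [hy', hκ.2.1 (hz'.trans hz.symm)]⟩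
      have hE : ∃ d, ∀ e, ι.onE e ≠ some d := by
        by_contra hE
        push Not at hE
        exact hns ⟨hV, hE⟩
      obtain ⟨d, hd⟩ := hE
      obtain ⟨P₁, hP₁, hadd⟩ := hι.exists_addEdge hP₀ hP' hd
      obtain ⟨ι₁, hι₁, -⟩ := id hadd
      obtain ⟨i, hi⟩ := ih _ (hc ▸ hadd.card_lt) P₁ hP₁ _ (hκ.comp hι₁) rfl
      exact ⟨i + 1, Or.inr ⟨hb'.2, P₁, hi, hadd⟩⟩

/-- A complement inside `X` that omitted a node would, by `IsEmbedding.exists_induce`, give a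
complement on a smaller induced subgraph, against minimality. So the spanning hypothesis of
`exists_mem_saturation` holds. -/
theorem mem_saturation_of_indMinimal {X : DGraph Λ}
    (hX : X ∈ indMinimal (objects {P : Completion r m' | P.IsComplement} ∩ boundedGraphs Λ n k)) :
    ∃ i, ∃ P ∈ saturation r m' n k i, P.X = X := by
  obtain ⟨⟨⟨P, hP, rfl⟩, hb⟩, hmin⟩ := hX
  have hspan : ∀ (P₀ : Completion r m') (ι : PHom P₀.X P.X), P₀.IsComplement →
      P₀.IsEmbedding P ι → ∀ y, ∃ x, ι.onV x = some y := by
    intro P₀ ι hP₀ hι y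
    obtain ⟨P₁, hP₁, hX₁⟩ := hι.exists_induce hP₀ hP
    have hsub := indSub_induce P.X {y | ∃ x, ι.onV x = some y}
    have h := hmin _ ⟨⟨P₁, hP₁, hX₁⟩, by
      obtain ⟨κ, hκ⟩ := indSub_iff.1 hsub
      exact hκ.toEmb.mem_boundedGraphs hb⟩ hsub
    obtain ⟨z, hz⟩ := (indEmb_inclusion P.X {y | ∃ x, ι.onV x = some y}).toEmb.surjV h.card_le y
    exact Option.some.inj hz ▸ z.2
  obtain ⟨i, hi⟩ := exists_mem_saturation hb hspan P hP (PHom.id _)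
    ⟨(PHom.indEmb_id _).total, (PHom.indEmb_id _).injV, (PHom.indEmb_id _).injE,
      PHom.id_comp _, PHom.comp_id _⟩
  exact ⟨i, P, hi, rfl⟩

/-- Node bound `a` from `IsComplement.card_nodes_le`, edge bound `b` from the multiplicity; round
`b` is then late enough for every member. -/
theorem saturation_stationary [Finite Λ] (r : PHom L R) (m' : PHom R G) (n k : ℕ) :
    ∃ N, (∀ i, saturation r m' n k i ⊆ saturation r m' n k N) ∧
      ∃ l : List (DGraph Λ), ∀ X ∈ objects (saturation r m' n k N), ∃ Y ∈ l, Nonempty (GIso X Y) := by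
  let a := Nat.card L.V + Nat.card G.V
  let b := k * (Nat.card Λ * (a * a))
  have hbound : ∀ {i} {P : Completion r m'}, P ∈ saturation r m' n k i →
      Nat.card P.X.V ≤ a ∧ Nat.card P.X.E ≤ b := by
    intro i P hP
    obtain ⟨hc, hm⟩ := isComplement_of_mem_saturation hP
    refine ⟨hc.card_nodes_le, hm.card_edges_le.trans ?_⟩
    have h := hc.card_nodes_le
    exact Nat.mul_le_mul_left _ (Nat.mul_le_mul_left _ (Nat.mul_le_mul h h))
  obtain ⟨l, hl⟩ := exists_list_iso Λ a b
  refine ⟨b, fun i P hP => saturation_mono (hbound hP).2 (mem_saturation_card hP), l, ?_⟩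
  rintro X ⟨P, hP, rfl⟩
  exact hl _ (hbound hP).1 (hbound hP).2

theorem exists_indMinimal {A : Set (DGraph Λ)} {X : DGraph Λ} (hX : X ∈ A) :
    ∃ Y ∈ indMinimal A, IndSub Y X := by
  induction hc : Nat.card X.V using Nat.strong_induction_on generalizing X with
  | _ c ih =>
    by_cases hmin : X ∈ indMinimal A
    · exact ⟨X, hmin, IndSub.refl X⟩
    · have : ∃ Y ∈ A, IndSub Y X ∧ ¬ IndSub X Y := by
        by_contra hcon
        push Not at hcon
        exact hmin ⟨hX, hcon⟩
      obtain ⟨Y, hY, hYX, hXY⟩ := this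
      have hlt : Nat.card Y.V < c := hc ▸ not_le.1 fun h => hXY (hYX.symm_of_card_le h)
      obtain ⟨Z, hZ, hZY⟩ := ih _ hlt hY rfl
      exact ⟨Z, hZ, hZY.trans hYX⟩

/-- Saturation computes the minimal pushout complements among the bounded graphs. -/
theorem saturation_spec [Finite Λ] (r : PHom L R) (m' : PHom R G) (n k : ℕ) :
    ∃ N : ℕ, saturation r m' n k (N + 1) = saturation r m' n k N ∧
      (∃ l : List (DGraph Λ), ∀ X ∈ objects (saturation r m' n k N),
        ∃ Y ∈ l, Nonempty (GIso X Y)) ∧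
      (∀ P ∈ saturation r m' n k N, P.IsComplement) ∧
      indMinimal (objects (saturation r m' n k N) ∩ boundedGraphs Λ n k) =
        indMinimal (objects {P : Completion r m' | P.IsComplement} ∩ boundedGraphs Λ n k) := by
  obtain ⟨N, hN, hl⟩ := saturation_stationary r m' n k
  refine ⟨N, (hN _).antisymm (saturation_mono N.le_succ), hl,
    fun P hP => (isComplement_of_mem_saturation hP).1, ?_⟩
  have hsub : objects (saturation r m' n k N) ∩ boundedGraphs Λ n k ⊆
      objects {P : Completion r m' | P.IsComplement} ∩ boundedGraphs Λ n k := by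
    rintro _ ⟨⟨P, hP, rfl⟩, hb⟩
    exact ⟨⟨P, (isComplement_of_mem_saturation hP).1, rfl⟩, hb⟩
  have hmem : indMinimal (objects {P : Completion r m' | P.IsComplement} ∩ boundedGraphs Λ n k) ⊆
      objects (saturation r m' n k N) ∩ boundedGraphs Λ n k := by
    intro X hX
    obtain ⟨i, P, hP, rfl⟩ := mem_saturation_of_indMinimal hX
    exact ⟨⟨P, hN i hP, rfl⟩, hX.1.2⟩
  refine Set.Subset.antisymm (fun X hX => ⟨hsub hX.1, fun Y hY hYX => ?_⟩)
    fun X hX => ⟨hmem hX, fun Y hY => hX.2 Y (hsub hY)⟩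
  -- A competitor `Y` need not be found by saturation, but a minimal `Z` below it is, and `X` can be
  -- compared with `Z`.
  obtain ⟨Z, hZ, hZY⟩ := exists_indMinimal hY
  exact (hX.2 Z (hmem hZ) (hZY.trans hYX)).trans hZY

end Complements

/-! ## Labelled structures and their well-quasi-order -/

section Structures

/-- A finite set of vertices in a surrounding labelled binary structure. -/
structure LStruct (D Y : Type) where
  V : Type
  finV : Finite V
  nonempty : Nonempty V
  adj : V → V → D
  dom : Set V
  lab : V → Y

variable {D Y : Type}

/-- Embeddings of labelled structures. -/
def LStruct.Emb (S T : LStruct D Y) : Prop :=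
  ∃ f : S.V → T.V, Set.InjOn f S.dom ∧ Set.MapsTo f S.dom T.dom ∧
    (∀ u ∈ S.dom, ∀ v ∈ S.dom, T.adj (f u) (f v) = S.adj u v) ∧ ∀ u ∈ S.dom, T.lab (f u) = S.lab u

instance : IsPreorder (LStruct D Y) LStruct.Emb where
  refl S := ⟨id, Set.injOn_id _, Set.mapsTo_id _, fun _ _ _ _ => rfl, fun _ _ => rfl⟩
  trans S T U := by
    rintro ⟨f, h1, h2, h3, h4⟩ ⟨g, k1, k2, k3, k4⟩
    exact ⟨g ∘ f, k1.comp h1 h2, k2.comp h2,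
      fun u hu v hv => (k3 _ (h2 hu) _ (h2 hv)).trans (h3 u hu v hv),
      fun u hu => (k4 _ (h2 hu)).trans (h4 u hu)⟩

/-- Sets of tree-depth at most `n`: every part of some partition without crossing edges has a root
whose removal leaves a set of tree-depth at most `n - 1`. -/
def TreeDepthLE {V : Type} (z : D) (adj : V → V → D) : ℕ → Set V → Prop
  | 0, U => U = ∅
  | n + 1, U => ∃ c : V → V, (∀ u ∈ U, c u ∈ U ∧ c (c u) = c u) ∧
      (∀ u ∈ U, ∀ v ∈ U, c u ≠ c v → adj u v = z) ∧
      ∀ v ∈ U, c v = v → TreeDepthLE z adj n {w | w ∈ U ∧ c w = v ∧ w ≠ v}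

/-- Turns the list order of Higman's lemma into an injective assignment of vertices; absence of
repetitions makes list positions and vertices interchangeable. -/
theorem exists_injOn_of_sublistForall₂ {α β γ δ : Type*} [Nonempty β] {R : γ → δ → Prop}
    {d : α → γ} {d' : β → δ} {l : List α} {l' : List β} (hl : l.Nodup) (hl' : l'.Nodup)
    (h : List.SublistForall₂ R (l.map d) (l'.map d')) :
    ∃ g : α → β, (∀ a ∈ l, g a ∈ l' ∧ R (d a) (d' (g a))) ∧ Set.InjOn g {a | a ∈ l} := by
  classical
  induction l' generalizing l with
  | nil =>
    cases l with
    | nil => exact ⟨fun _ => Classical.arbitrary β, by simp, by simp⟩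
    | cons a l => cases h
  | cons b l' ih =>
    cases l with
    | nil => exact ⟨fun _ => Classical.arbitrary β, by simp, by simp⟩
    | cons a l =>
      rw [List.nodup_cons] at hl'
      cases h with
      | cons hab h =>
        rw [List.nodup_cons] at hl
        obtain ⟨g, h1, h2⟩ := ih hl.2 hl'.2 h
        have hne : ∀ x ∈ l, x ≠ a := fun x hx hxa => hl.1 (hxa ▸ hx)
        have hg : ∀ x ∈ l, Function.update g a b x = g x := fun x hx =>
          Function.update_of_ne (hne x hx) _ _
        refine ⟨Function.update g a b, fun x hx => ?_, fun x hx y hy hxy => ?_⟩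
        · rcases List.mem_cons.1 hx with rfl | hx
          · simpa using hab
          · rw [hg x hx]
            exact ⟨List.mem_cons_of_mem _ (h1 x hx).1, (h1 x hx).2⟩
        · rcases List.mem_cons.1 hx with hxa | hx'
          · rcases List.mem_cons.1 hy with hya | hy'
            · rw [hxa, hya]
            · rw [hxa, hg y hy', Function.update_self] at hxy
              exact absurd (hxy ▸ (h1 y hy').1) hl'.1
          · rcases List.mem_cons.1 hy with hya | hy'
            · rw [hya, hg x hx', Function.update_self] at hxy
              exact absurd (hxy ▸ (h1 x hx').1) hl'.1
            · rw [hg x hx', hg y hy'] at hxy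
              exact h2 hx' hy' hxy
      | cons_right h =>
        obtain ⟨g, h1, h2⟩ := ih hl hl'.2 h
        exact ⟨g, fun x hx => ⟨List.mem_cons_of_mem _ (h1 x hx).1, (h1 x hx).2⟩, h2⟩

/-- The part of a structure below the root `v` of a partition `c`, with the edges to and from the
root recorded in the labels. -/
def LStruct.below (S : LStruct D Y) (c : S.V → S.V) (v : S.V) : LStruct D (Y × D × D) where
  V := S.V
  finV := S.finV
  nonempty := S.nonempty
  adj := S.adj
  dom := {w | w ∈ S.dom ∧ c w = v ∧ w ≠ v}
  lab w := (S.lab w, S.adj v w, S.adj w v)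

/-- Comparison of rooted parts. -/
def rootedEmb (x y : (Y × D) × LStruct D (Y × D × D)) : Prop := x.1 = y.1 ∧ x.2.Emb y.2

instance : IsPreorder ((Y × D) × LStruct D (Y × D × D)) rootedEmb where
  refl x := ⟨rfl, refl_of LStruct.Emb x.2⟩
  trans _ _ _ h1 h2 := ⟨h1.1.trans h2.1, trans_of LStruct.Emb h1.2 h2.2⟩

/-- Roots are sent to roots by `g`, and the rest of each part by its own embedding. Edges at a root
agree because `below` records them in the labels, and edges between different parts are `z` on both
sides. -/
theorem LStruct.emb_of_rooted {z : D} {S T : LStruct D Y} {c : S.V → S.V} {c' : T.V → T.V}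
    (hc : ∀ u ∈ S.dom, c u ∈ S.dom ∧ c (c u) = c u)
    (hz : ∀ u ∈ S.dom, ∀ v ∈ S.dom, c u ≠ c v → S.adj u v = z)
    (hz' : ∀ u ∈ T.dom, ∀ v ∈ T.dom, c' u ≠ c' v → T.adj u v = z)
    {g : S.V → T.V} (hg : ∀ v ∈ S.dom, c v = v → g v ∈ T.dom ∧ c' (g v) = g v)
    (hginj : ∀ v ∈ S.dom, ∀ w ∈ S.dom, c v = v → c w = w → g v = g w → v = w)
    (hR : ∀ v ∈ S.dom, c v = v → rootedEmb ((S.lab v, S.adj v v), S.below c v)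
      ((T.lab (g v), T.adj (g v) (g v)), T.below c' (g v))) : S.Emb T := by
  classical
  have hne := T.nonempty
  have hF : ∀ v, ∃ f : S.V → T.V, v ∈ S.dom → c v = v →
      Set.InjOn f (S.below c v).dom ∧ Set.MapsTo f (S.below c v).dom (T.below c' (g v)).dom ∧
      (∀ u ∈ (S.below c v).dom, ∀ w ∈ (S.below c v).dom, T.adj (f u) (f w) = S.adj u w) ∧
      ∀ u ∈ (S.below c v).dom, (T.below c' (g v)).lab (f u) = (S.below c v).lab u := by
    intro v
    by_cases hv : v ∈ S.dom ∧ c v = v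
    · obtain ⟨-, f, hf⟩ := hR v hv.1 hv.2
      exact ⟨f, fun _ _ => hf⟩
    · exact ⟨fun _ => Classical.arbitrary _, fun h1 h2 => absurd ⟨h1, h2⟩ hv⟩
  choose F hF using hF
  let f : S.V → T.V := fun u => if c u = u then g u else F (c u) u
  have hroot : ∀ u, c u = u → f u = g u := fun u hu => if_pos hu
  have hother : ∀ u ∈ S.dom, c u ≠ u → u ∈ (S.below c (c u)).dom ∧ f u = F (c u) u :=
    fun u hu hcu => ⟨⟨hu, rfl, hcu.symm⟩, if_neg hcu⟩
  have hFc := fun u (hu : u ∈ S.dom) => hF (c u) (hc u hu).1 (hc u hu).2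
  have hmem : ∀ u ∈ S.dom, f u ∈ T.dom ∧ c' (f u) = g (c u) ∧ (c u ≠ u → f u ≠ g (c u)) := by
    intro u hu
    by_cases hcu : c u = u
    · rw [hroot u hcu, hcu]
      exact ⟨(hg u hu hcu).1, (hg u hu hcu).2, fun h => absurd rfl h⟩
    · obtain ⟨h1, h2⟩ := hother u hu hcu
      have h3 := (hFc u hu).2.1 h1
      rw [h2]
      exact ⟨h3.1, h3.2.1, fun _ => h3.2.2⟩
  refine ⟨f, fun u hu v hv huv => ?_, fun u hu => (hmem u hu).1, fun u hu v hv => ?_,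
    fun u hu => ?_⟩
  · have hcc : c u = c v := hginj _ (hc u hu).1 _ (hc v hv).1 (hc u hu).2 (hc v hv).2
      (by rw [← (hmem u hu).2.1, ← (hmem v hv).2.1, huv])
    by_cases hcu : c u = u
    · by_cases hcv : c v = v
      · rw [← hcu, ← hcv, hcc]
      · refine absurd ?_ ((hmem v hv).2.2 hcv)
        rw [← huv, hroot u hcu, ← hcc, hcu]
    · by_cases hcv : c v = v
      · refine absurd ?_ ((hmem u hu).2.2 hcu)
        rw [huv, hroot v hcv, hcc, hcv]
      · obtain ⟨h1, h2⟩ := hother u hu hcu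
        obtain ⟨h3, h4⟩ := hother v hv hcv
        rw [h2, h4, hcc] at huv
        rw [hcc] at h1
        exact (hFc v hv).1 h1 h3 huv
  · by_cases hcc : c u = c v
    · by_cases hcu : c u = u
      · by_cases hcv : c v = v
        · have : u = v := by rw [← hcu, ← hcv, hcc]
          subst this
          rw [hroot u hcu]
          exact (congrArg Prod.snd (hR u hu hcu).1).symm
        · obtain ⟨h3, h4⟩ := hother v hv hcv
          have h5 := (hFc v hv).2.2.2 v h3
          rw [← hcc, hcu] at h4 h5
          rw [hroot u hcu, h4]
          exact congrArg (fun p : Y × D × D => p.2.1) h5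
      · obtain ⟨h1, h2⟩ := hother u hu hcu
        by_cases hcv : c v = v
        · have h5 := (hFc u hu).2.2.2 u h1
          rw [hcc, hcv] at h2 h5
          rw [hroot v hcv, h2]
          exact congrArg (fun p : Y × D × D => p.2.2) h5
        · obtain ⟨h3, h4⟩ := hother v hv hcv
          rw [hcc] at h1 h2
          rw [h2, h4]
          exact (hFc v hv).2.2.1 u h1 v h3
    · rw [hz u hu v hv hcc]
      refine hz' _ (hmem u hu).1 _ (hmem v hv).1 fun h => hcc ?_
      rw [(hmem u hu).2.1, (hmem v hv).2.1] at h
      exact hginj _ (hc u hu).1 _ (hc v hv).1 (hc u hu).2 (hc v hv).2 h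
  · by_cases hcu : c u = u
    · rw [hroot u hcu]
      exact (congrArg Prod.fst (hR u hu hcu).1).symm
    · obtain ⟨h1, h2⟩ := hother u hu hcu
      rw [h2]
      exact congrArg (fun p : Y × D × D => p.1) ((hFc u hu).2.2.2 u h1)

/-- Structures of bounded tree-depth are well-quasi-ordered by embeddings. -/
theorem wellQuasiOrdered_treeDepthLE [Finite D] (z : D) (n : ℕ) : ∀ (Y : Type) [Finite Y],
    {S : LStruct D Y | TreeDepthLE z S.adj n S.dom}.PartiallyWellOrderedOn LStruct.Emb := by
  induction n with
  | zero =>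
    intro Y _
    rw [Set.partiallyWellOrderedOn_iff_exists_lt]
    intro S hS
    have h0 : (S 0).dom = ∅ := hS 0
    have := (S 1).nonempty
    refine ⟨0, 1, one_pos, fun _ => Classical.arbitrary _, ?_⟩
    simp [h0, Set.MapsTo]
  | succ n ih =>
    intro Y _
    rw [Set.partiallyWellOrderedOn_iff_exists_lt]
    intro S hS
    choose c hc hz hrec using hS
    have hl : ∀ i, ∃ l : List (S i).V, l.Nodup ∧ ∀ v, v ∈ l ↔ v ∈ (S i).dom ∧ c i v = v := by
      intro i
      have := (S i).finV
      exact ⟨(Set.toFinite {v | v ∈ (S i).dom ∧ c i v = v}).toFinset.toList,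
        Finset.nodup_toList _, fun v => by simp⟩
    choose l hnd hmem using hl
    -- A part is coded by the label and loop of its root and by the structure below it. The labels
    -- grow from `Y` to `Y × D × D`, which is why the induction quantifies over `Y`.
    have hpwo : (Set.univ ×ˢ {S : LStruct D (Y × D × D) | TreeDepthLE z S.adj n S.dom} :
        Set ((Y × D) × LStruct D (Y × D × D))).PartiallyWellOrderedOn rootedEmb :=
      (Set.finite_univ.partiallyWellOrderedOn (r := Eq)).prod (ih (Y × D × D))
    -- Higman's lemma, applied to the lists of coded parts.
    obtain ⟨i, j, hij, h⟩ :=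
      (Set.PartiallyWellOrderedOn.partiallyWellOrderedOn_sublistForall₂ _ hpwo).exists_lt
        (f := fun i => (l i).map fun v => (((S i).lab v, (S i).adj v v), (S i).below (c i) v))
        (by
          intro i x hx
          obtain ⟨v, hv, rfl⟩ := List.mem_map.1 hx
          have := (hmem i v).1 hv
          exact ⟨trivial, hrec i v this.1 this.2⟩)
    have := (S j).nonempty
    obtain ⟨g, h1, h2⟩ := exists_injOn_of_sublistForall₂ (hnd i) (hnd j) h
    refine ⟨i, j, hij, LStruct.emb_of_rooted (hc i) (hz i) (hz j) (g := g) (fun v hv hcv => ?_)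
      (fun v hv w hw hcv hcw hvw => ?_) fun v hv hcv => ?_⟩
    · exact (hmem j _).1 (h1 v ((hmem i v).2 ⟨hv, hcv⟩)).1
    · exact h2 ((hmem i v).2 ⟨hv, hcv⟩) ((hmem i w).2 ⟨hw, hcw⟩) hvw
    · exact (h1 v ((hmem i v).2 ⟨hv, hcv⟩)).2

/-- If every part of a set can be reached from a vertex that only starts short paths, then the
tree-depth of the set is bounded. -/
theorem treeDepthLE_of_paths {V : Type} {z : D} {adj : V → V → D} {A : V → V → Prop}
    (hA : ∀ u v, A u v → A v u) (hadj : ∀ u v, u ≠ v → ¬ A u v → adj u v = z) (n : ℕ) :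
    ∀ U : Set V, (∀ x ∈ U, ∃ v ∈ U, Relation.ReflTransGen (fun a b => A a b ∧ a ∈ U ∧ b ∈ U) x v ∧
      ∀ p : List V, (v :: p).IsChain A → (v :: p).Nodup → (∀ y ∈ p, y ∈ U) →
        (v :: p).length ≤ n) → TreeDepthLE z adj n U := by
  classical
  induction n with
  | zero =>
    intro U hU
    refine Set.eq_empty_iff_forall_notMem.2 fun x hx => ?_
    obtain ⟨v, -, -, h⟩ := hU x hx
    have := h [] (by simp) (by simp) (by simp)
    simp at this
  | succ n ih =>
    intro U hU
    let E : V → V → Prop := fun a b => A a b ∧ a ∈ U ∧ b ∈ U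
    have hsymm : ∀ x y, Relation.ReflTransGen E x y → Relation.ReflTransGen E y x := fun x y h =>
      have : Std.Symm E := ⟨fun a b hab => ⟨hA _ _ hab.1, hab.2.2, hab.2.1⟩⟩
      symm_of (Relation.ReflTransGen E) h
    let cls : V → Set V := fun x => {y | Relation.ReflTransGen E x y}
    have hcls : ∀ x y, Relation.ReflTransGen E x y → cls x = cls y := fun x y h =>
      Set.ext fun w => ⟨fun hw => (hsymm x y h).trans hw, fun hw => h.trans hw⟩
    let good : V → Prop := fun v => v ∈ U ∧ ∀ p : List V, (v :: p).IsChain A → (v :: p).Nodup →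
      (∀ y ∈ p, y ∈ U) → (v :: p).length ≤ n + 1
    -- The parts are the connected components of `U`. The choice takes the component as a set, so
    -- that all its vertices get the same representative; the fallback `x` never occurs for
    -- components in `U`.
    let rep : Set V → V → V := fun S x => if h : ∃ v ∈ S, good v then h.choose else x
    have hrep : ∀ x ∈ U, ∀ y, rep (cls x) y ∈ cls x ∧ good (rep (cls x) y) := by
      intro x hx y
      obtain ⟨v, hv, hxv, hp⟩ := hU x hx
      have h : ∃ v ∈ cls x, good v := ⟨v, hxv, hv, hp⟩
      simp only [rep, dif_pos h]
      exact h.choose_spec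
    have hrep' : ∀ x ∈ U, ∀ y w, rep (cls x) y = rep (cls x) w := by
      intro x hx y w
      obtain ⟨v, hv, hxv, hp⟩ := hU x hx
      have h : ∃ v ∈ cls x, good v := ⟨v, hxv, hv, hp⟩
      simp only [rep, dif_pos h]
    let c : V → V := fun x => rep (cls x) x
    have hreach : ∀ x ∈ U, ∀ y, Relation.ReflTransGen E x y → c x = c y := by
      intro x hx y hxy
      simp only [c, ← hcls x y hxy]
      exact hrep' x hx x y
    have hroot : ∀ x ∈ U, Relation.ReflTransGen E x (c x) ∧ good (c x) := fun x hx => hrep x hx x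
    refine ⟨c, fun u hu => ⟨(hroot u hu).2.1, (hreach u hu _ (hroot u hu).1).symm⟩, ?_, ?_⟩
    · intro u hu v hv huv
      refine hadj u v (fun h => huv (h ▸ rfl)) fun h => huv ?_
      exact hreach u hu v (.single ⟨h, hu, hv⟩)
    · intro u hu hcu
      have hgood := (hroot u hu).2
      rw [hcu] at hgood
      apply ih
      -- `w` is the last vertex before a walk from `x` first meets `u`; it is a neighbour of `u` in
      -- the component of `x` after `u` is removed.
      have key : ∀ x, Relation.ReflTransGen E x u → x ∈ U → c x = u → x ≠ u →
          ∃ w, (w ∈ U ∧ c w = u ∧ w ≠ u) ∧ A u w ∧ Relation.ReflTransGen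
            (fun a b => A a b ∧ a ∈ {w | w ∈ U ∧ c w = u ∧ w ≠ u} ∧
              b ∈ {w | w ∈ U ∧ c w = u ∧ w ≠ u}) x w := by
        intro x hxu
        induction hxu using Relation.ReflTransGen.head_induction_on with
        | refl => intro _ _ h; exact absurd rfl h
        | @head x y hxy _ ihy =>
          intro hx hcx hxu
          by_cases hyu : y = u
          · exact ⟨x, ⟨hx, hcx, hxu⟩, hA _ _ (hyu ▸ hxy.1), .refl⟩
          · have hcy : c y = u := (hreach x hx y (.single hxy)).symm.trans hcx
            obtain ⟨w, hw, huw, hyw⟩ := ihy hxy.2.2 hcy hyu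
            exact ⟨w, hw, huw, .head ⟨hxy.1, ⟨hx, hcx, hxu⟩, ⟨hxy.2.2, hcy, hyu⟩⟩ hyw⟩
      intro x hx
      have hxu := (hroot x hx.1).1
      rw [hx.2.1] at hxu
      obtain ⟨w, hw, huw, hxw⟩ := key x hxu hx.1 hx.2.1 hx.2.2
      refine ⟨w, hw, hxw, fun p hp hnd hmem => ?_⟩
      -- A path from `w` avoiding `u` is prolonged by `u`, so the bound drops by one.
      have := hgood.2 (w :: p) (List.isChain_cons_cons.2 ⟨huw, hp⟩)
        (List.nodup_cons.2 ⟨fun h => ?_, hnd⟩) (fun y hy => ?_)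
      · simpa using this
      · rcases List.mem_cons.1 h with h | h
        · exact hw.2.2 h.symm
        · exact (hmem u h).2.2 rfl
      · rcases List.mem_cons.1 hy with rfl | hy
        · exact hw.1
        · exact (hmem y hy).1

end Structures

/-! ## The well-quasi-order on bounded graphs -/

section Bounded

variable {Λ : Type} {n k : ℕ} {G H : DGraph Λ}

/-- The numbers of edges between two nodes, capped at `k`. -/
noncomputable def DGraph.mult (G : DGraph Λ) (k : ℕ) (u v : G.V) (a : Λ) : Fin (k + 1) :=
  ⟨min k (Nat.card {e : G.E // G.src e = u ∧ G.tgt e = v ∧ G.lab e = a}), by omega⟩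

theorem DGraph.MultBounded.card_eq (hG : G.MultBounded k) (hH : H.MultBounded k) {u v : G.V}
    {u' v' : H.V} (h : H.mult k u' v' = G.mult k u v) (a : Λ) :
    Nat.card {e : H.E // H.src e = u' ∧ H.tgt e = v' ∧ H.lab e = a} =
      Nat.card {e : G.E // G.src e = u ∧ G.tgt e = v ∧ G.lab e = a} := by
  have := congrArg Fin.val (congrFun h a)
  simpa [DGraph.mult, hG u v a, hH u' v' a] using this

/-- Below the cap, equal values of `mult` mean equal numbers of parallel edges. Bijections chosen
for each pair of nodes and label combine to an edge map that is injective and full. -/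
theorem indSub_of_mult (hG : G.MultBounded k) (hH : H.MultBounded k) {f : G.V → H.V}
    (hf : Function.Injective f) (h : ∀ u v, H.mult k (f u) (f v) = G.mult k u v) : IndSub G H := by
  have := G.finE
  have := H.finE
  have hψ : ∀ u v a, Nonempty ({e : G.E // G.src e = u ∧ G.tgt e = v ∧ G.lab e = a} ≃
      {e : H.E // H.src e = f u ∧ H.tgt e = f v ∧ H.lab e = a}) := fun u v a =>
    Finite.card_eq.1 (hG.card_eq hH (h u v) a).symm
  let ψ := fun u v a => (hψ u v a).some
  let g : G.E → H.E := fun e => (ψ (G.src e) (G.tgt e) (G.lab e) ⟨e, rfl, rfl, rfl⟩).1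
  have hg : ∀ u v a e he, g e = (ψ u v a ⟨e, he⟩).1 := by
    rintro _ _ _ e ⟨rfl, rfl, rfl⟩
    rfl
  have hspec := fun e => (ψ (G.src e) (G.tgt e) (G.lab e) ⟨e, rfl, rfl, rfl⟩).2
  refine indSub_iff.2 ⟨⟨fun x => some (f x), fun e => some (g e), ?_, ?_, ?_⟩,
    ⟨⟨⟨fun _ => by simp, fun _ => by simp⟩, fun x y h => hf (Option.some.inj h), fun d e hde => ?_⟩,
      fun e u v hu hv => ?_⟩⟩
  · rintro e _ ⟨⟩
    exact (hspec e).2.2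
  · rintro e _ ⟨⟩
    exact congrArg some (hspec e).1.symm
  · rintro e _ ⟨⟩
    exact congrArg some (hspec e).2.1.symm
  · have hge : g d = g e := Option.some.inj hde
    have h1 : G.src d = G.src e := hf ((hspec d).1.symm.trans ((congrArg H.src hge).trans (hspec e).1))
    have h2 : G.tgt d = G.tgt e :=
      hf ((hspec d).2.1.symm.trans ((congrArg H.tgt hge).trans (hspec e).2.1))
    have h3 : G.lab d = G.lab e :=
      (hspec d).2.2.symm.trans ((congrArg H.lab hge).trans (hspec e).2.2)
    rw [hg _ _ _ d ⟨h1, h2, h3⟩, hg _ _ _ e ⟨rfl, rfl, rfl⟩] at hge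
    exact congrArg Subtype.val ((ψ _ _ _).injective (Subtype.ext hge))
  · obtain ⟨⟨d, hd⟩, hde⟩ := (ψ u v (H.lab e)).surjective
      ⟨e, (Option.some.inj hu).symm, (Option.some.inj hv).symm, rfl⟩
    exact ⟨d, congrArg some ((hg _ _ _ d hd).trans (congrArg Subtype.val hde))⟩

/-- Adjacency in the underlying undirected graph. -/
def DGraph.Adj (G : DGraph Λ) (u v : G.V) : Prop :=
  ∃ e, G.src e = u ∧ G.tgt e = v ∨ G.src e = v ∧ G.tgt e = u

theorem DGraph.length_le_of_chain (hG : ∀ l v e, G.IsPath l v e → l ≤ n) (p : List G.V)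
    (hp : p.IsChain G.Adj) (hnd : p.Nodup) : p.length ≤ n + 1 := by
  rcases hl : p.length with _ | l
  · omega
  · let v : Fin (l + 1) → G.V := fun i => p[i.1]'(by omega)
    have hv : Function.Injective v := fun i j hij =>
      Fin.ext ((hnd.getElem_inj_iff).1 hij)
    have hadj : ∀ i : Fin l, G.Adj (v i.castSucc) (v i.succ) := fun i =>
      hp.getElem i.1 (by omega)
    choose e he using hadj
    have := hG l v e ⟨hv, fun i j hij => ?_, fun i => ?_⟩
    · omega
    · have h1 := he i
      have h2 := he j
      rw [← hij] at h2
      -- Equal edges have equal end pairs. The swapped case would need both `i = j + 1` and `j = i +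
      -- 1`.
      have key : (v i.castSucc = v j.castSucc) ∨
          (v i.castSucc = v j.succ ∧ v i.succ = v j.castSucc) := by
        rcases h1 with ⟨a, b⟩ | ⟨a, b⟩ <;> rcases h2 with ⟨a', b'⟩ | ⟨a', b'⟩ <;>
          rw [a] at a' <;> rw [b] at b' <;> simp_all
      rcases key with h | ⟨h, h'⟩
      · exact Fin.castSucc_injective _ (hv h)
      · have h3 := congrArg Fin.val (hv h)
        have h4 := congrArg Fin.val (hv h')
        simp only [Fin.val_castSucc, Fin.val_succ] at h3 h4
        omega
    · rcases he i with ⟨a, b⟩ | ⟨a, b⟩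
      · exact ⟨Or.inl a, Or.inr b⟩
      · exact ⟨Or.inr b, Or.inl a⟩

/-- Tree-depth counts vertices, and a path with `n` edges has `n + 1` of them. -/
theorem treeDepthLE_of_mem_boundedGraphs (hG : G ∈ boundedGraphs Λ n k) :
    TreeDepthLE (fun _ => 0) (G.mult k) (n + 1) Set.univ := by
  refine treeDepthLE_of_paths (A := G.Adj) ?_ ?_ _ _ ?_
  · rintro u v ⟨e, he⟩
    exact ⟨e, he.symm⟩
  · intro u v _ h
    funext a
    have : IsEmpty {e : G.E // G.src e = u ∧ G.tgt e = v ∧ G.lab e = a} :=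
      ⟨fun e => h ⟨e.1, Or.inl ⟨e.2.1, e.2.2.1⟩⟩⟩
    simp [DGraph.mult]
  · exact fun x _ => ⟨x, trivial, .refl, fun p hp hnd _ => G.length_le_of_chain hG.1 _ hp hnd⟩

/-- The induced subgraph order is a well-quasi-order on the bounded graphs. -/
theorem exists_lt_indSub [Finite Λ] (n k : ℕ) (f : ℕ → DGraph Λ)
    (hf : ∀ i, f i ∈ boundedGraphs Λ n k) : ∃ i j, i < j ∧ IndSub (f i) (f j) := by
  -- An `LStruct` has a nonempty carrier, so the empty graph, which lies below everything, is
  -- treated apart.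
  by_cases hne : ∃ i, IsEmpty (f i).V
  · obtain ⟨i, hi⟩ := hne
    refine ⟨i, i + 1, i.lt_succ_self, indSub_of_mult (hf i).2 (hf (i + 1)).2 (f := isEmptyElim)
      (fun x => isEmptyElim x) fun x => isEmptyElim x⟩
  · push Not at hne
    let S : ℕ → LStruct (Λ → Fin (k + 1)) Unit := fun i =>
      { V := (f i).V
        finV := (f i).finV
        nonempty := hne i
        adj := (f i).mult k
        dom := Set.univ
        lab := fun _ => () }
    obtain ⟨i, j, hij, g, h1, -, h3, -⟩ :=
      (wellQuasiOrdered_treeDepthLE (fun _ : Λ => (0 : Fin (k + 1))) (n + 1) Unit).exists_lt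
        (f := S) fun i => treeDepthLE_of_mem_boundedGraphs (hf i)
    exact ⟨i, j, hij, indSub_of_mult (hf i).2 (hf j).2 (Set.injOn_univ.1 h1)
      fun u v => h3 u trivial v trivial⟩

theorem isRestrictedWSTS_gts [Finite Λ] (n k : ℕ) (rules : Set (Rule Λ)) :
    IsRestrictedWSTS (gts rules) (boundedGraphs Λ n k) where
  downClosed s t h ht := by
    obtain ⟨ι, hι⟩ := indSub_iff.1 h
    exact hι.toEmb.mem_boundedGraphs ht
  refl := IndSub.refl
  trans _ _ _ := IndSub.trans
  wqo := exists_lt_indSub n k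
  compat s₁ t₁ s₂ hle := by
    rintro ⟨ρ, hρ, hstep⟩
    obtain ⟨t₂, ht, h⟩ := hstep.exists_of_indSub hle
    exact ⟨t₂, .single ⟨ρ, hρ, ht⟩, h⟩

end Bounded

/-! ## Primitive recursive predicates -/

attribute [fun_prop] Primrec
attribute [fun_prop] Primrec.fst Primrec.snd Primrec.const Primrec.id Primrec.comp Primrec.pair

/-! ### Words of fixed length. -/

section Words

variable {β : Type*}

/-- The words of length `n` over the alphabet `l`. -/
def words (l : List β) : ℕ → List (List β)
  | 0 => [[]]
  | n + 1 => (words l n).flatMap fun w => l.map fun b => b :: w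

theorem mem_words {l : List β} {n : ℕ} {w : List β} :
    w ∈ words l n ↔ w.length = n ∧ ∀ b ∈ w, b ∈ l := by
  induction n generalizing w with
  | zero => cases w <;> simp [words]
  | succ n ih =>
    cases w with
    | nil => simp [words]
    | cons b w =>
      simp only [words, List.mem_flatMap, List.mem_map, List.cons.injEq, ih, List.length_cons,
        Nat.add_right_cancel_iff, List.forall_mem_cons]
      constructor
      · rintro ⟨_, ⟨h1, h2⟩, _, h3, rfl, rfl⟩
        exact ⟨h1, h3, h2⟩
      · rintro ⟨h1, h3, h2⟩
        exact ⟨w, ⟨h1, h2⟩, b, h3, rfl, rfl⟩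

/-- Makes a quantifier over maps out of `Fin n` a search through a finite list. -/
theorem exists_words_iff {l : List β} {n : ℕ} {P : List β → Prop} :
    (∃ w ∈ words l n, P w) ↔ ∃ f : Fin n → β, (∀ i, f i ∈ l) ∧ P (List.ofFn f) := by
  constructor
  · rintro ⟨w, hw, hP⟩
    obtain ⟨rfl, hl⟩ := mem_words.1 hw
    exact ⟨w.get, fun i => hl _ (List.get_mem w i), by rwa [List.ofFn_get]⟩
  · rintro ⟨f, hf, hP⟩
    refine ⟨_, mem_words.2 ⟨List.length_ofFn, fun b hb => ?_⟩, hP⟩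
    obtain ⟨i, rfl⟩ := List.mem_ofFn.1 hb
    exact hf i

end Words

/-! ### Closure properties of primitive recursive functions and predicates. -/

section Closure

variable {α β γ : Type*} [Primcodable α] [Primcodable β] [Primcodable γ]

@[fun_prop]
theorem primrec_some {f : α → β} (hf : Primrec f) : Primrec fun a => some (f a) :=
  Primrec.option_some.comp hf

@[fun_prop]
theorem primrec_succ {f : α → ℕ} (hf : Primrec f) : Primrec fun a => f a + 1 :=
  Primrec.succ.comp hf

@[fun_prop]
theorem primrec_add {f g : α → ℕ} (hf : Primrec f) (hg : Primrec g) :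
    Primrec fun a => f a + g a :=
  Primrec.nat_add.comp hf hg

@[fun_prop]
theorem primrec_mul {f g : α → ℕ} (hf : Primrec f) (hg : Primrec g) :
    Primrec fun a => f a * g a :=
  Primrec.nat_mul.comp hf hg

@[fun_prop]
theorem primrec_length {f : α → List β} (hf : Primrec f) : Primrec fun a => (f a).length :=
  Primrec.list_length.comp hf

@[fun_prop]
theorem primrec_range {f : α → ℕ} (hf : Primrec f) : Primrec fun a => List.range (f a) :=
  Primrec.list_range.comp hf

@[fun_prop]
theorem primrec_cons {f : α → β} {g : α → List β} (hf : Primrec f) (hg : Primrec g) :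
    Primrec fun a => f a :: g a :=
  Primrec.list_cons.comp hf hg

@[fun_prop]
theorem primrec_getElem? {f : α → List β} {g : α → ℕ} (hf : Primrec f) (hg : Primrec g) :
    Primrec fun a => (f a)[g a]? :=
  Primrec.list_getElem?.comp hf hg

@[fun_prop]
theorem primrec_getD {f : α → List β} {g : α → ℕ} (b : β) (hf : Primrec f) (hg : Primrec g) :
    Primrec fun a => (f a).getD (g a) b :=
  (Primrec.list_getD b).comp hf hg

@[fun_prop]
theorem primrec_listMap {f : α → List β} {g : α → β → γ} (hf : Primrec f)
    (hg : Primrec fun x : α × β => g x.1 x.2) : Primrec fun a => (f a).map (g a) :=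
  Primrec.list_map hf hg

@[fun_prop]
theorem primrec_flatMap {f : α → List β} {g : α → β → List γ} (hf : Primrec f)
    (hg : Primrec fun x : α × β => g x.1 x.2) : Primrec fun a => (f a).flatMap (g a) :=
  Primrec.list_flatMap hf hg

@[fun_prop]
theorem primrec_optionMap {f : α → Option β} {g : α → β → γ} (hf : Primrec f)
    (hg : Primrec fun x : α × β => g x.1 x.2) : Primrec fun a => (f a).map (g a) :=
  Primrec.option_map hf hg

@[fun_prop]
theorem primrec_optionBind {f : α → Option β} {g : α → β → Option γ} (hf : Primrec f)
    (hg : Primrec fun x : α × β => g x.1 x.2) : Primrec fun a => (f a).bind (g a) :=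
  Primrec.option_bind hf hg

/-- A condition that does not depend on the input has a constant truth value, however it is
obtained. It applies to conditions on a fixed rule. -/
theorem primrecPred_const (p : Prop) : PrimrecPred fun _ : α => p := by
  classical
  exact ⟨fun _ => inferInstance, Primrec.const (decide p)⟩

theorem primrecPred_eq {f g : α → β} (hf : Primrec f) (hg : Primrec g) :
    PrimrecPred fun a => f a = g a :=
  Primrec.eq.comp hf hg

theorem primrecPred_imp {p q : α → Prop} (hp : PrimrecPred p) (hq : PrimrecPred q) :
    PrimrecPred fun a => p a → q a :=
  (hp.not.or hq).of_eq fun _ => imp_iff_not_or.symm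

theorem primrecPred_forall_mem {f : α → List β} {P : α → β → Prop} (hf : Primrec f)
    (hP : PrimrecPred fun x : α × β => P x.1 x.2) : PrimrecPred fun a => ∀ b ∈ f a, P a b := by
  have h : PrimrecRel fun (b : β) (a : α) => P a b :=
    hP.comp (f := fun x : β × α => (x.2, x.1)) (by fun_prop)
  exact h.forall_mem_list.comp hf Primrec.id

theorem primrecPred_exists_mem {f : α → List β} {P : α → β → Prop} (hf : Primrec f)
    (hP : PrimrecPred fun x : α × β => P x.1 x.2) : PrimrecPred fun a => ∃ b ∈ f a, P a b := by
  have h : PrimrecRel fun (b : β) (a : α) => P a b :=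
    hP.comp (f := fun x : β × α => (x.2, x.1)) (by fun_prop)
  exact h.exists_mem_list.comp hf Primrec.id

theorem primrecPred_forall_lt {f : α → ℕ} {P : α → ℕ → Prop} (hf : Primrec f)
    (hP : PrimrecPred fun x : α × ℕ => P x.1 x.2) : PrimrecPred fun a => ∀ i < f a, P a i :=
  (primrecPred_forall_mem (f := fun a => List.range (f a)) (by fun_prop) hP).of_eq (by simp)

theorem primrecPred_exists_lt {f : α → ℕ} {P : α → ℕ → Prop} (hf : Primrec f)
    (hP : PrimrecPred fun x : α × ℕ => P x.1 x.2) : PrimrecPred fun a => ∃ i < f a, P a i :=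
  (primrecPred_exists_mem (f := fun a => List.range (f a)) (by fun_prop) hP).of_eq (by simp)

/-- The index type needs no coding: the quantifier unfolds to a fixed finite disjunction. It ranges
over items of a fixed rule, or over the rules themselves. -/
theorem primrecPred_exists_finite {ι : Type*} [Finite ι] {P : ι → α → Prop}
    (hP : ∀ i, PrimrecPred (P i)) : PrimrecPred fun a => ∃ i, P i a := by
  have key : ∀ s : Set ι, PrimrecPred fun a => ∃ i ∈ s, P i a := by
    intro s
    induction s, Set.toFinite s using Set.Finite.induction_on with
    | empty => exact (primrecPred_const False).of_eq (by simp)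
    | @insert i _ _ _ ih => exact ((hP i).or ih).of_eq (by simp)
  exact (key Set.univ).of_eq (by simp)

theorem primrecPred_forall_finite {ι : Type*} [Finite ι] {P : ι → α → Prop}
    (hP : ∀ i, PrimrecPred (P i)) : PrimrecPred fun a => ∀ i, P i a :=
  (primrecPred_exists_finite fun i => (hP i).not).not.of_eq fun a => by simp

theorem primrec_filter {f : α → List β} {P : α → β → Prop} [∀ a, DecidablePred (P a)]
    (hf : Primrec f) (hP : PrimrecPred fun x : α × β => P x.1 x.2) :
    Primrec fun a => (f a).filter fun b => P a b := by
  have h : PrimrecPred fun x : α × β => P x.1 x.2 := hP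
  have h2 : Primrec fun a => (f a).flatMap fun b => bif decide (P a b) then [b] else [] := by
    refine primrec_flatMap hf (Primrec.cond h.decide ?_ (Primrec.const []))
    fun_prop
  refine h2.of_eq fun a => ?_
  induction f a with
  | nil => rfl
  | cons b l ih => by_cases hb : P a b <;> simp [hb, ih]

@[fun_prop]
theorem primrec_words {f : α → List β} {g : α → ℕ} (hf : Primrec f) (hg : Primrec g) :
    Primrec fun a => words (f a) (g a) := by
  have : Primrec fun a => Nat.rec (motive := fun _ => List (List β)) [[]]
      (fun _ s => s.flatMap fun w => (f a).map fun b => b :: w) (g a) := by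
    refine Primrec.nat_rec' (h := fun a (x : ℕ × List (List β)) =>
      x.2.flatMap fun w => (f a).map fun b => b :: w) hg (by fun_prop) ?_
    change Primrec _
    fun_prop
  refine this.of_eq fun a => ?_
  induction g a with
  | zero => rfl
  | succ n ih => simp only [words, ← ih]

end Closure

/-! ## Decidability of boundedness and of the induced subgraph order -/

theorem forall_lt_iff_fin {n : ℕ} {P : ℕ → Prop} : (∀ i < n, P i) ↔ ∀ i : Fin n, P i :=
  ⟨fun h i => h i i.2, fun h i hi => h ⟨i, hi⟩⟩

theorem exists_lt_iff_fin {n : ℕ} {P : ℕ → Prop} : (∃ i < n, P i) ↔ ∃ i : Fin n, P i :=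
  ⟨fun ⟨i, hi, h⟩ => ⟨⟨i, hi⟩, h⟩, fun ⟨i, h⟩ => ⟨i, i.2, h⟩⟩

theorem getD_ofFn {β : Type*} {n : ℕ} (f : Fin n → β) (i : Fin n) (b : β) :
    (List.ofFn f).getD i b = f i := by
  simp [List.getD]

theorem exists_words_range_iff {N n : ℕ} {P : List ℕ → Prop} :
    (∃ w ∈ words (List.range N) n, P w) ↔ ∃ f : Fin n → Fin N, P (List.ofFn fun i => (f i : ℕ)) := by
  rw [exists_words_iff]
  constructor
  · rintro ⟨f, hf, hP⟩
    exact ⟨fun i => ⟨f i, List.mem_range.1 (hf i)⟩, hP⟩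
  · rintro ⟨f, hP⟩
    exact ⟨fun i => f i, fun i => List.mem_range.2 (f i).2, hP⟩

section Codes

variable {Λ : Type}

theorem GraphCode.getElem?_edges (c : GraphCode Λ) (i : Fin c.1.2.length) :
    c.1.2[(i : ℕ)]? = some (c.toGraph.lab i, Fin.val (n := c.1.1) (c.toGraph.src i),
      Fin.val (n := c.1.1) (c.toGraph.tgt i)) :=
  List.getElem?_eq_getElem i.2

/-- An initial segment of a too long path has exactly `n + 1` edges, and multiplicity above `k`
means `k + 1` distinct parallel edges. Both obstructions are tuples of fixed length. -/
theorem mem_boundedGraphs_iff {G : DGraph Λ} {n k : ℕ} : G ∈ boundedGraphs Λ n k ↔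
    (¬ ∃ (v : Fin (n + 2) → G.V) (e : Fin (n + 1) → G.E), G.IsPath (n + 1) v e) ∧
    ¬ ∃ w : Fin (k + 1) → G.E, Function.Injective w ∧
      ∀ i j, (G.lab (w i), G.src (w i), G.tgt (w i)) = (G.lab (w j), G.src (w j), G.tgt (w j)) := by
  have := G.finE
  refine and_congr ⟨?_, ?_⟩ ⟨?_, ?_⟩
  · rintro h ⟨v, e, hp⟩
    exact absurd (h _ v e hp) (by omega)
  · intro h l v e hp
    by_contra hl
    have h1 : n + 1 ≤ l := by omega
    have h2 : n + 2 ≤ l + 1 := by omega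
    refine h ⟨fun i => v (i.castLE h2), fun i => e (i.castLE h1),
      hp.1.comp (Fin.castLE_injective h2), hp.2.1.comp (Fin.castLE_injective h1), fun i => ?_⟩
    exact hp.2.2 (i.castLE h1)
  · rintro h ⟨w, hw, heq⟩
    have h0 := h (G.src (w 0)) (G.tgt (w 0)) (G.lab (w 0))
    have := Nat.card_le_card_of_injective
      (fun i => (⟨w i, by have := heq i 0; simp only [Prod.mk.injEq] at this; tauto⟩ :
        {e : G.E // G.src e = G.src (w 0) ∧ G.tgt e = G.tgt (w 0) ∧ G.lab e = G.lab (w 0)}))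
      fun i j hij => hw (Subtype.ext_iff.1 hij)
    rw [Nat.card_fin] at this
    omega
  · intro h u v a
    by_contra hc
    let S := {e : G.E // G.src e = u ∧ G.tgt e = v ∧ G.lab e = a}
    let f : Fin (k + 1) → S := fun i => (Finite.equivFin S).symm (i.castLE (by push Not at hc; exact hc))
    refine h ⟨fun i => (f i).1, fun i j hij => ?_, fun i j => ?_⟩
    · exact Fin.castLE_injective _ ((Finite.equivFin S).symm.injective (Subtype.ext hij))
    · rw [(f i).2.1, (f i).2.2.1, (f i).2.2.2, (f j).2.1, (f j).2.2.1, (f j).2.2.2]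

theorem PHom.Total.exists_maps {G H : DGraph Λ} {φ : PHom G H} (hφ : φ.Total) :
    ∃ (f : G.V → H.V) (g : G.E → H.E), (φ.onV = fun x => some (f x)) ∧
      (φ.onE = fun e => some (g e)) ∧
      ∀ e, H.lab (g e) = G.lab e ∧ H.src (g e) = f (G.src e) ∧ H.tgt (g e) = f (G.tgt e) := by
  obtain ⟨f, g, hf, hg⟩ := hφ.exists_eq
  refine ⟨f, g, funext hf, funext hg, fun e => ⟨φ.lab_eq e _ (hg e), ?_, ?_⟩⟩
  · exact Option.some.inj ((φ.src_eq e _ (hg e)).symm.trans (hf _))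
  · exact Option.some.inj ((φ.tgt_eq e _ (hg e)).symm.trans (hf _))

/-- The total morphism given by a pair of maps. -/
def PHom.ofMaps {G H : DGraph Λ} (f : G.V → H.V) (g : G.E → H.E)
    (h : ∀ e, H.lab (g e) = G.lab e ∧ H.src (g e) = f (G.src e) ∧ H.tgt (g e) = f (G.tgt e)) :
    PHom G H where
  onV x := some (f x)
  onE e := some (g e)
  lab_eq := by
    rintro e _ ⟨⟩
    exact (h e).1
  src_eq := by
    rintro e _ ⟨⟩
    exact congrArg some (h e).2.1.symm
  tgt_eq := by
    rintro e _ ⟨⟩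
    exact congrArg some (h e).2.2.symm

theorem indSub_iff_exists_maps {G H : DGraph Λ} : IndSub G H ↔
    ∃ (f : G.V → H.V) (g : G.E → H.E), Function.Injective f ∧ Function.Injective g ∧
      (∀ e, H.lab (g e) = G.lab e ∧ H.src (g e) = f (G.src e) ∧ H.tgt (g e) = f (G.tgt e)) ∧
      ∀ e, (∃ x, f x = H.src e) → (∃ y, f y = H.tgt e) → ∃ d, g d = e := by
  rw [indSub_iff]
  constructor
  · rintro ⟨ι, hι⟩
    obtain ⟨f, g, hf, hg, h⟩ := hι.total.exists_maps
    refine ⟨f, g, fun x y h => hι.injV (by simp [hf, h]), fun x y h => hι.injE (by simp [hg, h]),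
      h, ?_⟩
    rintro e ⟨x, hx⟩ ⟨y, hy⟩
    obtain ⟨d, hd⟩ := hι.full e x y (by simp [hf, hx]) (by simp [hf, hy])
    exact ⟨d, by simpa [hg] using hd⟩
  · rintro ⟨f, g, hf, hg, h, hfull⟩
    refine ⟨.ofMaps f g h, ⟨⟨⟨fun _ => Option.some_ne_none _, fun _ => Option.some_ne_none _⟩,
      fun x y h => hf (Option.some.inj h), fun x y h => hg (Option.some.inj h)⟩,
      fun e x y hx hy => ?_⟩⟩
    obtain ⟨d, hd⟩ := hfull e ⟨x, Option.some.inj hx⟩ ⟨y, Option.some.inj hy⟩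
    exact ⟨d, congrArg some hd⟩

variable {α : Type*} [Primcodable α] [Primcodable Λ]

@[fun_prop]
theorem primrec_codeVal {f : α → GraphCode Λ} (hf : Primrec f) : Primrec fun a => (f a).1 :=
  Primrec.subtype_val.comp hf

/-- The word `w` has no repetitions. -/
theorem primrecPred_getD_inj {f : α → List ℕ} {N : α → ℕ} (hf : Primrec f) (hN : Primrec N) :
    PrimrecPred fun a => ∀ i < N a, ∀ j < N a, (f a).getD i 0 = (f a).getD j 0 → i = j := by
  refine primrecPred_forall_lt hN (primrecPred_forall_lt (by fun_prop) (primrecPred_imp ?_ ?_)) <;>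
    exact primrecPred_eq (by fun_prop) (by fun_prop)

theorem injective_iff_getD {n N : ℕ} {f : Fin n → Fin N} : Function.Injective f ↔
    ∀ i < n, ∀ j < n, (List.ofFn fun i => (f i : ℕ)).getD i 0 =
      (List.ofFn fun i => (f i : ℕ)).getD j 0 → i = j := by
  simp only [forall_lt_iff_fin, getD_ofFn, ← Fin.ext_iff]
  rfl

theorem primrecPred_mem_boundedGraphs (n k : ℕ) :
    PrimrecPred fun c : GraphCode Λ => c.toGraph ∈ boundedGraphs Λ n k := by
  -- The words have the required lengths and entries in range, so the default `0` and the value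
  -- `none` never arise.
  have key : PrimrecPred fun c : GraphCode Λ =>
      (¬ ∃ v ∈ words (List.range c.1.1) (n + 2), ∃ e ∈ words (List.range c.1.2.length) (n + 1),
        (∀ i < n + 2, ∀ j < n + 2, v.getD i 0 = v.getD j 0 → i = j) ∧
        (∀ i < n + 1, ∀ j < n + 1, e.getD i 0 = e.getD j 0 → i = j) ∧
        ∀ i < n + 1, (c.1.2[e.getD i 0]?.map (fun t => t.2.1) = some (v.getD i 0) ∨
            c.1.2[e.getD i 0]?.map (fun t => t.2.2) = some (v.getD i 0)) ∧
          (c.1.2[e.getD i 0]?.map (fun t => t.2.1) = some (v.getD (i + 1) 0) ∨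
            c.1.2[e.getD i 0]?.map (fun t => t.2.2) = some (v.getD (i + 1) 0))) ∧
      ¬ ∃ w ∈ words (List.range c.1.2.length) (k + 1),
        (∀ i < k + 1, ∀ j < k + 1, w.getD i 0 = w.getD j 0 → i = j) ∧
        ∀ i < k + 1, ∀ j < k + 1, c.1.2[w.getD i 0]? = c.1.2[w.getD j 0]? := by
    refine PrimrecPred.and (PrimrecPred.not ?_) (PrimrecPred.not ?_)
    · refine primrecPred_exists_mem (by fun_prop) (primrecPred_exists_mem (by fun_prop)
        ((primrecPred_getD_inj (by fun_prop) (by fun_prop)).and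
        ((primrecPred_getD_inj (by fun_prop) (by fun_prop)).and
        (primrecPred_forall_lt (by fun_prop) (PrimrecPred.and (PrimrecPred.or ?_ ?_)
          (PrimrecPred.or ?_ ?_)))))) <;> exact primrecPred_eq (by fun_prop) (by fun_prop)
    · refine primrecPred_exists_mem (by fun_prop)
        ((primrecPred_getD_inj (by fun_prop) (by fun_prop)).and
        (primrecPred_forall_lt (by fun_prop) (primrecPred_forall_lt (by fun_prop) ?_)))
      exact primrecPred_eq (by fun_prop) (by fun_prop)
  refine key.of_eq fun c => ?_
  rw [mem_boundedGraphs_iff]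
  refine and_congr (not_congr ?_) (not_congr ?_)
  · rw [exists_words_range_iff]
    refine exists_congr fun v => ?_
    rw [exists_words_range_iff]
    refine exists_congr fun e => ?_
    rw [← injective_iff_getD, ← injective_iff_getD]
    refine and_congr Iff.rfl (and_congr Iff.rfl ?_)
    rw [forall_lt_iff_fin]
    refine forall_congr' fun i => ?_
    have h1 := getD_ofFn (fun i => (v i : ℕ)) i.castSucc 0
    have h2 := getD_ofFn (fun i => (v i : ℕ)) i.succ 0
    rw [Fin.val_castSucc] at h1
    rw [Fin.val_succ] at h2
    rw [getD_ofFn, h1, h2, c.getElem?_edges]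
    simp only [Option.map_some, Option.some.injEq]
    exact and_congr (or_congr Fin.ext_iff.symm Fin.ext_iff.symm)
      (or_congr Fin.ext_iff.symm Fin.ext_iff.symm)
  · rw [exists_words_range_iff]
    refine exists_congr fun w => ?_
    rw [← injective_iff_getD]
    refine and_congr Iff.rfl ?_
    simp only [forall_lt_iff_fin, getD_ofFn, c.getElem?_edges, Option.some.injEq, Prod.mk.injEq]
    exact forall₂_congr fun i j =>
      and_congr Iff.rfl (and_congr Fin.ext_iff.symm Fin.ext_iff.symm)

theorem primrecPred_indSub :
    PrimrecPred fun p : GraphCode Λ × GraphCode Λ => IndSub p.1.toGraph p.2.toGraph := by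
  have key : PrimrecPred fun p : GraphCode Λ × GraphCode Λ =>
      ∃ f ∈ words (List.range p.2.1.1) p.1.1.1,
      ∃ g ∈ words (List.range p.2.1.2.length) p.1.1.2.length,
        (∀ i < p.1.1.1, ∀ j < p.1.1.1, f.getD i 0 = f.getD j 0 → i = j) ∧
        (∀ i < p.1.1.2.length, ∀ j < p.1.1.2.length, g.getD i 0 = g.getD j 0 → i = j) ∧
        (∀ i < p.1.1.2.length, p.2.1.2[g.getD i 0]? =
          p.1.1.2[i]?.map fun t => (t.1, f.getD t.2.1 0, f.getD t.2.2 0)) ∧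
        ∀ j < p.2.1.2.length,
          (∃ x < p.1.1.1, some (f.getD x 0) = p.2.1.2[j]?.map fun t => t.2.1) →
          (∃ x < p.1.1.1, some (f.getD x 0) = p.2.1.2[j]?.map fun t => t.2.2) →
          ∃ i < p.1.1.2.length, g.getD i 0 = j := by
    refine primrecPred_exists_mem (by fun_prop) (primrecPred_exists_mem (by fun_prop)
      ((primrecPred_getD_inj (by fun_prop) (by fun_prop)).and
      ((primrecPred_getD_inj (by fun_prop) (by fun_prop)).and (PrimrecPred.and ?_ ?_))))
    · exact primrecPred_forall_lt (by fun_prop) (primrecPred_eq (by fun_prop) (by fun_prop))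
    · refine primrecPred_forall_lt (by fun_prop) (primrecPred_imp ?_ (primrecPred_imp ?_ ?_)) <;>
        exact primrecPred_exists_lt (by fun_prop) (primrecPred_eq (by fun_prop) (by fun_prop))
  refine key.of_eq fun p => ?_
  rw [indSub_iff_exists_maps, exists_words_range_iff]
  refine exists_congr fun f => ?_
  rw [exists_words_range_iff]
  refine exists_congr fun g => ?_
  rw [← injective_iff_getD, ← injective_iff_getD]
  refine and_congr Iff.rfl (and_congr Iff.rfl ?_)
  simp only [forall_lt_iff_fin, exists_lt_iff_fin, getD_ofFn, GraphCode.getElem?_edges,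
    Option.map_some, Option.some.injEq, Prod.mk.injEq, ← Fin.ext_iff]
  refine and_congr (forall_congr' fun e => and_congr Iff.rfl (and_congr ?_ ?_))
    (forall_congr' fun e => imp_congr (exists_congr fun x => Fin.ext_iff.symm)
      (imp_congr (exists_congr fun x => Fin.ext_iff.symm) Iff.rfl))
  · rw [getD_ofFn (fun i => (f i : ℕ)) (p.1.toGraph.src e)]
    exact Fin.ext_iff.symm
  · rw [getD_ofFn (fun i => (f i : ℕ)) (p.1.toGraph.tgt e)]
    exact Fin.ext_iff.symm

end Codes

/-! ## Decidability of direct rewriting -/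

section Steps

variable {Λ : Type}

/-- The morphisms become maps between finite sets with elementary conditions, ready to be listed by
words. -/
theorem rewrites_iff_exists_maps {ρ : Rule Λ} {X H : DGraph Λ} : Rewrites ρ X H ↔
    ∃ (fv : ρ.L.V → X.V) (fe : ρ.L.E → X.E) (gv : ρ.R.V → H.V) (ge : ρ.R.E → H.E)
      (pv : X.V → Option H.V) (pe : X.E → Option H.E),
      (∀ e, X.lab (fe e) = ρ.L.lab e ∧ X.src (fe e) = fv (ρ.L.src e) ∧
        X.tgt (fe e) = fv (ρ.L.tgt e)) ∧
      (∀ e, H.lab (ge e) = ρ.R.lab e ∧ H.src (ge e) = gv (ρ.R.src e) ∧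
        H.tgt (ge e) = gv (ρ.R.tgt e)) ∧
      (∀ e d, pe e = some d → H.lab d = X.lab e ∧ pv (X.src e) = some (H.src d) ∧
        pv (X.tgt e) = some (H.tgt d)) ∧
      (∀ x y, fv x = fv y → (ρ.r.onV x = none ↔ ρ.r.onV y = none)) ∧
      (∀ x y, fe x = fe y → (ρ.r.onE x = none ↔ ρ.r.onE y = none)) ∧
      SetSquare ρ.r.onV (fun a => some (fv a)) (fun b => some (gv b)) pv ∧
      SetSquare ρ.r.onE (fun a => some (fe a)) (fun b => some (ge b)) pe ∧
      (∀ x, pv x = none → ∃ a, fv a = x ∧ ρ.r.onV a = none) ∧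
      (∀ e, pe e = none → (∃ a, fe a = e ∧ ρ.r.onE a = none) ∨
        pv (X.src e) = none ∨ pv (X.tgt e) = none) := by
  rw [rewrites_iff]
  constructor
  · rintro ⟨m, m', r', hm, hcf, hs⟩
    have hm' : m'.Total := ⟨hs.nodes.total, hs.edges.total⟩
    obtain ⟨fv, fe, hfv, hfe, hf⟩ := hm.exists_maps
    obtain ⟨gv, ge, hgv, hge, hg⟩ := hm'.exists_maps
    refine ⟨fv, fe, gv, ge, r'.onV, r'.onE, hf, hg, fun e d h => ⟨r'.lab_eq e d h, r'.src_eq e d h,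
      r'.tgt_eq e d h⟩, fun x y h => hcf.1 x y (by simp [hfv, h]),
      fun x y h => hcf.2 x y (by simp [hfe, h]), ?_, ?_, fun x hx => ?_, fun e he => ?_⟩
    · rw [← hfv, ← hgv]; exact hs.nodes
    · rw [← hfe, ← hge]; exact hs.edges
    · simpa [hfv] using hs.delV x hx
    · simpa [hfe] using hs.delE e he
  · rintro ⟨fv, fe, gv, ge, pv, pe, hf, hg, hp, hcv, hce, hsv, hse, hdv, hde⟩
    refine ⟨.ofMaps fv fe hf, .ofMaps gv ge hg, ⟨pv, pe, fun e d h => (hp e d h).1,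
      fun e d h => (hp e d h).2.1, fun e d h => (hp e d h).2.2⟩, ⟨fun _ => Option.some_ne_none _,
      fun _ => Option.some_ne_none _⟩, ⟨fun x y h => hcv x y (Option.some.inj h),
      fun x y h => hce x y (Option.some.inj h)⟩, hsv, hse, fun x hx => ?_, fun e he => ?_⟩
    · obtain ⟨a, ha, hr⟩ := hdv x hx
      exact ⟨a, congrArg some ha, hr⟩
    · refine (hde e he).imp_left ?_
      rintro ⟨a, ha, hr⟩
      exact ⟨a, congrArg some ha, hr⟩

end Steps

/-! ### Words that list maps out of finite types. -/

section Reading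

variable {A B : Type} [Finite A] [Finite B]

/-- The value at `a` of the map out of a finite type that is listed by the word `w`. -/
noncomputable def read (w : List ℕ) (a : A) : ℕ := w.getD (Finite.equivFin A a) 0

/-- The word that lists a map out of a finite type. -/
noncomputable def listing {N : ℕ} (f : A → Fin N) : List ℕ :=
  List.ofFn fun i => (f ((Finite.equivFin A).symm i) : ℕ)

@[simp]
theorem read_listing {N : ℕ} (f : A → Fin N) (a : A) : read (listing f) a = f a := by
  rw [read, listing, getD_ofFn, Equiv.symm_apply_apply]

theorem exists_words_listing_iff {N : ℕ} {P : List ℕ → Prop} :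
    (∃ w ∈ words (List.range N) (Nat.card A), P w) ↔ ∃ f : A → Fin N, P (listing f) := by
  rw [exists_words_range_iff]
  constructor
  · rintro ⟨f, hf⟩
    refine ⟨fun a => f (Finite.equivFin A a), ?_⟩
    simpa [listing] using hf
  · rintro ⟨f, hf⟩
    exact ⟨_, hf⟩

theorem exists_words_option_iff {N n : ℕ} {P : List (Option ℕ) → Prop} :
    (∃ w ∈ words (none :: (List.range N).map some) n, P w) ↔
      ∃ f : Fin n → Option (Fin N), P (List.ofFn fun i => (f i).map Fin.val) := by
  rw [exists_words_iff]
  constructor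
  · rintro ⟨f, hf, hP⟩
    have h : ∀ i, ∃ o : Option (Fin N), o.map Fin.val = f i := by
      intro i
      rcases List.mem_cons.1 (hf i) with h | h
      · exact ⟨none, h.symm⟩
      · obtain ⟨j, hj, hij⟩ := List.mem_map.1 h
        exact ⟨some ⟨j, List.mem_range.1 hj⟩, hij⟩
    choose g hg using h
    exact ⟨g, by simpa only [hg] using hP⟩
  · rintro ⟨f, hP⟩
    refine ⟨_, fun i => ?_, hP⟩
    cases f i <;> simp

theorem map_val_eq_some {d : ℕ} {o : Option (Fin d)} {j : Fin d} :
    o.map Fin.val = some (j : ℕ) ↔ o = some j := by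
  cases o <;> simp [Fin.ext_iff]

/-- The conditions of `SetSquare` for maps that are listed by words. -/
def WordSquare (f : A → Option B) (u v : List ℕ) (p : List (Option ℕ)) (c d : ℕ) : Prop :=
  (∀ a, (f a).map (read v) = p.getD (read u a) none) ∧
  (∀ j < d, (∃ b : B, read v b = j) ∨ ∃ i < c, p.getD i none = some j) ∧
  (∀ b b' : B, read v b = read v b' → Relation.EqvGen
    (fun b b' => ∃ a a' : A, f a = some b ∧ f a' = some b' ∧ read u a = read u a') b b') ∧
  (∀ b : B, ∀ i < c, p.getD i none = some (read v b) → ∃ a : A, read u a = i ∧ f a ≠ none) ∧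
  ∀ i < c, ∀ j < c, p.getD i none = p.getD j none →
    p.getD i none = none ∨ i = j ∨ ∃ a : A, read u a = i ∧ f a ≠ none

theorem wordSquare_iff {f : A → Option B} {c d : ℕ} {u : A → Fin c} {v : B → Fin d}
    {p : Fin c → Option (Fin d)} :
    WordSquare f (listing u) (listing v) (List.ofFn fun i => (p i).map Fin.val) c d ↔
      SetSquare f (fun a => some (u a)) (fun b => some (v b)) p := by
  have hinj : Function.Injective (Option.map (Fin.val : Fin d → ℕ)) :=
    Option.map_injective Fin.val_injective
  simp only [WordSquare, forall_lt_iff_fin, exists_lt_iff_fin, read_listing, getD_ofFn, map_val_eq_some,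
    ← Fin.ext_iff, hinj.eq_iff, Option.map_eq_none_iff]
  constructor
  · rintro ⟨h1, h2, h3, h4, h5⟩
    refine ⟨fun a => ?_, fun b => Option.some_ne_none _, fun j => ?_, fun b b' h => ?_, ?_, ?_⟩
    · apply hinj
      have := h1 a
      rw [Option.bind_some, ← this]
      cases f a <;> simp
    · simpa using h2 j
    · refine (h3 b b' (Option.some.inj h)).mono ?_
      rintro b b' ⟨a, a', h, h', hu⟩
      exact ⟨a, a', h, h', congrArg some hu⟩
    · rintro b i j hb hi
      obtain ⟨a, ha, hf⟩ := h4 b i (hi.trans hb.symm)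
      exact ⟨a, _, congrArg some ha, (Option.some_get (Option.isSome_iff_ne_none.2 hf)).symm⟩
    · rintro i i' j hi hi'
      rcases h5 i i' (hi.trans hi'.symm) with h | h | ⟨a, ha, hf⟩
      · exact absurd (h.symm.trans hi) (by simp)
      · exact .inl h
      · exact .inr ⟨a, _, congrArg some ha, (Option.some_get (Option.isSome_iff_ne_none.2 hf)).symm⟩
  · rintro h
    refine ⟨fun a => ?_, fun j => by simpa using h.surj j, fun b b' hb => ?_, fun b i hi => ?_,
      fun i i' hi => ?_⟩
    · have := congrArg (Option.map Fin.val) (h.comm a)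
      rw [Option.bind_some] at this
      rw [← this]
      cases f a <;> simp
    · refine (h.ker b b' (congrArg some hb)).mono ?_
      rintro b b' ⟨a, a', h, h', hu⟩
      exact ⟨a, a', h, h', Option.some.inj hu⟩
    · obtain ⟨a, b', ha, hf⟩ := h.mix b i _ rfl hi
      exact ⟨a, Option.some.inj ha, by simp [hf]⟩
    · rcases Option.eq_none_or_eq_some (p i) with h0 | ⟨j, hj⟩
      · exact .inl h0
      · refine .inr ((h.inj i i' j hj (hi.symm.trans hj)).imp_right ?_)
        rintro ⟨a, b, ha, hf⟩
        exact ⟨a, Option.some.inj ha, by simp [hf]⟩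

end Reading

/-! ### Deciding the square conditions on words. -/

section Primrec

variable {α : Type*} [Primcodable α] {A B : Type} [Finite A] [Finite B]

-- For each fixed `a` the position `Finite.equivFin A a` is a constant, so the arbitrary choice of
-- enumeration does no harm.
@[fun_prop]
theorem primrec_read {w : α → List ℕ} (hw : Primrec w) (a : A) : Primrec fun x => read (w x) a :=
  (Primrec.list_getD 0).comp hw (Primrec.const _)

theorem primrecPred_iff_const {P : α → Prop} (q : Prop) (hP : PrimrecPred P) :
    PrimrecPred fun x : α => (q ↔ P x) := by
  by_cases h : q
  · exact hP.of_eq fun x => by simp [h]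
  · exact hP.not.of_eq fun x => by simp [h]

theorem primrecPred_wordSquare (f : A → Option B) {u v : α → List ℕ} {p : α → List (Option ℕ)}
    {c d : α → ℕ} (hu : Primrec u) (hv : Primrec v) (hp : Primrec p) (hc : Primrec c)
    (hd : Primrec d) : PrimrecPred fun x => WordSquare f (u x) (v x) (p x) (c x) (d x) := by
  refine PrimrecPred.and ?_ (PrimrecPred.and ?_ (PrimrecPred.and ?_ (PrimrecPred.and ?_ ?_)))
  · refine primrecPred_forall_finite fun a => primrecPred_eq ?_ (by fun_prop)
    cases f a with
    | none => exact Primrec.const _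
    | some b => exact primrec_some (by fun_prop)
  · exact primrecPred_forall_lt hd (PrimrecPred.or
      (primrecPred_exists_finite fun b => primrecPred_eq (by fun_prop) (by fun_prop))
      (primrecPred_exists_lt (by fun_prop) (primrecPred_eq (by fun_prop) (by fun_prop))))
  · refine primrecPred_forall_finite fun b => primrecPred_forall_finite fun b' =>
      primrecPred_imp (primrecPred_eq (by fun_prop) (by fun_prop)) ?_
    -- The generated equivalence depends on the input only through the kernel `κ` of the listed map
    -- on the finite set `A`. There are finitely many relations `κ`, and for each of them the last
    -- condition is a constant.
    have key : PrimrecPred fun x => ∃ κ : A → A → Prop,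
        (∀ a a', κ a a' ↔ read (u x) a = read (u x) a') ∧ Relation.EqvGen
          (fun b b' => ∃ a a', f a = some b ∧ f a' = some b' ∧ κ a a') b b' := by
      refine primrecPred_exists_finite fun κ => PrimrecPred.and ?_ (primrecPred_const _)
      exact primrecPred_forall_finite fun a => primrecPred_forall_finite fun a' =>
        primrecPred_iff_const _ (primrecPred_eq (by fun_prop) (by fun_prop))
    refine key.of_eq fun x => ⟨?_, fun h => ⟨_, fun a a' => Iff.rfl, h⟩⟩
    rintro ⟨κ, hκ, h⟩
    simpa only [hκ] using h
  · exact primrecPred_forall_finite fun b => primrecPred_forall_lt hc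
      (primrecPred_imp (primrecPred_eq (by fun_prop) (by fun_prop))
        (primrecPred_exists_finite fun a => PrimrecPred.and
          (primrecPred_eq (by fun_prop) (by fun_prop)) (primrecPred_const _)))
  · exact primrecPred_forall_lt hc (primrecPred_forall_lt (by fun_prop)
      (primrecPred_imp (primrecPred_eq (by fun_prop) (by fun_prop))
        (PrimrecPred.or (primrecPred_eq (by fun_prop) (by fun_prop))
        (PrimrecPred.or (primrecPred_eq (by fun_prop) (by fun_prop))
        (primrecPred_exists_finite fun a => PrimrecPred.and
          (primrecPred_eq (by fun_prop) (by fun_prop)) (primrecPred_const _))))))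

end Primrec

/-! ### Rewriting steps as conditions on words. -/

section WordRewrites

variable {Λ : Type}

instance (G : DGraph Λ) : Finite G.V := G.finV

instance (G : DGraph Λ) : Finite G.E := G.finE

/-- The conditions for a step of `ρ` from `x` to `h` in terms of words that list the morphisms. -/
def WordRewrites (ρ : Rule Λ) (x h : ℕ × List (Λ × ℕ × ℕ)) (fv fe gv ge : List ℕ)
    (pv pe : List (Option ℕ)) : Prop :=
  (∀ e, x.2[read fe e]? = some (ρ.L.lab e, read fv (ρ.L.src e), read fv (ρ.L.tgt e))) ∧
  (∀ e, h.2[read ge e]? = some (ρ.R.lab e, read gv (ρ.R.src e), read gv (ρ.R.tgt e))) ∧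
  (∀ i < x.2.length, ∀ j < h.2.length, pe.getD i none = some j →
    (x.2[i]?.map fun t => (t.1, pv.getD t.2.1 none, pv.getD t.2.2 none)) =
      h.2[j]?.map fun t => (t.1, some t.2.1, some t.2.2)) ∧
  (∀ a b, read fv a = read fv b → (ρ.r.onV a = none ↔ ρ.r.onV b = none)) ∧
  (∀ a b, read fe a = read fe b → (ρ.r.onE a = none ↔ ρ.r.onE b = none)) ∧
  WordSquare ρ.r.onV fv gv pv x.1 h.1 ∧
  WordSquare ρ.r.onE fe ge pe x.2.length h.2.length ∧
  (∀ i < x.1, pv.getD i none = none → ∃ a, read fv a = i ∧ ρ.r.onV a = none) ∧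
  ∀ i < x.2.length, pe.getD i none = none → (∃ a, read fe a = i ∧ ρ.r.onE a = none) ∨
    (x.2[i]?.bind fun t => pv.getD t.2.1 none) = none ∨
    (x.2[i]?.bind fun t => pv.getD t.2.2 none) = none

theorem rewrites_toGraph_iff (ρ : Rule Λ) (x h : GraphCode Λ) :
    Rewrites ρ x.toGraph h.toGraph ↔
      ∃ fv ∈ words (List.range x.1.1) (Nat.card ρ.L.V),
      ∃ fe ∈ words (List.range x.1.2.length) (Nat.card ρ.L.E),
      ∃ gv ∈ words (List.range h.1.1) (Nat.card ρ.R.V),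
      ∃ ge ∈ words (List.range h.1.2.length) (Nat.card ρ.R.E),
      ∃ pv ∈ words (none :: (List.range h.1.1).map some) x.1.1,
      ∃ pe ∈ words (none :: (List.range h.1.2.length).map some) x.1.2.length,
        WordRewrites ρ x.1 h.1 fv fe gv ge pv pe := by
  rw [rewrites_iff_exists_maps]
  simp only [exists_words_listing_iff, exists_words_option_iff]
  refine exists_congr fun (fv : ρ.L.V → Fin x.1.1) =>
    exists_congr fun (fe : ρ.L.E → Fin x.1.2.length) =>
    exists_congr fun (gv : ρ.R.V → Fin h.1.1) =>
    exists_congr fun (ge : ρ.R.E → Fin h.1.2.length) =>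
    exists_congr fun (pv : Fin x.1.1 → Option (Fin h.1.1)) =>
    exists_congr fun (pe : Fin x.1.2.length → Option (Fin h.1.2.length)) => ?_
  have hread : ∀ i : x.toGraph.V, (List.ofFn fun i => (pv i).map Fin.val).getD
      (Fin.val (n := x.1.1) i) none = (pv i).map Fin.val := fun i => getD_ofFn _ _ _
  simp only [WordRewrites, wordSquare_iff, forall_lt_iff_fin, read_listing, getD_ofFn,
    GraphCode.getElem?_edges, Option.some.injEq, Prod.mk.injEq, Option.map_some, Option.bind_some,
    hread, map_val_eq_some, Option.map_eq_none_iff]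
  refine and_congr ?_ (and_congr ?_ (and_congr ?_ (and_congr ?_ (and_congr ?_
    (and_congr Iff.rfl (and_congr Iff.rfl (and_congr ?_ ?_)))))))
  · exact forall_congr' fun e => and_congr Iff.rfl (and_congr Fin.ext_iff Fin.ext_iff)
  · exact forall_congr' fun e => and_congr Iff.rfl (and_congr Fin.ext_iff Fin.ext_iff)
  · exact forall₂_congr fun e d => imp_congr Iff.rfl (and_congr eq_comm
      (and_congr map_val_eq_some.symm map_val_eq_some.symm))
  · exact forall₂_congr fun a b => imp_congr Fin.ext_iff Iff.rfl
  · exact forall₂_congr fun a b => imp_congr Fin.ext_iff Iff.rfl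
  · exact forall_congr' fun i => imp_congr Iff.rfl
      (exists_congr fun a => and_congr Fin.ext_iff Iff.rfl)
  · exact forall_congr' fun i => imp_congr Iff.rfl
      (or_congr (exists_congr fun a => and_congr Fin.ext_iff Iff.rfl) Iff.rfl)

theorem primrecPred_wordRewrites [Primcodable Λ] {α : Type*} [Primcodable α] (ρ : Rule Λ)
    {x h : α → ℕ × List (Λ × ℕ × ℕ)} {fv fe gv ge : α → List ℕ} {pv pe : α → List (Option ℕ)}
    (hx : Primrec x) (hh : Primrec h) (hfv : Primrec fv) (hfe : Primrec fe) (hgv : Primrec gv)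
    (hge : Primrec ge) (hpv : Primrec pv) (hpe : Primrec pe) :
    PrimrecPred fun a => WordRewrites ρ (x a) (h a) (fv a) (fe a) (gv a) (ge a) (pv a) (pe a) := by
  refine PrimrecPred.and ?_ (PrimrecPred.and ?_ (PrimrecPred.and ?_ (PrimrecPred.and ?_
    (PrimrecPred.and ?_ (PrimrecPred.and ?_ (PrimrecPred.and ?_ (PrimrecPred.and ?_ ?_)))))))
  · exact primrecPred_forall_finite fun e => primrecPred_eq (by fun_prop) (by fun_prop)
  · exact primrecPred_forall_finite fun e => primrecPred_eq (by fun_prop) (by fun_prop)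
  · exact primrecPred_forall_lt (by fun_prop) (primrecPred_forall_lt (by fun_prop)
      (primrecPred_imp (primrecPred_eq (by fun_prop) (by fun_prop))
        (primrecPred_eq (by fun_prop) (by fun_prop))))
  · exact primrecPred_forall_finite fun a => primrecPred_forall_finite fun b =>
      primrecPred_imp (primrecPred_eq (by fun_prop) (by fun_prop)) (primrecPred_const _)
  · exact primrecPred_forall_finite fun a => primrecPred_forall_finite fun b =>
      primrecPred_imp (primrecPred_eq (by fun_prop) (by fun_prop)) (primrecPred_const _)
  · exact primrecPred_wordSquare _ hfv hgv hpv (by fun_prop) (by fun_prop)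
  · exact primrecPred_wordSquare _ hfe hge hpe (by fun_prop) (by fun_prop)
  · exact primrecPred_forall_lt (by fun_prop) (primrecPred_imp
      (primrecPred_eq (by fun_prop) (by fun_prop)) (primrecPred_exists_finite fun a =>
        PrimrecPred.and (primrecPred_eq (by fun_prop) (by fun_prop)) (primrecPred_const _)))
  · refine primrecPred_forall_lt (by fun_prop) (primrecPred_imp
      (primrecPred_eq (by fun_prop) (by fun_prop)) (PrimrecPred.or ?_ (PrimrecPred.or
        (primrecPred_eq (by fun_prop) (by fun_prop)) (primrecPred_eq (by fun_prop) (by fun_prop)))))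
    exact primrecPred_exists_finite fun a => PrimrecPred.and
      (primrecPred_eq (by fun_prop) (by fun_prop)) (primrecPred_const _)

theorem primrecPred_rewrites [Primcodable Λ] {α : Type*} [Primcodable α] (ρ : Rule Λ)
    {x h : α → GraphCode Λ} (hx : Primrec x) (hh : Primrec h) :
    PrimrecPred fun a => Rewrites ρ (x a).toGraph (h a).toGraph := by
  simp only [rewrites_toGraph_iff]
  refine primrecPred_exists_mem (by fun_prop) (primrecPred_exists_mem (by fun_prop)
    (primrecPred_exists_mem (by fun_prop) (primrecPred_exists_mem (by fun_prop)
    (primrecPred_exists_mem (by fun_prop) (primrecPred_exists_mem (by fun_prop)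
    (primrecPred_wordRewrites ρ ?_ ?_ ?_ ?_ ?_ ?_ ?_ ?_)))))) <;> fun_prop

end WordRewrites

/-! ## Enumeration of codes and the effective pred-basis -/

theorem SetSquare.card_le {A B C D : Type*} [Finite B] [Finite C] {f : A → Option B}
    {g : A → Option C} {g' : B → Option D} {f' : C → Option D} (h : SetSquare f g g' f') :
    Nat.card D ≤ Nat.card C + Nat.card B := by
  have hd : ∀ d, ∃ s : C ⊕ B, Sum.elim f' g' s = some d := by
    intro d
    rcases h.surj d with ⟨b, hb⟩ | ⟨c, hc⟩
    · exact ⟨.inr b, hb⟩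
    · exact ⟨.inl c, hc⟩
  choose t ht using hd
  rw [← Nat.card_sum]
  exact Nat.card_le_card_of_injective t fun d d' hdd =>
    Option.some.inj ((ht d).symm.trans ((congrArg _ hdd).trans (ht d')))

/-! ### Invariance under isomorphism and growth of graphs in a step. -/

section Transport

variable {Λ : Type} {ρ : Rule Λ} {X H H' : DGraph Λ}

theorem Rewrites.of_iso (h : Rewrites ρ X H) (φ : GIso H H') : Rewrites ρ X H' := by
  obtain ⟨m, m', r', hm, hcf, hs⟩ := rewrites_iff.1 h
  have hφ := φ.indEmb
  have hV : ∀ o : Option H.V, o.bind φ.toPHom.onV = none → o = none := by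
    rintro (_ | x) h
    · rfl
    · exact absurd h (hφ.total.1 x)
  refine rewrites_iff.2 ⟨m, φ.toPHom.comp m', φ.toPHom.comp r', hm, hcf,
    hs.nodes.map_bijective hφ.total.1 hφ.injV fun y => ⟨φ.onV.symm y, by simp [GIso.toPHom]⟩,
    hs.edges.map_bijective hφ.total.2 hφ.injE fun y => ⟨φ.onE.symm y, by simp [GIso.toPHom]⟩,
    fun x hx => hs.delV x (hV _ hx), fun e he => ?_⟩
  have he' : r'.onE e = none := by
    cases h : r'.onE e with
    | none => rfl
    | some d => simp [h, GIso.toPHom] at he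
  refine (hs.delE e he').imp_right (Or.imp ?_ ?_) <;> intro h <;> simp [h]

theorem Rewrites.card_le (h : Rewrites ρ X H) :
    Nat.card H.V ≤ Nat.card X.V + Nat.card ρ.R.V ∧ Nat.card H.E ≤ Nat.card X.E + Nat.card ρ.R.E := by
  obtain ⟨m, m', r', hm, hcf, hs⟩ := rewrites_iff.1 h
  exact ⟨hs.nodes.card_le, hs.edges.card_le⟩

theorem GIso.card_eq (φ : GIso H H') :
    Nat.card H.V = Nat.card H'.V ∧ Nat.card H.E = Nat.card H'.E :=
  ⟨Nat.card_congr φ.onV, Nat.card_congr φ.onE⟩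

theorem GraphCode.card_eq (c : GraphCode Λ) :
    Nat.card c.toGraph.V = c.1.1 ∧ Nat.card c.toGraph.E = c.1.2.length :=
  ⟨Nat.card_fin _, Nat.card_fin _⟩

end Transport

/-! ### Codes of bounded size and the basis of predecessors. -/

section Enumeration

variable {Λ : Type}

/-- The code with `n` nodes and the admissible edges of a given list. -/
def restrictCode (n : ℕ) (l : List (Λ × ℕ × ℕ)) : GraphCode Λ :=
  ⟨(n, l.filter fun e => e.2.1 < n ∧ e.2.2 < n), fun e he => by
    simpa using (List.mem_filter.1 he).2⟩

/-- The possible edges on `n` nodes with labels from `l`. -/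
def edgeList (l : List Λ) (n : ℕ) : List (Λ × ℕ × ℕ) :=
  l.flatMap fun a => (List.range n).flatMap fun i => (List.range n).map fun j => (a, i, j)

/-- The codes with at most `N` nodes and at most `M` edges whose labels lie in `l`. -/
def codesUpTo (l : List Λ) (N M : ℕ) : List (GraphCode Λ) :=
  (List.range (N + 1)).flatMap fun n => (List.range (M + 1)).flatMap fun m =>
    (words (edgeList l n) m).map (restrictCode n)

/-- The filter in `restrictCode` changes nothing on the edge list of a genuine code. -/
theorem mem_codesUpTo {l : List Λ} (hl : ∀ a, a ∈ l) {N M : ℕ} {c : GraphCode Λ} (hN : c.1.1 ≤ N)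
    (hM : c.1.2.length ≤ M) : c ∈ codesUpTo l N M := by
  refine List.mem_flatMap.2 ⟨c.1.1, List.mem_range.2 (by omega), List.mem_flatMap.2
    ⟨c.1.2.length, List.mem_range.2 (by omega), List.mem_map.2 ⟨c.1.2, mem_words.2 ⟨rfl, ?_⟩, ?_⟩⟩⟩
  · rintro ⟨a, i, j⟩ he
    have h := c.2 _ he
    simpa [edgeList, hl] using h
  · refine Subtype.ext (Prod.ext rfl (List.filter_eq_self.2 fun e he => ?_))
    simpa using c.2 e he

/-- A step adds at most as many items as `R` has, and results may be replaced by isomorphic ones, so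
the search for a result is bounded. -/
theorem exists_rewrites_iff {l : List Λ} (hl : ∀ a, a ∈ l) (ρ : Rule Λ) (x q : GraphCode Λ) :
    (∃ H, Rewrites ρ x.toGraph H ∧ IndSub q.toGraph H) ↔
      ∃ h ∈ codesUpTo l (x.1.1 + Nat.card ρ.R.V) (x.1.2.length + Nat.card ρ.R.E),
        Rewrites ρ x.toGraph h.toGraph ∧ IndSub q.toGraph h.toGraph := by
  constructor
  · rintro ⟨H, hH, hq⟩
    obtain ⟨h, ⟨φ⟩⟩ := GraphCode.exists_iso H
    have h1 := hH.card_le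
    rw [← φ.card_eq.1, ← φ.card_eq.2, h.card_eq.1, h.card_eq.2, x.card_eq.1, x.card_eq.2] at h1
    exact ⟨h, mem_codesUpTo hl h1.1 h1.2, hH.of_iso φ.symm, hq.trans φ.symm.indSub⟩
  · rintro ⟨h, -, hr, hq⟩
    exact ⟨_, hr, hq⟩

theorem mem_pred_up_singleton {rules : Set (Rule Λ)} {G K : DGraph Λ} :
    G ∈ (gts rules).pred ((gts rules).up {K}) ↔
      ∃ ρ : rules, ∃ H, Rewrites ρ.1 G H ∧ IndSub K H := by
  constructor
  · rintro ⟨H, hH, ρ, hρ, hr⟩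
    exact ⟨⟨ρ, hρ⟩, H, hr, mem_up_singleton.1 hH⟩
  · rintro ⟨⟨ρ, hρ⟩, H, hr, hH⟩
    exact ⟨H, mem_up_singleton.2 hH, ρ, hρ, hr⟩

variable [Primcodable Λ] {α : Type*} [Primcodable α]

@[fun_prop]
theorem primrec_restrictCode {f : α → ℕ} {g : α → List (Λ × ℕ × ℕ)} (hf : Primrec f)
    (hg : Primrec g) : Primrec fun a => restrictCode (f a) (g a) := by
  classical
  refine Primrec.subtype_mk (hp := primrecPred_graphCode Λ) (Primrec.pair hf ?_)
  have h : PrimrecPred fun x : α × Λ × ℕ × ℕ => x.2.2.1 < f x.1 ∧ x.2.2.2 < f x.1 :=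
    PrimrecPred.and (Primrec.nat_lt.comp (by fun_prop) (by fun_prop))
      (Primrec.nat_lt.comp (by fun_prop) (by fun_prop))
  exact (primrec_filter (P := fun a e => e.2.1 < f a ∧ e.2.2 < f a) hg h).of_eq fun a => by
    congr!

@[fun_prop]
theorem primrec_codesUpTo (l : List Λ) {f g : α → ℕ} (hf : Primrec f) (hg : Primrec g) :
    Primrec fun a => codesUpTo l (f a) (g a) := by
  unfold codesUpTo edgeList
  fun_prop

theorem primrecPred_mem_pred [Finite Λ] {rules : Set (Rule Λ)} (hrules : rules.Finite)
    {x q : α → GraphCode Λ} (hx : Primrec x) (hq : Primrec q) :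
    PrimrecPred fun a => (x a).toGraph ∈ (gts rules).pred ((gts rules).up {(q a).toGraph}) := by
  obtain ⟨l, -, hl⟩ := Finite.exists_univ_list Λ
  have := hrules.to_subtype
  simp only [mem_pred_up_singleton, exists_rewrites_iff hl]
  refine primrecPred_exists_finite fun ρ => primrecPred_exists_mem (by fun_prop)
    ((primrecPred_rewrites ρ.1 (by fun_prop) (by fun_prop)).and ?_)
  exact primrecPred_indSub.comp (f := fun y : α × GraphCode Λ => (q y.1, y.2)) (by fun_prop)

/-- By `Rewrites.exists_induce`, predecessors in `Q` with at most `K + |q|` nodes already generate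
all of them; `K` bounds the left-hand sides. All candidates of that size are listed and tested. -/
theorem effectiveQPredBasis_gts [Finite Λ] (n k : ℕ) {rules : Set (Rule Λ)}
    (hrules : rules.Finite) :
    EffectiveQPredBasis (gts rules) (GraphCode.toGraph (Λ := Λ)) (boundedGraphs Λ n k) := by
  classical
  obtain ⟨l, -, hl⟩ := Finite.exists_univ_list Λ
  obtain ⟨K, hK⟩ : ∃ K, ∀ ρ ∈ rules, Nat.card ρ.L.V ≤ K := by
    obtain ⟨K, hK⟩ := (hrules.image fun ρ => Nat.card ρ.L.V).bddAbove
    exact ⟨K, fun ρ hρ => hK ⟨ρ, hρ, rfl⟩⟩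
  let N : GraphCode Λ → ℕ := fun q => K + q.1.1
  have hT := isRestrictedWSTS_gts n k rules
  refine ⟨fun q => (codesUpTo l (N q) (k * (Nat.card Λ * (N q * N q)))).filter fun c =>
    c.toGraph ∈ boundedGraphs Λ n k ∧
      c.toGraph ∈ (gts rules).pred ((gts rules).up {q.toGraph}), ?_, fun q _ => ⟨?_, ?_⟩⟩
  · refine (primrec_filter (P := fun q (c : GraphCode Λ) => c.toGraph ∈ boundedGraphs Λ n k ∧
      c.toGraph ∈ (gts rules).pred ((gts rules).up {GraphCode.toGraph q})) (by fun_prop) ?_).to_comp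
    exact ((primrecPred_mem_boundedGraphs n k).comp Primrec.snd).and
      (primrecPred_mem_pred hrules Primrec.snd Primrec.fst)
  · intro b hb
    exact (of_decide_eq_true (List.mem_filter.1 hb).2).1
  · refine Set.Subset.antisymm ?_ ?_
    · rintro G ⟨X, ⟨hX, hXQ⟩, hXG⟩
      obtain ⟨⟨ρ, hρ⟩, H, hr, hqH⟩ := mem_pred_up_singleton.1 hX
      obtain ⟨W, H₁, hr₁, hqH₁, hW⟩ := hr.exists_induce hqH
      obtain ⟨b, ⟨φ⟩⟩ := GraphCode.exists_iso (X.induce W)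
      -- The step is moved from the induced subgraph to its code by compatibility, an isomorphism
      -- being a special case of the order.
      obtain ⟨H₂, hr₂, hH₂⟩ := hr₁.exists_of_indSub φ.symm.indSub
      have hbX : IndSub b.toGraph X := φ.indSub.trans (indSub_induce X W)
      have hbQ : b.toGraph ∈ boundedGraphs Λ n k := hT.downClosed _ _ hbX hXQ
      have hV : b.1.1 ≤ N q := by
        rw [← b.card_eq.1, φ.card_eq.1]
        refine hW.trans ?_
        rw [q.card_eq.1]
        exact Nat.add_le_add_right (hK ρ hρ) _
      have hE : b.1.2.length ≤ k * (Nat.card Λ * (N q * N q)) := by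
        have := hbQ.2.card_edges_le
        rw [b.card_eq.1, b.card_eq.2] at this
        exact this.trans (Nat.mul_le_mul_left _ (Nat.mul_le_mul_left _ (Nat.mul_le_mul hV hV)))
      refine (mem_up_codedSet (T := gts rules)).2 ⟨b, List.mem_filter.2 ⟨mem_codesUpTo hl hV hE,
        decide_eq_true ⟨hbQ, mem_pred_up_singleton.2 ⟨⟨ρ, hρ⟩, H₂, hr₂, hqH₁.trans hH₂⟩⟩⟩,
        hbX.trans hXG⟩
    · intro G hG
      obtain ⟨b, hb, hbG⟩ := (mem_up_codedSet (T := gts rules)).1 hG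
      have h := of_decide_eq_true (List.mem_filter.1 hb).2
      exact ⟨_, ⟨h.2, h.1⟩, hbG⟩

end Enumeration

end GraphWSTS

theorem mainTheorem7 {Λ : Type} [Finite Λ] [Primcodable Λ] (n k : ℕ)
    (rules : Set (Rule Λ)) (hrules : rules.Finite) :
    -- the system is a restricted WSTS, with decidable restriction and decidable order
    IsRestrictedWSTS (gts rules) (boundedGraphs Λ n k) ∧
    (ComputablePred fun c : GraphCode Λ => c.toGraph ∈ boundedGraphs Λ n k) ∧
    (ComputablePred fun p : GraphCode Λ × GraphCode Λ => IndSub p.1.toGraph p.2.toGraph) ∧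
    -- it has an effective pred-basis relative to the bounded graphs
    EffectiveQPredBasis (gts rules) (GraphCode.toGraph (Λ := Λ)) (boundedGraphs Λ n k) ∧
    -- the results on the coverability problems apply
    CoverabilityResults (gts rules) (GraphCode.toGraph (Λ := Λ)) (boundedGraphs Λ n k) ∧
    -- computation of the minimal pushout complements by saturation
    (∀ (L R G : DGraph Λ) (r : PHom L R) (m' : PHom R G), m'.Total →
      ∃ N : ℕ,
        saturation r m' n k (N + 1) = saturation r m' n k N ∧
        (∃ l : List (DGraph Λ), ∀ X ∈ objects (saturation r m' n k N),
          ∃ Y ∈ l, Nonempty (GIso X Y)) ∧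
        (∀ P ∈ saturation r m' n k N, P.IsComplement) ∧
        indMinimal (objects (saturation r m' n k N) ∩ boundedGraphs Λ n k) =
          indMinimal (objects {P : Completion r m' | P.IsComplement} ∩ boundedGraphs Λ n k)) := 
  ⟨isRestrictedWSTS_gts n k rules, (primrecPred_mem_boundedGraphs n k).computablePred,
    primrecPred_indSub.computablePred, effectiveQPredBasis_gts n k hrules,
    coverabilityResults (isRestrictedWSTS_gts n k rules)
      (primrecPred_mem_boundedGraphs n k).computablePred primrecPred_indSub.computablePred,
    fun _ _ _ r m' _ => saturation_spec r m' n k⟩
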